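/- All algebras are over $\mathbb C$, not necessarily unital, with non-degenerate product; $M(X)$ is the multiplier algebra of $X$. Let $(A,\Delta)$ be an algebraic quantum group: a regular multiplier Hopf algebra (that is, $\Delta:A\to M(A\otimes A)$ is a coassociative homomorphism such that the four maps sending $a\otimes a'$ to $\Delta(a)(1\otimes a')$, $(a\otimes 1)\Delta(a')$, $\Delta(a)(a'\otimes 1)$, $(1\otimes a)\Delta(a')$ are bijections of $A\otimes A$ onto $A\otimes A$) with a left integral, i.e. a non-zero linear functional $\varphi$ on $A$ such that $(\iota\otimes\varphi)\Delta(a)=\varphi(a)1$ for all $a\in A$. Let $B=\widehat A=\{\varphi(\,\cdot\,c): c\in A\}$ be the dual, paired with $A$ by $\langle a,b\rangle=b(a)$, with the product dual to the coproduct of $A$: for $b=\varphi(\,\cdot\,c)$ and $b'=\varphi(\,\cdot\,c')$, $$\langle a,bb'\rangle=\langle\Delta(a),b\otimes b'\rangle=(\varphi\otimes\varphi)(\Delta(a)(c\otimes c')).$$ For a pairing of an algebra $X$ with a vector space $Y$ on which $X$ acts by $\langle x',x\triangleright y\rangle=\langle x'x,y\rangle$ and $\langle x',y\triangleleft x\rangle=\langle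 xx',y\rangle$, the pairing is extended to $M(X)\times Y$ by $\langle m,x\triangleright y\rangle=\langle mx,y\rangle$ and $\langle m,y\triangleleft x\rangle=\langle xm,y\rangle$. These extensions are used below for $X=B\otimes B$, $Y=A\otimes A$ and for $X=B\otimes A$, $Y=A\otimes B$. Then: 1. There is a unique homomorphism $\Delta:B\to M(B\otimes B)$ (the coproduct of $B$) such that $\langle a\otimes a',\Delta(b)\rangle=\langle aa',b\rangle$ for all $a,a'\in A$ and $b\in B$. 2. There is a unique element $V\in M(B\otimes A)$ (the duality) such that $\langle V,a\otimes b\rangle=\langle a,b\rangle$ for all $a\in A$ and $b\in B$. 3. The homomorphisms $\iota\otimes\Delta:B\otimes A\to M(B\otimes A\otimes A)$ and $\Delta\otimes\iota:B\otimes A\to M(B\otimes B\otimes A)$ are non-degenerate (a homomorphism $\alpha:X\to M(Y)$ is non-degenerate if $\alpha(X)Y=Y=Y\alpha(X)$, with products of subspaces meaning linear spans; it then extends uniquely to a unital homomorphism $M(X)\to M(Y)$), and their extensions to $M(B\otimes A)$ satisfy $$(\iota\otimes\Delta)V=V_{12}V_{13}\ \text{ in } M(B\otimes A\otimes A),\qquad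 (\Delta\otimes\iota)V=V_{13}V_{23}\ \text{ in } M(B\otimes B\otimes A).$$ Here the leg numbering notation is used: $V_{12}=V\otimes 1$, $V_{23}=1\otimes V$, and $V_{13}$ is obtained from $V\otimes 1$ by flipping the last two tensor factors. -/

import Mathlib

open scoped TensorProduct

noncomputable section


namespace MultiplierHopf

/-! ### Non-degenerate algebras and multiplier algebras

An algebra over `ℂ`, not assumed to be unital, is a type `X` with
`[NonUnitalRing X] [Module ℂ X] [IsScalarTower ℂ X X] [SMulCommClass ℂ X X]`. -/

/-- The product of `X` is non-degenerate. -/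
class NondegenerateMul (X : Type*) [NonUnitalRing X] : Prop where
  eq_zero_of_mul_right : ∀ x : X, (∀ y, x * y = 0) → x = 0
  eq_zero_of_mul_left : ∀ x : X, (∀ y, y * x = 0) → x = 0

section Multipliers

variable (X : Type*) [NonUnitalRing X] [Module ℂ X] [IsScalarTower ℂ X X] [SMulCommClass ℂ X X]

/-- The multiplier algebra `M(X)`: pairs `(L, R)` of linear maps, `L x = m x` and `R x = x m`,
with `m (x y) = (m x) y`, `(x y) m = x (y m)` and `(x m) y = x (m y)`. The second component lives
in the opposite algebra, so that the product is the one of multipliers: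
`(m n) x = m (n x)` and `x (m n) = (x m) n`. -/
def multiplierAlgebra : Subalgebra ℂ (Module.End ℂ X × (Module.End ℂ X)ᵐᵒᵖ) where
  carrier := {p | (∀ x y, p.1 (x * y) = p.1 x * y) ∧
    (∀ x y, p.2.unop (x * y) = x * p.2.unop y) ∧ ∀ x y, p.2.unop x * y = x * p.1 y}
  mul_mem' := by
    rintro p q ⟨h1, h2, h3⟩ ⟨k1, k2, k3⟩
    exact ⟨fun x y => by simp [h1, k1], fun x y => by simp [h2, k2],
      fun x y => by simp [h3, k3]⟩
  add_mem' := by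
    rintro p q ⟨h1, h2, h3⟩ ⟨k1, k2, k3⟩
    exact ⟨fun x y => by simp [h1, k1, add_mul], fun x y => by simp [h2, k2, mul_add],
      fun x y => by simp [h3, k3, add_mul, mul_add]⟩
  algebraMap_mem' := fun r =>
    ⟨fun x y => by simp [Algebra.algebraMap_eq_smul_one, smul_mul_assoc],
      fun x y => by simp [Algebra.algebraMap_eq_smul_one, mul_smul_comm],
      fun x y => by simp [Algebra.algebraMap_eq_smul_one, mul_smul_comm, smul_mul_assoc]⟩

/-- The multiplier algebra `M(X)` as a type. -/
def Mult : Type _ := ↥(multiplierAlgebra X)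

instance : Ring (Mult X) := inferInstanceAs (Ring ↥(multiplierAlgebra X))

instance : Algebra ℂ (Mult X) := inferInstanceAs (Algebra ℂ ↥(multiplierAlgebra X))

instance : NonUnitalNonAssocSemiring (Mult X) := inferInstance

instance : Module ℂ (Mult X) := inferInstance

instance : DistribMulAction ℂ (Mult X) := inferInstance

variable {X}

/-- `m.lmul x` is the element `m x` of `X`. -/
def Mult.lmul (m : Mult X) : X →ₗ[ℂ] X := m.1.1

/-- `m.rmul x` is the element `x m` of `X`. -/
def Mult.rmul (m : Mult X) : X →ₗ[ℂ] X := m.1.2.unop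

theorem Mult.lmul_mul_apply (m : Mult X) (x y : X) : m.lmul (x * y) = m.lmul x * y := m.2.1 x y

theorem Mult.rmul_mul_apply (m : Mult X) (x y : X) : m.rmul (x * y) = x * m.rmul y := m.2.2.1 x y

theorem Mult.rmul_mul (m : Mult X) (x y : X) : m.rmul x * y = x * m.lmul y := m.2.2.2 x y

theorem Mult.ext {m n : Mult X} (h1 : ∀ x, m.lmul x = n.lmul x) (h2 : ∀ x, m.rmul x = n.rmul x) :
    m = n :=
  Subtype.ext (Prod.ext (LinearMap.ext h1) (MulOpposite.unop_injective (LinearMap.ext h2)))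

/-- The multiplier with the given left and right multiplication maps. -/
def Mult.mk (L R : X →ₗ[ℂ] X) (h1 : ∀ x y, L (x * y) = L x * y)
    (h2 : ∀ x y, R (x * y) = x * R y) (h3 : ∀ x y, R x * y = x * L y) : Mult X :=
  ⟨(L, MulOpposite.op R), h1, h2, h3⟩

@[simp] theorem Mult.lmul_mk (L R : X →ₗ[ℂ] X) (h1 h2 h3) (x : X) :
    (Mult.mk L R h1 h2 h3).lmul x = L x := rfl

@[simp] theorem Mult.rmul_mk (L R : X →ₗ[ℂ] X) (h1 h2 h3) (x : X) :
    (Mult.mk L R h1 h2 h3).rmul x = R x := rfl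

@[simp] theorem Mult.lmul_mul (m n : Mult X) (x : X) : (m * n).lmul x = m.lmul (n.lmul x) := rfl

@[simp] theorem Mult.rmul_mul' (m n : Mult X) (x : X) : (m * n).rmul x = n.rmul (m.rmul x) := rfl

@[simp] theorem Mult.lmul_one (x : X) : (1 : Mult X).lmul x = x := rfl

@[simp] theorem Mult.rmul_one (x : X) : (1 : Mult X).rmul x = x := rfl

@[simp] theorem Mult.lmul_zero (x : X) : (0 : Mult X).lmul x = 0 := rfl

@[simp] theorem Mult.rmul_zero (x : X) : (0 : Mult X).rmul x = 0 := rfl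

@[simp] theorem Mult.lmul_add (m n : Mult X) (x : X) :
    (m + n).lmul x = m.lmul x + n.lmul x := rfl

@[simp] theorem Mult.rmul_add (m n : Mult X) (x : X) :
    (m + n).rmul x = m.rmul x + n.rmul x := rfl

@[simp] theorem Mult.lmul_smul (r : ℂ) (m : Mult X) (x : X) :
    (r • m).lmul x = r • m.lmul x := rfl

@[simp] theorem Mult.rmul_smul (r : ℂ) (m : Mult X) (x : X) :
    (r • m).rmul x = r • m.rmul x := rfl

variable (X) in
/-- The canonical homomorphism `X → M(X)` (injective when the product is non-degenerate). -/
def incl : X →ₙₐ[ℂ] Mult X where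
  toFun x := Mult.mk (LinearMap.mulLeft ℂ x) (LinearMap.mulRight ℂ x)
    (fun y z => by simp [mul_assoc]) (fun y z => by simp [mul_assoc])
    (fun y z => by simp [mul_assoc])
  map_smul' r x := Mult.ext (fun y => smul_mul_assoc r x y) (fun y => mul_smul_comm r y x)
  map_zero' := Mult.ext (fun y => zero_mul y) (fun y => mul_zero y)
  map_add' x y := Mult.ext (fun z => add_mul x y z) (fun z => mul_add z x y)
  map_mul' x y := Mult.ext (fun z => mul_assoc x y z) (fun z => (mul_assoc z x y).symm)

@[simp] theorem lmul_incl (x y : X) : (incl X x).lmul y = x * y := rfl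

@[simp] theorem rmul_incl (x y : X) : (incl X x).rmul y = y * x := rfl

end Multipliers

/-! ### Tensor products and leg numbering -/

section Tensor

variable {X : Type*} [NonUnitalRing X] [Module ℂ X] [IsScalarTower ℂ X X] [SMulCommClass ℂ X X]
variable {Y : Type*} [NonUnitalRing Y] [Module ℂ Y] [IsScalarTower ℂ Y Y] [SMulCommClass ℂ Y Y]
variable {Z : Type*} [NonUnitalRing Z] [Module ℂ Z] [IsScalarTower ℂ Z Z] [SMulCommClass ℂ Z Z]
variable {W : Type*} [NonUnitalRing W] [Module ℂ W] [IsScalarTower ℂ W W] [SMulCommClass ℂ W W]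

instance instNonUnitalRingTensor : NonUnitalRing (X ⊗[ℂ] Y) :=
  Algebra.TensorProduct.instNonUnitalRing

instance instIsScalarTowerTensor : IsScalarTower ℂ (X ⊗[ℂ] Y) (X ⊗[ℂ] Y) := inferInstance

instance instSMulCommClassTensor : SMulCommClass ℂ (X ⊗[ℂ] Y) (X ⊗[ℂ] Y) := inferInstance

/-- The multiplier `m ⊗ n` of `X ⊗ Y`, for `m ∈ M(X)` and `n ∈ M(Y)`. -/
def tmul (m : Mult X) (n : Mult Y) : Mult (X ⊗[ℂ] Y) :=
  Mult.mk (TensorProduct.map m.lmul n.lmul) (TensorProduct.map m.rmul n.rmul)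
    (fun s t => by
      induction s with
      | zero => simp
      | add s s' h h' => simp only [add_mul, map_add, h, h']
      | tmul x y =>
        induction t with
        | zero => simp
        | add t t' h h' => simp only [mul_add, map_add, h, h']
        | tmul x' y' => simp [m.lmul_mul_apply, n.lmul_mul_apply])
    (fun s t => by
      induction s with
      | zero => simp
      | add s s' h h' => simp only [add_mul, map_add, h, h']
      | tmul x y =>
        induction t with
        | zero => simp
        | add t t' h h' => simp only [mul_add, map_add, h, h']
        | tmul x' y' => simp [m.rmul_mul_apply, n.rmul_mul_apply])
    (fun s t => by
      induction s with
      | zero => simp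
      | add s s' h h' => simp only [add_mul, map_add, h, h']
      | tmul x y =>
        induction t with
        | zero => simp
        | add t t' h h' => simp only [mul_add, map_add, h, h']
        | tmul x' y' => simp [m.rmul_mul, n.rmul_mul])

@[simp] theorem lmul_tmul (m : Mult X) (n : Mult Y) (x : X) (y : Y) :
    (tmul m n).lmul (x ⊗ₜ[ℂ] y) = m.lmul x ⊗ₜ[ℂ] n.lmul y := rfl

@[simp] theorem rmul_tmul (m : Mult X) (n : Mult Y) (x : X) (y : Y) :
    (tmul m n).rmul (x ⊗ₜ[ℂ] y) = m.rmul x ⊗ₜ[ℂ] n.rmul y := rfl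

theorem Mult.ext_tmul {m n : Mult (X ⊗[ℂ] Y)}
    (h1 : ∀ x y, m.lmul (x ⊗ₜ[ℂ] y) = n.lmul (x ⊗ₜ[ℂ] y))
    (h2 : ∀ x y, m.rmul (x ⊗ₜ[ℂ] y) = n.rmul (x ⊗ₜ[ℂ] y)) : m = n := by
  have e1 : m.lmul = n.lmul := TensorProduct.ext' h1
  have e2 : m.rmul = n.rmul := TensorProduct.ext' h2
  exact Mult.ext (fun x => by rw [e1]) (fun x => by rw [e2])

/-- The tensor product `f ⊗ g : X ⊗ Y → M(Z ⊗ W)` of two homomorphisms `f : X → M(Z)` and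
`g : Y → M(W)`, given by `x ⊗ y ↦ f x ⊗ g y`. -/
def tensorHom (f : X →ₙₐ[ℂ] Mult Z) (g : Y →ₙₐ[ℂ] Mult W) :
    X ⊗[ℂ] Y →ₙₐ[ℂ] Mult (Z ⊗[ℂ] W) :=
  let F : X ⊗[ℂ] Y →ₗ[ℂ] Mult (Z ⊗[ℂ] W) := TensorProduct.lift
    (LinearMap.mk₂ ℂ (fun x y => tmul (f x) (g y))
      (fun x x' y => Mult.ext_tmul (by simp [TensorProduct.add_tmul])
        (by simp [TensorProduct.add_tmul]))
      (fun r x y => Mult.ext_tmul (by simp [TensorProduct.smul_tmul'])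
        (by simp [TensorProduct.smul_tmul']))
      (fun x y y' => Mult.ext_tmul (by simp [TensorProduct.tmul_add])
        (by simp [TensorProduct.tmul_add]))
      (fun r x y => Mult.ext_tmul (by simp) (by simp)))
  { F with
    map_zero' := F.map_zero
    map_mul' := fun s t => by
      change F (s * t) = F s * F t
      induction s with
      | zero => simp
      | add s s' h h' => simp only [add_mul, map_add, h, h']
      | tmul x y =>
        induction t with
        | zero => simp
        | add t t' h h' => simp only [mul_add, map_add, h, h']
        | tmul x' y' =>
          have hF : ∀ x y, F (x ⊗ₜ[ℂ] y) = tmul (f x) (g y) := fun _ _ => rfl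
          rw [Algebra.TensorProduct.tmul_mul_tmul, hF, hF, hF, map_mul, map_mul]
          exact Mult.ext_tmul (by simp) (by simp) }

@[simp] theorem tensorHom_tmul (f : X →ₙₐ[ℂ] Mult Z) (g : Y →ₙₐ[ℂ] Mult W) (x : X) (y : Y) :
    tensorHom f g (x ⊗ₜ[ℂ] y) = tmul (f x) (g y) := rfl

/-- The isomorphism `M(X) ≅ M(Y)` induced by an isomorphism `e : X ≅ Y` of algebras. -/
def Mult.congr (e : X ≃ₗ[ℂ] Y) (he : ∀ x x', e (x * x') = e x * e x') :
    Mult X →ₐ[ℂ] Mult Y where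
  toFun m := Mult.mk (e.toLinearMap ∘ₗ m.lmul ∘ₗ e.symm.toLinearMap)
    (e.toLinearMap ∘ₗ m.rmul ∘ₗ e.symm.toLinearMap)
    (fun x y => by
      obtain ⟨x, rfl⟩ := e.surjective x
      obtain ⟨y, rfl⟩ := e.surjective y
      simp [← he, m.lmul_mul_apply])
    (fun x y => by
      obtain ⟨x, rfl⟩ := e.surjective x
      obtain ⟨y, rfl⟩ := e.surjective y
      simp [← he, m.rmul_mul_apply])
    (fun x y => by
      obtain ⟨x, rfl⟩ := e.surjective x
      obtain ⟨y, rfl⟩ := e.surjective y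
      simp [← he, m.rmul_mul])
  map_one' := Mult.ext (fun x => by simp) (fun x => by simp)
  map_mul' m n := Mult.ext (fun x => by simp) (fun x => by simp)
  map_zero' := Mult.ext (fun x => e.map_zero) (fun x => e.map_zero)
  map_add' m n := Mult.ext (fun x => by simp) (fun x => by simp)
  commutes' r := Mult.ext (fun x => by simp [Algebra.algebraMap_eq_smul_one])
    (fun x => by simp [Algebra.algebraMap_eq_smul_one])

theorem assoc_mul (s t : (X ⊗[ℂ] Y) ⊗[ℂ] Z) :
    TensorProduct.assoc ℂ X Y Z (s * t) =
      TensorProduct.assoc ℂ X Y Z s * TensorProduct.assoc ℂ X Y Z t := by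
  induction s with
  | zero => simp
  | add s s' h h' => simp only [add_mul, map_add, h, h']
  | tmul p z =>
    induction t with
    | zero => simp
    | add t t' h h' => simp only [mul_add, map_add, h, h']
    | tmul q z' =>
      induction p with
      | zero => simp
      | add s s' h h' => simp only [add_mul, map_add, h, h', TensorProduct.add_tmul]
      | tmul x y =>
        induction q with
        | zero => simp
        | add t t' h h' => simp only [mul_add, map_add, h, h', TensorProduct.add_tmul]
        | tmul x' y' => simp

/-- The identification `M((X ⊗ Y) ⊗ Z) = M(X ⊗ (Y ⊗ Z))`. -/
def multAssoc : Mult ((X ⊗[ℂ] Y) ⊗[ℂ] Z) →ₐ[ℂ] Mult (X ⊗[ℂ] (Y ⊗[ℂ] Z)) :=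
  Mult.congr (TensorProduct.assoc ℂ X Y Z) assoc_mul

theorem congr_comm_mul (s t : X ⊗[ℂ] (Y ⊗[ℂ] Z)) :
    TensorProduct.congr (LinearEquiv.refl ℂ X) (TensorProduct.comm ℂ Y Z) (s * t) =
      TensorProduct.congr (LinearEquiv.refl ℂ X) (TensorProduct.comm ℂ Y Z) s *
      TensorProduct.congr (LinearEquiv.refl ℂ X) (TensorProduct.comm ℂ Y Z) t := by
  induction s with
  | zero => simp
  | add s s' h h' => simp only [add_mul, map_add, h, h']
  | tmul x p =>
    induction t with
    | zero => simp
    | add t t' h h' => simp only [mul_add, map_add, h, h']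
    | tmul x' q =>
      induction p with
      | zero => simp
      | add s s' h h' => simp only [add_mul, map_add, h, h', TensorProduct.tmul_add]
      | tmul y z =>
        induction q with
        | zero => simp
        | add t t' h h' => simp only [mul_add, map_add, h, h', TensorProduct.tmul_add]
        | tmul y' z' => simp

/-- The map `ι ⊗ ζ : M(X ⊗ (Y ⊗ Z)) → M(X ⊗ (Z ⊗ Y))`, with `ζ` the flip. -/
def multFlip : Mult (X ⊗[ℂ] (Y ⊗[ℂ] Z)) →ₐ[ℂ] Mult (X ⊗[ℂ] (Z ⊗[ℂ] Y)) :=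
  Mult.congr (TensorProduct.congr (LinearEquiv.refl ℂ X) (TensorProduct.comm ℂ Y Z))
    congr_comm_mul

variable (Z) in
/-- `E₁₂ = E ⊗ 1`. -/
def leg12 (E : Mult (X ⊗[ℂ] Y)) : Mult (X ⊗[ℂ] (Y ⊗[ℂ] Z)) := multAssoc (tmul E 1)

variable (Z) in
/-- `E₁₃ = (ι ⊗ ζ)(E₁₂)`. -/
def leg13 (E : Mult (X ⊗[ℂ] Y)) : Mult (X ⊗[ℂ] (Z ⊗[ℂ] Y)) := multFlip (leg12 Z E)

variable (Z) in
/-- `E₂₃ = 1 ⊗ E`. -/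
def leg23 (E : Mult (X ⊗[ℂ] Y)) : Mult (Z ⊗[ℂ] (X ⊗[ℂ] Y)) := tmul 1 E

end Tensor

/-! ### Non-degeneracy of tensor products and extension to multiplier algebras -/

section Extension

/-- A jointly injective family of linear maps on `X` stays jointly injective on `X ⊗ Y`. -/
theorem rTensor_separating {X X' Y ι : Type*} [AddCommGroup X] [Module ℂ X] [AddCommGroup X']
    [Module ℂ X'] [AddCommGroup Y] [Module ℂ Y] (f : ι → X →ₗ[ℂ] X')
    (hf : ∀ x, (∀ i, f i x = 0) → x = 0) (t : X ⊗[ℂ] Y) (ht : ∀ i, (f i).rTensor Y t = 0) :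
    t = 0 := by
  classical
  let b := Module.Basis.ofVectorSpace ℂ Y
  have key : ∀ (i : ι) (s : X ⊗[ℂ] Y) (j),
      TensorProduct.equivFinsuppOfBasisRight b ((f i).rTensor Y s) j =
        f i (TensorProduct.equivFinsuppOfBasisRight b s j) := by
    intro i s j
    induction s with
    | zero => simp
    | add s s' h h' => simp only [map_add, Finsupp.add_apply, h, h']
    | tmul x y => simp
  apply (TensorProduct.equivFinsuppOfBasisRight b).injective
  ext j
  rw [map_zero]
  exact hf _ fun i => by rw [← key, ht, map_zero]; rfl

theorem lTensor_separating {X X' Y ι : Type*} [AddCommGroup X] [Module ℂ X] [AddCommGroup X']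
    [Module ℂ X'] [AddCommGroup Y] [Module ℂ Y] (f : ι → X →ₗ[ℂ] X')
    (hf : ∀ x, (∀ i, f i x = 0) → x = 0) (t : Y ⊗[ℂ] X) (ht : ∀ i, (f i).lTensor Y t = 0) :
    t = 0 := by
  apply (TensorProduct.comm ℂ Y X).injective
  rw [map_zero]
  refine rTensor_separating f hf _ fun i => ?_
  have : (f i).rTensor Y (TensorProduct.comm ℂ Y X t)
      = TensorProduct.comm ℂ Y X' ((f i).lTensor Y t) := by
    generalize t = t
    induction t with
    | zero => simp
    | add s s' h h' => simp only [map_add, h, h']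
    | tmul x y => simp
  rw [this, ht, map_zero]

variable {X : Type*} [NonUnitalRing X] [Module ℂ X] [IsScalarTower ℂ X X] [SMulCommClass ℂ X X]
variable {Y : Type*} [NonUnitalRing Y] [Module ℂ Y] [IsScalarTower ℂ Y Y] [SMulCommClass ℂ Y Y]

instance [NondegenerateMul X] [NondegenerateMul Y] : NondegenerateMul (X ⊗[ℂ] Y) where
  eq_zero_of_mul_right t ht := by
    refine rTensor_separating (fun x : X => LinearMap.mulRight ℂ x)
      (fun x h => NondegenerateMul.eq_zero_of_mul_right x h) t fun x => ?_
    refine lTensor_separating (fun y : Y => LinearMap.mulRight ℂ y)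
      (fun y h => NondegenerateMul.eq_zero_of_mul_right y h) _ fun y => ?_
    rw [← ht (x ⊗ₜ y)]
    generalize t = t
    induction t with
    | zero => simp
    | add s s' h h' => simp only [map_add, add_mul, h, h']
    | tmul x y => simp
  eq_zero_of_mul_left t ht := by
    refine rTensor_separating (fun x : X => LinearMap.mulLeft ℂ x)
      (fun x h => NondegenerateMul.eq_zero_of_mul_left x h) t fun x => ?_
    refine lTensor_separating (fun y : Y => LinearMap.mulLeft ℂ y)
      (fun y h => NondegenerateMul.eq_zero_of_mul_left y h) _ fun y => ?_
    rw [← ht (x ⊗ₜ y)]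
    generalize t = t
    induction t with
    | zero => simp
    | add s s' h h' => simp only [map_add, mul_add, h, h']
    | tmul x y => simp

/-- A homomorphism `α : X → M(Y)` is non-degenerate if `α(X) Y = Y = Y α(X)`. -/
structure IsNondegenerateHom (α : X →ₙₐ[ℂ] Mult Y) : Prop where
  span_lmul : Submodule.span ℂ {z : Y | ∃ x y, z = (α x).lmul y} = ⊤
  span_rmul : Submodule.span ℂ {z : Y | ∃ x y, z = (α x).rmul y} = ⊤

namespace IsNondegenerateHom

variable {α : X →ₙₐ[ℂ] Mult Y}

/-- The map `X ⊗ Y → Y`, `x ⊗ y ↦ α(x) y`. -/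
def lact (α : X →ₙₐ[ℂ] Mult Y) : X ⊗[ℂ] Y →ₗ[ℂ] Y :=
  TensorProduct.lift (LinearMap.mk₂ ℂ (fun x y => (α x).lmul y) (by simp) (by simp) (by simp)
    (by simp))

/-- The map `X ⊗ Y → Y`, `x ⊗ y ↦ y α(x)`. -/
def ract (α : X →ₙₐ[ℂ] Mult Y) : X ⊗[ℂ] Y →ₗ[ℂ] Y :=
  TensorProduct.lift (LinearMap.mk₂ ℂ (fun x y => (α x).rmul y) (by simp) (by simp) (by simp)
    (by simp))

@[simp] theorem lact_tmul (x : X) (y : Y) : lact α (x ⊗ₜ[ℂ] y) = (α x).lmul y := rfl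

@[simp] theorem ract_tmul (x : X) (y : Y) : ract α (x ⊗ₜ[ℂ] y) = (α x).rmul y := rfl

theorem lact_surjective (h : IsNondegenerateHom α) : Function.Surjective (lact α) := by
  rw [← LinearMap.range_eq_top, eq_top_iff, ← h.span_lmul, Submodule.span_le]
  rintro z ⟨x, y, rfl⟩
  exact ⟨x ⊗ₜ y, rfl⟩

theorem ract_surjective (h : IsNondegenerateHom α) : Function.Surjective (ract α) := by
  rw [← LinearMap.range_eq_top, eq_top_iff, ← h.span_rmul, Submodule.span_le]
  rintro z ⟨x, y, rfl⟩
  exact ⟨x ⊗ₜ y, rfl⟩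

/-- `(y α(x)) (α(m x') y') = (y α(x m)) (α(x') y')`. -/
theorem ract_mul_lact (m : Mult X) (s t : X ⊗[ℂ] Y) :
    ract α s * lact α (m.lmul.rTensor Y t) = ract α (m.rmul.rTensor Y s) * lact α t := by
  induction s with
  | zero => simp
  | add s s' h h' => simp only [map_add, add_mul, h, h']
  | tmul x y =>
    induction t with
    | zero => simp
    | add t t' h h' => simp only [map_add, mul_add, h, h']
    | tmul x' y' =>
      simp only [LinearMap.rTensor_tmul, lact_tmul, ract_tmul, Mult.rmul_mul]
      rw [← Mult.lmul_mul, ← Mult.lmul_mul, ← map_mul, ← map_mul, m.rmul_mul]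

variable [NondegenerateMul Y]

theorem lact_ker (h : IsNondegenerateHom α) (m : Mult X) (t : X ⊗[ℂ] Y) (ht : lact α t = 0) :
    lact α (m.lmul.rTensor Y t) = 0 := by
  refine NondegenerateMul.eq_zero_of_mul_left _ fun y => ?_
  obtain ⟨s, rfl⟩ := h.ract_surjective y
  rw [ract_mul_lact, ht, mul_zero]

theorem ract_ker (h : IsNondegenerateHom α) (m : Mult X) (t : X ⊗[ℂ] Y) (ht : ract α t = 0) :
    ract α (m.rmul.rTensor Y t) = 0 := by
  refine NondegenerateMul.eq_zero_of_mul_right _ fun y => ?_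
  obtain ⟨s, rfl⟩ := h.lact_surjective y
  rw [← ract_mul_lact, ht, zero_mul]

/-- The left multiplication `α(x) y ↦ α(m x) y` by the extension of `α` at `m`. -/
def extendL (h : IsNondegenerateHom α) (m : Mult X) : Y →ₗ[ℂ] Y :=
  (LinearMap.ker (lact α)).liftQ (lact α ∘ₗ m.lmul.rTensor Y)
    (fun t ht => h.lact_ker m t ht) ∘ₗ
    ((lact α).quotKerEquivOfSurjective h.lact_surjective).symm.toLinearMap

/-- The right multiplication `y α(x) ↦ y α(x m)` by the extension of `α` at `m`. -/
def extendR (h : IsNondegenerateHom α) (m : Mult X) : Y →ₗ[ℂ] Y :=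
  (LinearMap.ker (ract α)).liftQ (ract α ∘ₗ m.rmul.rTensor Y)
    (fun t ht => h.ract_ker m t ht) ∘ₗ
    ((ract α).quotKerEquivOfSurjective h.ract_surjective).symm.toLinearMap

theorem extendL_lact (h : IsNondegenerateHom α) (m : Mult X) (t : X ⊗[ℂ] Y) :
    h.extendL m (lact α t) = lact α (m.lmul.rTensor Y t) := by
  have : ((lact α).quotKerEquivOfSurjective h.lact_surjective).symm (lact α t)
      = Submodule.Quotient.mk t := by
    rw [LinearEquiv.symm_apply_eq]; rfl
  simp only [extendL, LinearMap.comp_apply, LinearEquiv.coe_coe, this]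
  rfl

theorem extendR_ract (h : IsNondegenerateHom α) (m : Mult X) (t : X ⊗[ℂ] Y) :
    h.extendR m (ract α t) = ract α (m.rmul.rTensor Y t) := by
  have : ((ract α).quotKerEquivOfSurjective h.ract_surjective).symm (ract α t)
      = Submodule.Quotient.mk t := by
    rw [LinearEquiv.symm_apply_eq]; rfl
  simp only [extendR, LinearMap.comp_apply, LinearEquiv.coe_coe, this]
  rfl

theorem lact_mul (t : X ⊗[ℂ] Y) (y : Y) :
    lact α t * y = lact α ((LinearMap.mulRight ℂ y).lTensor X t) := by
  induction t with
  | zero => simp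
  | add t t' h h' => simp only [map_add, add_mul, h, h']
  | tmul x y' => simp [Mult.lmul_mul_apply]

theorem mul_ract (t : X ⊗[ℂ] Y) (y : Y) :
    y * ract α t = ract α ((LinearMap.mulLeft ℂ y).lTensor X t) := by
  induction t with
  | zero => simp
  | add t t' h h' => simp only [map_add, mul_add, h, h']
  | tmul x y' => simp [Mult.rmul_mul_apply]

/-- The unique extension `M(X) → M(Y)` of a non-degenerate homomorphism `α : X → M(Y)`. At a
multiplier `m` it is given by `α(x) y ↦ α(m x) y` and `y α(x) ↦ y α(x m)`. -/
def extend (h : IsNondegenerateHom α) : Mult X →ₐ[ℂ] Mult Y where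
  toFun m := Mult.mk (h.extendL m) (h.extendR m)
    (fun y y' => by
      obtain ⟨t, rfl⟩ := h.lact_surjective y
      rw [lact_mul, extendL_lact, extendL_lact, lact_mul]
      congr 1
      rw [← LinearMap.comp_apply, ← LinearMap.comp_apply, LinearMap.rTensor_comp_lTensor,
        LinearMap.lTensor_comp_rTensor])
    (fun y y' => by
      obtain ⟨t, rfl⟩ := h.ract_surjective y'
      rw [mul_ract, extendR_ract, extendR_ract, mul_ract]
      congr 1
      rw [← LinearMap.comp_apply, ← LinearMap.comp_apply, LinearMap.rTensor_comp_lTensor,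
        LinearMap.lTensor_comp_rTensor])
    (fun y y' => by
      obtain ⟨s, rfl⟩ := h.ract_surjective y
      obtain ⟨t, rfl⟩ := h.lact_surjective y'
      rw [extendR_ract, extendL_lact, ract_mul_lact])
  map_one' := by
    refine Mult.ext (fun y => ?_) (fun y => ?_)
    · obtain ⟨t, rfl⟩ := h.lact_surjective y
      rw [Mult.lmul_mk, extendL_lact]
      exact congrArg _ (LinearMap.rTensor_id_apply Y X t)
    · obtain ⟨t, rfl⟩ := h.ract_surjective y
      rw [Mult.rmul_mk, extendR_ract]
      exact congrArg _ (LinearMap.rTensor_id_apply Y X t)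
  map_mul' m n := by
    refine Mult.ext (fun y => ?_) (fun y => ?_)
    · obtain ⟨t, rfl⟩ := h.lact_surjective y
      simp only [Mult.lmul_mk, Mult.lmul_mul, extendL_lact]
      exact congrArg _ (LinearMap.rTensor_comp_apply Y m.lmul n.lmul t)
    · obtain ⟨t, rfl⟩ := h.ract_surjective y
      simp only [Mult.rmul_mk, Mult.rmul_mul', extendR_ract]
      exact congrArg _ (LinearMap.rTensor_comp_apply Y n.rmul m.rmul t)
  map_zero' := by
    refine Mult.ext (fun y => ?_) (fun y => ?_)
    · obtain ⟨t, rfl⟩ := h.lact_surjective y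
      rw [Mult.lmul_mk, extendL_lact]
      change lact α ((0 : X →ₗ[ℂ] X).rTensor Y t) = 0
      simp
    · obtain ⟨t, rfl⟩ := h.ract_surjective y
      rw [Mult.rmul_mk, extendR_ract]
      change ract α ((0 : X →ₗ[ℂ] X).rTensor Y t) = 0
      simp
  map_add' m n := by
    refine Mult.ext (fun y => ?_) (fun y => ?_)
    · obtain ⟨t, rfl⟩ := h.lact_surjective y
      simp only [Mult.lmul_mk, Mult.lmul_add, extendL_lact]
      rw [← map_add, ← LinearMap.add_apply, ← LinearMap.rTensor_add]; rfl
    · obtain ⟨t, rfl⟩ := h.ract_surjective y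
      simp only [Mult.rmul_mk, Mult.rmul_add, extendR_ract]
      rw [← map_add, ← LinearMap.add_apply, ← LinearMap.rTensor_add]; rfl
  commutes' r := by
    refine Mult.ext (fun y => ?_) (fun y => ?_)
    · obtain ⟨t, rfl⟩ := h.lact_surjective y
      rw [Mult.lmul_mk, extendL_lact]
      change lact α ((r • (LinearMap.id : X →ₗ[ℂ] X)).rTensor Y t) = r • lact α t
      simp [LinearMap.rTensor_smul]
    · obtain ⟨t, rfl⟩ := h.ract_surjective y
      rw [Mult.rmul_mk, extendR_ract]
      change ract α ((r • (LinearMap.id : X →ₗ[ℂ] X)).rTensor Y t) = r • ract α t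
      simp [LinearMap.rTensor_smul]

theorem extend_lmul (h : IsNondegenerateHom α) (m : Mult X) (x : X) (y : Y) :
    (h.extend m).lmul ((α x).lmul y) = (α (m.lmul x)).lmul y :=
  h.extendL_lact m (x ⊗ₜ y)

theorem extend_rmul (h : IsNondegenerateHom α) (m : Mult X) (x : X) (y : Y) :
    (h.extend m).rmul ((α x).rmul y) = (α (m.rmul x)).rmul y :=
  h.extendR_ract m (x ⊗ₜ y)

end IsNondegenerateHom

end Extension

/-! ### Algebraic quantum groups -/

section QuantumGroup

/-- A regular multiplier Hopf algebra: an algebra `A` with a non-degenerate product and a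
homomorphism `Δ : A → M(A ⊗ A)`, coassociative, such that each of the four maps
`a ⊗ b ↦ Δ(a)(1 ⊗ b)`, `a ⊗ b ↦ (a ⊗ 1)Δ(b)`, `a ⊗ b ↦ Δ(a)(b ⊗ 1)`, `a ⊗ b ↦ (1 ⊗ a)Δ(b)`
is a bijection from `A ⊗ A` to `A ⊗ A` (so that, in particular, all these products lie in
`A ⊗ A`). Coassociativity is the equation
`(a ⊗ 1 ⊗ 1) (Δ ⊗ ι)(Δ(b)(1 ⊗ c)) = (ι ⊗ Δ)((a ⊗ 1)Δ(b)) (1 ⊗ 1 ⊗ c)` in `M(A ⊗ A ⊗ A)`. -/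
structure RegularMultiplierHopfAlgebra (A : Type*) [NonUnitalRing A] [Module ℂ A]
    [IsScalarTower ℂ A A] [SMulCommClass ℂ A A] [NondegenerateMul A] where
  /-- The coproduct `Δ`. -/
  comul : A →ₙₐ[ℂ] Mult (A ⊗[ℂ] A)
  exists_equiv_comul_mul_right : ∃ T : (A ⊗[ℂ] A) ≃ₗ[ℂ] (A ⊗[ℂ] A), ∀ a b,
    incl (A ⊗[ℂ] A) (T (a ⊗ₜ[ℂ] b)) = comul a * tmul 1 (incl A b)
  exists_equiv_left_mul_comul : ∃ T : (A ⊗[ℂ] A) ≃ₗ[ℂ] (A ⊗[ℂ] A), ∀ a b,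
    incl (A ⊗[ℂ] A) (T (a ⊗ₜ[ℂ] b)) = tmul (incl A a) 1 * comul b
  exists_equiv_comul_mul_left : ∃ T : (A ⊗[ℂ] A) ≃ₗ[ℂ] (A ⊗[ℂ] A), ∀ a b,
    incl (A ⊗[ℂ] A) (T (a ⊗ₜ[ℂ] b)) = comul a * tmul (incl A b) 1
  exists_equiv_right_mul_comul : ∃ T : (A ⊗[ℂ] A) ≃ₗ[ℂ] (A ⊗[ℂ] A), ∀ a b,
    incl (A ⊗[ℂ] A) (T (a ⊗ₜ[ℂ] b)) = tmul 1 (incl A a) * comul b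
  coassoc : ∀ (a b c : A) (s t : A ⊗[ℂ] A),
    incl (A ⊗[ℂ] A) s = comul b * tmul 1 (incl A c) →
    incl (A ⊗[ℂ] A) t = tmul (incl A a) 1 * comul b →
    tmul (incl A a) 1 * multAssoc (tensorHom comul (incl A) s) =
      tensorHom (incl A) comul t * tmul 1 (tmul 1 (incl A c))

/-- The map `ι ⊗ φ : A ⊗ A → A` for a linear functional `φ` on `A`. -/
def sliceRight {A : Type*} [AddCommGroup A] [Module ℂ A] (φ : A →ₗ[ℂ] ℂ) : A ⊗[ℂ] A →ₗ[ℂ] A :=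
  (TensorProduct.rid ℂ A).toLinearMap ∘ₗ φ.lTensor A

@[simp] theorem sliceRight_tmul {A : Type*} [AddCommGroup A] [Module ℂ A] (φ : A →ₗ[ℂ] ℂ)
    (a b : A) : sliceRight φ (a ⊗ₜ[ℂ] b) = φ b • a := by simp [sliceRight]

/-- The functional `φ ⊗ φ' : A ⊗ A' → ℂ`. -/
def tensorFunctional {A A' : Type*} [AddCommGroup A] [Module ℂ A] [AddCommGroup A'] [Module ℂ A']
    (φ : A →ₗ[ℂ] ℂ) (φ' : A' →ₗ[ℂ] ℂ) : A ⊗[ℂ] A' →ₗ[ℂ] ℂ :=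
  LinearMap.mul' ℂ ℂ ∘ₗ TensorProduct.map φ φ'

@[simp] theorem tensorFunctional_tmul {A A' : Type*} [AddCommGroup A] [Module ℂ A]
    [AddCommGroup A'] [Module ℂ A'] (φ : A →ₗ[ℂ] ℂ) (φ' : A' →ₗ[ℂ] ℂ) (a : A) (a' : A') :
    tensorFunctional φ φ' (a ⊗ₜ[ℂ] a') = φ a * φ' a' := rfl

/-- An algebraic quantum group: a regular multiplier Hopf algebra with a (fixed) left integral,
that is, a non-zero linear functional `φ` with `(ι ⊗ φ)Δ(a) = φ(a) 1` in `M(A)` for all `a`.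
The two invariance fields say that this equation holds after multiplying with any `b ∈ A` from the
right, respectively from the left. -/
structure AlgebraicQuantumGroup (A : Type*) [NonUnitalRing A] [Module ℂ A]
    [IsScalarTower ℂ A A] [SMulCommClass ℂ A A] [NondegenerateMul A]
    extends RegularMultiplierHopfAlgebra A where
  /-- The left integral `φ`. -/
  integral : A →ₗ[ℂ] ℂ
  integral_ne_zero : integral ≠ 0
  left_invariant : ∀ (a b : A) (t : A ⊗[ℂ] A),
    incl (A ⊗[ℂ] A) t = comul a * tmul (incl A b) 1 → sliceRight integral t = integral a • b
  left_invariant' : ∀ (a b : A) (t : A ⊗[ℂ] A),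
    incl (A ⊗[ℂ] A) t = tmul (incl A b) 1 * comul a → sliceRight integral t = integral a • b

namespace AlgebraicQuantumGroup

variable {A : Type*} [NonUnitalRing A] [Module ℂ A] [IsScalarTower ℂ A A] [SMulCommClass ℂ A A]
  [NondegenerateMul A] (Q : AlgebraicQuantumGroup A)

/-! ### The dual -/

/-- The linear map `c ↦ φ(· c)` from `A` to its linear dual. -/
def toDual : A →ₗ[ℂ] Module.Dual ℂ A :=
  LinearMap.mk₂ ℂ (fun c a => Q.integral (a * c)) (by simp [mul_add]) (by simp [mul_smul_comm])
    (by simp [add_mul]) (by simp [smul_mul_assoc])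

@[simp] theorem toDual_apply (c a : A) : Q.toDual c a = Q.integral (a * c) := rfl

/-- The dual `Â = {φ(· c) | c ∈ A}` as a vector space. -/
def Dual : Type _ := ↥(LinearMap.range Q.toDual)

instance : AddCommGroup Q.Dual := inferInstanceAs (AddCommGroup ↥(LinearMap.range Q.toDual))

instance : Module ℂ Q.Dual := inferInstanceAs (Module ℂ ↥(LinearMap.range Q.toDual))

/-- The element `φ(· c)` of `Â`. -/
def fourier : A →ₗ[ℂ] Q.Dual := Q.toDual.rangeRestrict

/-- The pairing `⟨a, b⟩ = b(a)` of `A` with `Â`. -/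
def pairing : A →ₗ[ℂ] Q.Dual →ₗ[ℂ] ℂ := (LinearMap.range Q.toDual).subtype.flip

@[simp] theorem pairing_fourier (a c : A) : Q.pairing a (Q.fourier c) = Q.integral (a * c) := rfl

theorem fourier_surjective : Function.Surjective Q.fourier := Q.toDual.surjective_rangeRestrict

theorem Dual.ext {b b' : Q.Dual} (h : ∀ a, Q.pairing a b = Q.pairing a b') : b = b' :=
  Subtype.ext (LinearMap.ext h)

/-- The functional `a ↦ (φ ⊗ φ)(Δ(a)(c ⊗ c'))`. -/
def convolution (c c' : A) : Module.Dual ℂ A where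
  toFun a := tensorFunctional Q.integral Q.integral ((Q.comul a).lmul (c ⊗ₜ[ℂ] c'))
  map_add' a a' := by simp
  map_smul' r a := by simp

theorem eq_of_mul {X : Type*} [NonUnitalRing X] [NondegenerateMul X] {s t : X}
    (h : ∀ x, s * x = t * x) : s = t := by
  rw [← sub_eq_zero]
  exact NondegenerateMul.eq_zero_of_mul_right _ fun x => by rw [sub_mul, h, sub_self]

theorem eq_of_mul_tmul {s t : A ⊗[ℂ] A} (h : ∀ x y, s * (x ⊗ₜ y) = t * (x ⊗ₜ y)) : s = t := by
  refine eq_of_mul fun z => ?_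
  induction z with
  | zero => simp
  | add z z' h h' => simp only [mul_add, h, h']
  | tmul x y => exact h x y

theorem rTensor_mulRight_mul (c x y : A) (s : A ⊗[ℂ] A) :
    (LinearMap.mulRight ℂ c).rTensor A s * (x ⊗ₜ y) = s * ((c * x) ⊗ₜ y) := by
  induction s with
  | zero => simp
  | add s t h h' => simp only [map_add, add_mul, h, h']
  | tmul p q => simp [mul_assoc]

theorem lTensor_mulRight_mul (c x y : A) (s : A ⊗[ℂ] A) :
    (LinearMap.mulRight ℂ c).lTensor A s * (x ⊗ₜ y) = s * (x ⊗ₜ (c * y)) := by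
  induction s with
  | zero => simp
  | add s t h h' => simp only [map_add, add_mul, h, h']
  | tmul p q => simp [mul_assoc]

theorem lmul_lTensor_mulRight (m : Mult (A ⊗[ℂ] A)) (z : A) (w : A ⊗[ℂ] A) :
    m.lmul ((LinearMap.mulRight ℂ z).lTensor A w) =
      (LinearMap.mulRight ℂ z).lTensor A (m.lmul w) := by
  refine eq_of_mul_tmul fun x y => ?_
  rw [← Mult.lmul_mul_apply, lTensor_mulRight_mul, lTensor_mulRight_mul, Mult.lmul_mul_apply]

theorem integral_slice (t : A ⊗[ℂ] A) : tensorFunctional Q.integral Q.integral t =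
    Q.integral (sliceRight Q.integral t) := by
  induction t with
  | zero => simp
  | add s t h h' => simp only [map_add, h, h']
  | tmul a b => simp [mul_comm]

/-- `φ(· c) φ(· c')` is again of the form `φ(· d)`. -/
theorem exists_convolution_eq (c c' : A) : ∃ d, Q.toDual d = Q.convolution c c' := by
  obtain ⟨T, hT⟩ := Q.exists_equiv_comul_mul_left
  have key : ∀ w : A ⊗[ℂ] A, ∃ d, ∀ a, Q.integral (a * d) =
      tensorFunctional Q.integral Q.integral ((Q.comul a).lmul (T w)) := by
    intro w
    induction w with
    | zero => exact ⟨0, by simp⟩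
    | add s t h h' =>
      obtain ⟨d, hd⟩ := h
      obtain ⟨d', hd'⟩ := h'
      exact ⟨d + d', fun a => by simp only [mul_add, map_add, hd, hd']⟩
    | tmul p q =>
      refine ⟨Q.integral q • p, fun a => ?_⟩
      have : (Q.comul a).lmul (T (p ⊗ₜ q)) = T ((a * p) ⊗ₜ q) := by
        refine eq_of_mul fun z => ?_
        rw [← Mult.lmul_mul_apply, ← lmul_incl, ← lmul_incl, hT, hT, map_mul, mul_assoc]
        rfl
      rw [this, integral_slice, Q.left_invariant (a * p) q _ (hT _ _)]
      simp [mul_smul_comm, mul_comm]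
  obtain ⟨w, hw⟩ := T.surjective (c ⊗ₜ c')
  obtain ⟨d, hd⟩ := key w
  exact ⟨d, LinearMap.ext fun a => by rw [toDual_apply, hd, hw]; rfl⟩

/-- The product `φ(· c) φ(· c')` in `Â`. -/
def conv (c c' : A) : Q.Dual := ⟨Q.convolution c c', Q.exists_convolution_eq c c'⟩

@[simp] theorem pairing_conv (a c c' : A) : Q.pairing a (Q.conv c c') =
    tensorFunctional Q.integral Q.integral ((Q.comul a).lmul (c ⊗ₜ[ℂ] c')) := rfl

theorem conv_add (c c' d : A) : Q.conv c (c' + d) = Q.conv c c' + Q.conv c d := by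
  refine Dual.ext Q fun a => ?_
  simp only [pairing_conv, map_add, TensorProduct.tmul_add]

theorem add_conv (c c' d : A) : Q.conv (c + c') d = Q.conv c d + Q.conv c' d := by
  refine Dual.ext Q fun a => ?_
  simp only [pairing_conv, map_add, TensorProduct.add_tmul]

theorem conv_smul (r : ℂ) (c c' : A) : Q.conv c (r • c') = r • Q.conv c c' := by
  refine Dual.ext Q fun a => ?_
  simp only [pairing_conv, map_smul, TensorProduct.tmul_smul]

theorem smul_conv (r : ℂ) (c c' : A) : Q.conv (r • c) c' = r • Q.conv c c' := by
  refine Dual.ext Q fun a => ?_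
  simp only [pairing_conv, map_smul, TensorProduct.smul_tmul, TensorProduct.tmul_smul]

/-- If `Δ(a)(1 ⊗ c') = s`, then `⟨a, φ(· c) φ(· c')⟩ = (φ(· c) ⊗ φ)(s)`. -/
theorem pairing_conv_of_right (a c c' : A) (s : A ⊗[ℂ] A)
    (hs : incl (A ⊗[ℂ] A) s = Q.comul a * tmul 1 (incl A c')) :
    Q.pairing a (Q.conv c c') = tensorFunctional (Q.toDual c) Q.integral s := by
  have h1 : (Q.comul a).lmul (c ⊗ₜ c') = (LinearMap.mulRight ℂ c).rTensor A s := by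
    refine eq_of_mul_tmul fun x y => ?_
    rw [← Mult.lmul_mul_apply, rTensor_mulRight_mul, ← lmul_incl s, hs]
    simp
  rw [pairing_conv, h1]
  generalize s = s
  induction s with
  | zero => simp
  | add s t h h' => simp only [map_add, h, h']
  | tmul p q => simp

/-- If `Δ(a)(c ⊗ 1) = t`, then `⟨a, φ(· c) φ(· c')⟩ = (φ ⊗ φ(· c'))(t)`. -/
theorem pairing_conv_of_left (a c c' : A) (t : A ⊗[ℂ] A)
    (ht : incl (A ⊗[ℂ] A) t = Q.comul a * tmul (incl A c) 1) :
    Q.pairing a (Q.conv c c') = tensorFunctional Q.integral (Q.toDual c') t := by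
  have h1 : (Q.comul a).lmul (c ⊗ₜ c') = (LinearMap.mulRight ℂ c').lTensor A t := by
    refine eq_of_mul_tmul fun x y => ?_
    rw [← Mult.lmul_mul_apply, lTensor_mulRight_mul, ← lmul_incl t, ht]
    simp
  rw [pairing_conv, h1]
  generalize t = t
  induction t with
  | zero => simp
  | add s t h h' => simp only [map_add, h, h']
  | tmul p q => simp

theorem exists_right (a b : A) :
    ∃ s, incl (A ⊗[ℂ] A) s = Q.comul a * tmul 1 (incl A b) := by
  obtain ⟨T, hT⟩ := Q.exists_equiv_comul_mul_right
  exact ⟨_, hT a b⟩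

theorem exists_left (a b : A) :
    ∃ s, incl (A ⊗[ℂ] A) s = Q.comul a * tmul (incl A b) 1 := by
  obtain ⟨T, hT⟩ := Q.exists_equiv_comul_mul_left
  exact ⟨_, hT a b⟩

theorem exists_left_mul (a b : A) :
    ∃ s, incl (A ⊗[ℂ] A) s = tmul (incl A a) 1 * Q.comul b := by
  obtain ⟨T, hT⟩ := Q.exists_equiv_left_mul_comul
  exact ⟨_, hT a b⟩

theorem toDual_eq_of_fourier_eq {c d : A} (h : Q.fourier c = Q.fourier d) :
    Q.toDual c = Q.toDual d := congrArg Subtype.val h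

theorem conv_congr {c c' d d' : A} (h : Q.fourier c = Q.fourier d)
    (h' : Q.fourier c' = Q.fourier d') : Q.conv c c' = Q.conv d d' := by
  refine Dual.ext Q fun a => ?_
  obtain ⟨s, hs⟩ := Q.exists_right a c'
  obtain ⟨t, ht⟩ := Q.exists_left a d
  rw [Q.pairing_conv_of_right a c c' s hs, Q.toDual_eq_of_fourier_eq h,
    ← Q.pairing_conv_of_right a d c' s hs, Q.pairing_conv_of_left a d c' t ht,
    Q.toDual_eq_of_fourier_eq h', ← Q.pairing_conv_of_left a d d' t ht]

/-- The product of `Â`, dual to the coproduct of `A`: for `b = φ(· c)` and `b' = φ(· c')`,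
`⟨a, b b'⟩ = ⟨Δ(a), b ⊗ b'⟩ = (φ ⊗ φ)(Δ(a)(c ⊗ c'))`. It does not depend on the choice of `c`
and `c'`. -/
instance : Mul Q.Dual where
  mul b b' := Q.conv (Q.fourier_surjective b).choose (Q.fourier_surjective b').choose

theorem fourier_mul_fourier (c c' : A) : Q.fourier c * Q.fourier c' = Q.conv c c' :=
  Q.conv_congr (Q.fourier_surjective _).choose_spec (Q.fourier_surjective _).choose_spec

theorem pairing_fourier_mul_fourier (a c c' : A) : Q.pairing a (Q.fourier c * Q.fourier c') =
    tensorFunctional Q.integral Q.integral ((Q.comul a).lmul (c ⊗ₜ[ℂ] c')) := by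
  rw [fourier_mul_fourier, pairing_conv]

/-- The map `x ↦ Δ(x)(p ⊗ q)`. -/
def comulL (p q : A) : A →ₗ[ℂ] A ⊗[ℂ] A where
  toFun x := (Q.comul x).lmul (p ⊗ₜ q)
  map_add' x y := by rw [map_add, Mult.lmul_add]
  map_smul' r x := by rw [map_smul, Mult.lmul_smul, RingHom.id_apply]

theorem comulL_apply (p q x : A) : Q.comulL p q x = (Q.comul x).lmul (p ⊗ₜ q) := rfl

theorem tensorFunctional_convolution (c c' : A) (s : A ⊗[ℂ] A) :
    tensorFunctional (Q.convolution c c') Q.integral s =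
      tensorFunctional Q.integral (tensorFunctional Q.integral Q.integral)
        (TensorProduct.assoc ℂ A A A ((Q.comulL c c').rTensor A s)) := by
  induction s with
  | zero => simp only [map_zero]
  | add s t h h' => simp only [map_add, h, h']
  | tmul p q =>
    rw [LinearMap.rTensor_tmul, comulL_apply, tensorFunctional_tmul]
    change tensorFunctional Q.integral Q.integral ((Q.comul p).lmul (c ⊗ₜ[ℂ] c')) * _ = _
    generalize (Q.comul p).lmul (c ⊗ₜ[ℂ] c') = w
    induction w with
    | zero => simp only [map_zero, TensorProduct.zero_tmul, zero_mul]
    | add s t h h' => simp only [map_add, TensorProduct.add_tmul, add_mul, h, h']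
    | tmul x y =>
      simp only [TensorProduct.assoc_tmul, tensorFunctional_tmul, mul_assoc]

theorem tensorFunctional_convolution' (c c' : A) (t : A ⊗[ℂ] A) :
    tensorFunctional Q.integral (Q.convolution c c') t =
      tensorFunctional Q.integral (tensorFunctional Q.integral Q.integral)
        ((Q.comulL c c').lTensor A t) := by
  induction t with
  | zero => simp only [map_zero]
  | add s t h h' => simp only [map_add, h, h']
  | tmul p q => rfl

theorem coassoc_left (x c c' z : A) (s : A ⊗[ℂ] A) :
    (tmul (incl A x) 1 * multAssoc (tensorHom Q.comul (incl A) s)).lmul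
      (c ⊗ₜ[ℂ] (c' ⊗ₜ[ℂ] z)) = (((LinearMap.mulRight ℂ z).lTensor A).lTensor A)
      ((LinearMap.mulLeft ℂ x).rTensor (A ⊗[ℂ] A)
        (TensorProduct.assoc ℂ A A A ((Q.comulL c c').rTensor A s))) := by
  induction s with
  | zero => simp only [map_zero, mul_zero, Mult.lmul_zero]
  | add s t h h' => simp only [map_add, mul_add, Mult.lmul_add, h, h']
  | tmul p q =>
    rw [LinearMap.rTensor_tmul, comulL_apply, Mult.lmul_mul]
    change (tmul (incl A x) 1).lmul (TensorProduct.assoc ℂ A A A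
      ((Q.comul p).lmul (c ⊗ₜ c') ⊗ₜ (q * z))) = _
    generalize (Q.comul p).lmul (c ⊗ₜ[ℂ] c') = w
    induction w with
    | zero => simp only [map_zero, TensorProduct.zero_tmul]
    | add s t h h' => simp only [map_add, TensorProduct.add_tmul, h, h']
    | tmul x y => rfl

theorem coassoc_right (c c' c'' z : A) (t : A ⊗[ℂ] A) :
    (tensorHom (incl A) Q.comul t * tmul 1 (tmul 1 (incl A c''))).lmul
      (c ⊗ₜ[ℂ] (c' ⊗ₜ[ℂ] z)) = (((LinearMap.mulRight ℂ z).lTensor A).lTensor A)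
      ((Q.comulL c' c'').lTensor A ((LinearMap.mulRight ℂ c).rTensor A t)) := by
  induction t with
  | zero => simp only [map_zero, zero_mul, Mult.lmul_zero]
  | add s t h h' => simp only [map_add, add_mul, Mult.lmul_add, h, h']
  | tmul p q =>
    have := lmul_lTensor_mulRight (Q.comul q) z (c' ⊗ₜ c'')
    rw [LinearMap.rTensor_tmul, LinearMap.lTensor_tmul, LinearMap.lTensor_tmul, comulL_apply,
      ← this]
    rfl

theorem conv_assoc {c c' c'' d d' : A} (hd : Q.fourier d = Q.conv c c')
    (hd' : Q.fourier d' = Q.conv c' c'') : Q.conv d c'' = Q.conv c d' := by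
  refine Dual.ext Q fun a => ?_
  obtain ⟨s, hs⟩ := Q.exists_right a c''
  obtain ⟨t', ht'⟩ := Q.exists_left a c
  rw [Q.pairing_conv_of_right a d c'' s hs, Q.pairing_conv_of_left a c d' t' ht']
  have hd : Q.toDual d = Q.convolution c c' := congrArg Subtype.val hd
  have hd' : Q.toDual d' = Q.convolution c' c'' := congrArg Subtype.val hd'
  rw [hd, hd', tensorFunctional_convolution, tensorFunctional_convolution']
  refine congrArg _ (sub_eq_zero.1 ?_)
  refine rTensor_separating (fun x : A => LinearMap.mulLeft ℂ x)
    (fun x h => NondegenerateMul.eq_zero_of_mul_left x h) _ fun x => ?_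
  refine lTensor_separating (fun z : A => (LinearMap.mulRight ℂ z).lTensor A)
    (fun w h => lTensor_separating (fun z : A => LinearMap.mulRight ℂ z)
      (fun y h => NondegenerateMul.eq_zero_of_mul_right y h) w h) _ fun z => ?_
  rw [map_sub, map_sub, sub_eq_zero]
  obtain ⟨t, ht⟩ := Q.exists_left_mul x a
  have h := congrArg (fun m => m.lmul (c ⊗ₜ[ℂ] (c' ⊗ₜ[ℂ] z))) (Q.coassoc x a c'' s t hs ht)
  have l3 : (LinearMap.mulRight ℂ c).rTensor A t = (LinearMap.mulLeft ℂ x).rTensor A t' := by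
    change _ = (tmul (incl A x) 1).lmul t'
    refine eq_of_mul_tmul fun y y' => ?_
    rw [rTensor_mulRight_mul, ← Mult.lmul_mul_apply, ← lmul_incl t, ← lmul_incl t', ht, ht']
    rfl
  have l4 : (Q.comulL c' c'').lTensor A ((LinearMap.mulLeft ℂ x).rTensor A t') =
      (LinearMap.mulLeft ℂ x).rTensor (A ⊗[ℂ] A) ((Q.comulL c' c'').lTensor A t') := by
    rw [← LinearMap.comp_apply, ← LinearMap.comp_apply, LinearMap.lTensor_comp_rTensor,
      LinearMap.rTensor_comp_lTensor]
  rw [← coassoc_left, ← l4, ← l3, ← coassoc_right]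
  exact h

/-- The algebra `Â`. -/
instance : NonUnitalRing Q.Dual where
  left_distrib b b' b'' := by
    obtain ⟨c, rfl⟩ := Q.fourier_surjective b
    obtain ⟨c', rfl⟩ := Q.fourier_surjective b'
    obtain ⟨c'', rfl⟩ := Q.fourier_surjective b''
    rw [← map_add, fourier_mul_fourier, fourier_mul_fourier, fourier_mul_fourier, conv_add]
  right_distrib b b' b'' := by
    obtain ⟨c, rfl⟩ := Q.fourier_surjective b
    obtain ⟨c', rfl⟩ := Q.fourier_surjective b'
    obtain ⟨c'', rfl⟩ := Q.fourier_surjective b''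
    rw [← map_add, fourier_mul_fourier, fourier_mul_fourier, fourier_mul_fourier, add_conv]
  zero_mul b := by
    obtain ⟨c, rfl⟩ := Q.fourier_surjective b
    rw [← map_zero Q.fourier, fourier_mul_fourier, ← zero_smul ℂ (0 : A), smul_conv, zero_smul,
      zero_smul, map_zero]
  mul_zero b := by
    obtain ⟨c, rfl⟩ := Q.fourier_surjective b
    rw [← map_zero Q.fourier, fourier_mul_fourier, ← zero_smul ℂ (0 : A), conv_smul, zero_smul,
      zero_smul, map_zero]
  mul_assoc b b' b'' := by
    obtain ⟨c, rfl⟩ := Q.fourier_surjective b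
    obtain ⟨c', rfl⟩ := Q.fourier_surjective b'
    obtain ⟨c'', rfl⟩ := Q.fourier_surjective b''
    obtain ⟨d, hd⟩ := Q.fourier_surjective (Q.conv c c')
    obtain ⟨d', hd'⟩ := Q.fourier_surjective (Q.conv c' c'')
    rw [fourier_mul_fourier, fourier_mul_fourier, ← hd, ← hd', fourier_mul_fourier,
      fourier_mul_fourier, Q.conv_assoc hd hd']

instance : IsScalarTower ℂ Q.Dual Q.Dual where
  smul_assoc r b b' := by
    obtain ⟨c, rfl⟩ := Q.fourier_surjective b
    obtain ⟨c', rfl⟩ := Q.fourier_surjective b'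
    rw [smul_eq_mul, smul_eq_mul, ← map_smul, fourier_mul_fourier, fourier_mul_fourier, smul_conv]

instance : SMulCommClass ℂ Q.Dual Q.Dual where
  smul_comm r b b' := by
    obtain ⟨c, rfl⟩ := Q.fourier_surjective b
    obtain ⟨c', rfl⟩ := Q.fourier_surjective b'
    rw [smul_eq_mul, smul_eq_mul, ← map_smul, fourier_mul_fourier, fourier_mul_fourier, conv_smul]

theorem fourier_eq_zero_of_forall {c : A}
    (h : ∀ x y : A, Q.integral (x * c) * Q.integral y = 0) : Q.fourier c = 0 := by
  refine Dual.ext Q fun a => ?_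
  by_contra hne
  refine Q.integral_ne_zero (LinearMap.ext fun y => ?_)
  have := h a y
  rw [map_zero, pairing_fourier] at hne
  simpa [hne] using this

instance : NondegenerateMul Q.Dual where
  eq_zero_of_mul_right b hb := by
    obtain ⟨c, rfl⟩ := Q.fourier_surjective b
    refine Q.fourier_eq_zero_of_forall fun x y => ?_
    obtain ⟨T, hT⟩ := Q.exists_equiv_comul_mul_right
    have key : ∀ w, tensorFunctional (Q.toDual c) Q.integral (T w) = 0 := by
      intro w
      induction w with
      | zero => simp
      | add s t h h' => simp only [map_add, h, h', add_zero]
      | tmul p q =>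
        rw [← Q.pairing_conv_of_right p c q _ (hT p q), ← fourier_mul_fourier, hb, map_zero]
    simpa using key (T.symm (x ⊗ₜ y))
  eq_zero_of_mul_left b hb := by
    obtain ⟨c, rfl⟩ := Q.fourier_surjective b
    refine Q.fourier_eq_zero_of_forall fun x y => ?_
    obtain ⟨T, hT⟩ := Q.exists_equiv_comul_mul_left
    have key : ∀ w, tensorFunctional Q.integral (Q.toDual c) (T w) = 0 := by
      intro w
      induction w with
      | zero => simp
      | add s t h h' => simp only [map_add, h, h', add_zero]
      | tmul p q =>
        rw [← Q.pairing_conv_of_left p q c _ (hT p q), ← fourier_mul_fourier, hb, map_zero]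
    have := key (T.symm (y ⊗ₜ x))
    rw [mul_comm]
    simpa using this


/-! ### Extended pairings, the dual coproduct and the duality -/

/-- The tensor product `⟨x ⊗ x', y ⊗ y'⟩ = ⟨x, y⟩ ⟨x', y'⟩` of two pairings. -/
def tensorPairing {X X' Y Y' : Type*} [AddCommGroup X] [Module ℂ X] [AddCommGroup X']
    [Module ℂ X'] [AddCommGroup Y] [Module ℂ Y] [AddCommGroup Y'] [Module ℂ Y']
    (p : X →ₗ[ℂ] Y →ₗ[ℂ] ℂ) (q : X' →ₗ[ℂ] Y' →ₗ[ℂ] ℂ) :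
    X ⊗[ℂ] X' →ₗ[ℂ] Y ⊗[ℂ] Y' →ₗ[ℂ] ℂ :=
  (TensorProduct.map₂ p q).compr₂ (LinearMap.mul' ℂ ℂ)

@[simp] theorem tensorPairing_tmul {X X' Y Y' : Type*} [AddCommGroup X] [Module ℂ X]
    [AddCommGroup X'] [Module ℂ X'] [AddCommGroup Y] [Module ℂ Y] [AddCommGroup Y'] [Module ℂ Y']
    (p : X →ₗ[ℂ] Y →ₗ[ℂ] ℂ) (q : X' →ₗ[ℂ] Y' →ₗ[ℂ] ℂ) (x : X) (x' : X') (y : Y) (y' : Y') :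
    tensorPairing p q (x ⊗ₜ x') (y ⊗ₜ y') = p x y * q x' y' := rfl

/-- Let `P` be a pairing of an algebra `X` with a vector space `Y`. The actions `x ▹ y` and
`y ◃ x` of `X` on `Y` are given by `⟨x', x ▹ y⟩ = ⟨x' x, y⟩` and `⟨x', y ◃ x⟩ = ⟨x x', y⟩`, and
the extension of the pairing to `M(X) × Y` by `⟨m, x ▹ y⟩ = ⟨m x, y⟩` and
`⟨m, y ◃ x⟩ = ⟨x m, y⟩`. The predicate says that `e` is the functional `⟨m, ·⟩` of this
extended pairing. -/
def IsExtendedPairing {X Y : Type*} [NonUnitalRing X] [Module ℂ X] [IsScalarTower ℂ X X]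
    [SMulCommClass ℂ X X] [AddCommGroup Y] [Module ℂ Y] (P : X →ₗ[ℂ] Y →ₗ[ℂ] ℂ) (m : Mult X)
    (e : Y →ₗ[ℂ] ℂ) : Prop :=
  (∀ (x : X) (y z : Y), (∀ x', P x' z = P (x' * x) y) → e z = P (m.lmul x) y) ∧
  (∀ (x : X) (y z : Y), (∀ x', P x' z = P (x * x') y) → e z = P (m.rmul x) y)

/-- `Δ` is the coproduct of `Â`: `⟨a ⊗ a', Δ(b)⟩ = ⟨a a', b⟩`, for the extension to
`(A ⊗ A) × M(Â ⊗ Â)` of the tensor product of the pairing with itself. -/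
def IsDualComul (Δ : Q.Dual →ₙₐ[ℂ] Mult (Q.Dual ⊗[ℂ] Q.Dual)) : Prop :=
  ∀ b, IsExtendedPairing (tensorPairing Q.pairing.flip Q.pairing.flip) (Δ b)
    (Q.pairing.flip b ∘ₗ LinearMap.mul' ℂ A)

/-- `V ∈ M(Â ⊗ A)` is the duality: `⟨V, a ⊗ b⟩ = ⟨a, b⟩`, for the extension to
`M(Â ⊗ A) × (A ⊗ Â)` of the tensor product of the flipped pairing with the pairing. -/
def IsDuality (V : Mult (Q.Dual ⊗[ℂ] A)) : Prop :=
  IsExtendedPairing (tensorPairing Q.pairing.flip Q.pairing) V (TensorProduct.lift Q.pairing)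

/-- The homomorphism `ι ⊗ Δ : Â ⊗ A → M(Â ⊗ (A ⊗ A))`. -/
def idTensorComul : Q.Dual ⊗[ℂ] A →ₙₐ[ℂ] Mult (Q.Dual ⊗[ℂ] (A ⊗[ℂ] A)) :=
  tensorHom (incl Q.Dual) Q.comul

/-- The homomorphism `Δ ⊗ ι : Â ⊗ A → M(Â ⊗ (Â ⊗ A))` for a coproduct `Δ` on `Â`. -/
def comulTensorId (Δ : Q.Dual →ₙₐ[ℂ] Mult (Q.Dual ⊗[ℂ] Q.Dual)) :
    Q.Dual ⊗[ℂ] A →ₙₐ[ℂ] Mult (Q.Dual ⊗[ℂ] (Q.Dual ⊗[ℂ] A)) :=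
  NonUnitalAlgHom.comp
    (AlgHom.toNonUnitalAlgHom (multAssoc (X := Q.Dual) (Y := Q.Dual) (Z := A)))
    (tensorHom Δ (incl A))

end AlgebraicQuantumGroup

end QuantumGroup

end MultiplierHopf

end

/-!
Let `T (a ⊗ b) = Δ(b)(a ⊗ 1)`. Left invariance of `φ` turns the defining property of the duality
into `V (φ(· c) ⊗ q) = ∑ φ(· dᵢ) ⊗ pᵢ`, where `T⁻¹ (q ⊗ c) = ∑ pᵢ ⊗ dᵢ`, so up to the Fourier
transform `c ↦ φ(· c)` left multiplication by `V` is `T⁻¹`. The right multiplications, and the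
coproduct of `B`, are obtained in the same way from the other canonical bijections, once it is known
that `φ` is faithful and that the functionals `φ(· c)`, `φ(c ·)`, `ψ(· c)`, `ψ(c ·)` all run through
the same space `B`, where `ψ = φ ∘ S` is the right integral. For such multipliers the two formulas
for `(ι ⊗ Δ)V` and `(Δ ⊗ ι)V` are both the pentagon equation `T₂₃ T₁₃ T₁₂ = T₁₂ T₂₃`, which is
coassociativity of `Δ`.
-/

open scoped TensorProduct

noncomputable section

namespace MultiplierHopf

section TensorLemmas

variable {X Y Z X' Y' : Type*} [AddCommGroup X] [Module ℂ X] [AddCommGroup Y] [Module ℂ Y]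
  [AddCommGroup Z] [Module ℂ Z] [AddCommGroup X'] [Module ℂ X'] [AddCommGroup Y'] [Module ℂ Y']

/-- The map `φ ⊗ ι : X ⊗ Y → Y` for a linear functional `φ` on `X`. -/
def sliceLeft (φ : X →ₗ[ℂ] ℂ) : X ⊗[ℂ] Y →ₗ[ℂ] Y :=
  (TensorProduct.lid ℂ Y).toLinearMap ∘ₗ φ.rTensor Y

@[simp] theorem sliceLeft_tmul (φ : X →ₗ[ℂ] ℂ) (x : X) (y : Y) :
    sliceLeft φ (x ⊗ₜ[ℂ] y) = φ x • y := by simp [sliceLeft]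

theorem sliceLeft_lTensor (φ : X →ₗ[ℂ] ℂ) (f : Y →ₗ[ℂ] Y') (w : X ⊗[ℂ] Y) :
    sliceLeft φ (f.lTensor X w) = f (sliceLeft φ w) :=
  LinearMap.congr_fun (f := sliceLeft φ ∘ₗ f.lTensor X) (g := f ∘ₗ sliceLeft φ)
    (TensorProduct.ext' fun _ _ => by simp) w

theorem sliceLeft_rTensor (φ : X' →ₗ[ℂ] ℂ) (f : X →ₗ[ℂ] X') (w : X ⊗[ℂ] Y) :
    sliceLeft φ (f.rTensor Y w) = sliceLeft (φ ∘ₗ f) w :=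
  LinearMap.congr_fun (f := sliceLeft φ ∘ₗ f.rTensor Y) (g := sliceLeft (φ ∘ₗ f))
    (TensorProduct.ext' fun _ _ => by simp) w

theorem sliceRight_rTensor (φ : X →ₗ[ℂ] ℂ) (f : X →ₗ[ℂ] X) (w : X ⊗[ℂ] X) :
    sliceRight φ (f.rTensor X w) = f (sliceRight φ w) :=
  LinearMap.congr_fun (f := sliceRight φ ∘ₗ f.rTensor X) (g := f ∘ₗ sliceRight φ)
    (TensorProduct.ext' fun _ _ => by simp) w

theorem sliceRight_surjective {φ : X →ₗ[ℂ] ℂ} (hφ : φ ≠ 0) :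
    Function.Surjective (sliceRight φ) := fun x => by
  obtain ⟨p, hp⟩ := DFunLike.ne_iff.1 hφ
  rw [LinearMap.zero_apply] at hp
  exact ⟨((φ p)⁻¹ • x) ⊗ₜ p, by simp [hp]⟩

/-- The map `T ⊗ ι : X ⊗ (Y ⊗ Z) → X' ⊗ (Y' ⊗ Z)` for a bijection `T : X ⊗ Y → X' ⊗ Y'`. -/
def leftLegs (T : X ⊗[ℂ] Y ≃ₗ[ℂ] X' ⊗[ℂ] Y') : X ⊗[ℂ] (Y ⊗[ℂ] Z) ≃ₗ[ℂ] X' ⊗[ℂ] (Y' ⊗[ℂ] Z) :=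
  (TensorProduct.assoc ℂ X Y Z).symm ≪≫ₗ T.rTensor Z ≪≫ₗ TensorProduct.assoc ℂ X' Y' Z

@[simp] theorem leftLegs_assoc (T : X ⊗[ℂ] Y ≃ₗ[ℂ] X' ⊗[ℂ] Y') (w : X ⊗[ℂ] Y) (z : Z) :
    leftLegs T (TensorProduct.assoc ℂ X Y Z (w ⊗ₜ z)) =
      TensorProduct.assoc ℂ X' Y' Z (T w ⊗ₜ z) := by
  simp [leftLegs]

@[simp] theorem leftLegs_tmul (T : X ⊗[ℂ] Y ≃ₗ[ℂ] X' ⊗[ℂ] Y') (x : X) (y : Y) (z : Z) :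
    leftLegs T (x ⊗ₜ (y ⊗ₜ z)) = TensorProduct.assoc ℂ X' Y' Z (T (x ⊗ₜ y) ⊗ₜ z) :=
  leftLegs_assoc T (x ⊗ₜ y) z

theorem lTensor_sliceLeft_assoc (φ : X →ₗ[ℂ] ℂ) (w : X ⊗[ℂ] X) (y : Y) :
    (sliceLeft φ).lTensor X (TensorProduct.assoc ℂ X X Y (w ⊗ₜ y)) = sliceRight φ w ⊗ₜ y :=
  LinearMap.congr_fun
    (f := (sliceLeft φ).lTensor X ∘ₗ (TensorProduct.assoc ℂ X X Y).toLinearMap ∘ₗ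
      (TensorProduct.mk ℂ (X ⊗[ℂ] X) Y).flip y)
    (g := (TensorProduct.mk ℂ X Y).flip y ∘ₗ sliceRight φ)
    (TensorProduct.ext' fun _ _ => by simp) w

theorem lTensor_eq_zero_of_ker_le {f : X →ₗ[ℂ] X'} {g : X →ₗ[ℂ] Y'}
    (h : LinearMap.ker f ≤ LinearMap.ker g) {w : Y ⊗[ℂ] X} (hw : f.lTensor Y w = 0) :
    g.lTensor Y w = 0 := by
  obtain ⟨g', hg'⟩ := LinearMap.exists_extend
    ((LinearMap.ker f).liftQ g h ∘ₗ f.quotKerEquivRange.symm.toLinearMap)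
  have hgf : g = g' ∘ₗ f := LinearMap.ext fun x => by
    have := LinearMap.congr_fun hg' (f.quotKerEquivRange ((LinearMap.ker f).mkQ x))
    simpa using this.symm
  rw [hgf, LinearMap.lTensor_comp_apply, hw, map_zero]

/-- Comparing both sides at a non-zero vector exhibits the common functional. -/
theorem exists_eq_slice_of_tmul_eq {f g : X ⊗[ℂ] X →ₗ[ℂ] X}
    (h : ∀ a b c, a ⊗ₜ[ℂ] f (b ⊗ₜ c) = g (a ⊗ₜ b) ⊗ₜ[ℂ] c) :
    ∃ φ : X →ₗ[ℂ] ℂ, f = sliceLeft φ ∧ g = sliceRight φ := by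
  by_cases hX : ∀ x : X, x = 0
  · exact ⟨0, LinearMap.ext fun w => (hX _).trans (hX _).symm,
      LinearMap.ext fun w => (hX _).trans (hX _).symm⟩
  push Not at hX
  obtain ⟨x, hx⟩ := hX
  obtain ⟨ω, hω⟩ := Module.Projective.exists_dual_ne_zero ℂ hx
  let φ : X →ₗ[ℂ] ℂ := (ω x)⁻¹ • ω ∘ₗ g ∘ₗ TensorProduct.mk ℂ X X x
  have hf : f = sliceLeft φ := TensorProduct.ext' fun b c => by
    have := congrArg (fun t => (ω x)⁻¹ • sliceLeft ω t) (h x b c)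
    simpa [φ, hω, smul_smul] using this
  refine ⟨φ, hf, TensorProduct.ext' fun a b => ?_⟩
  have := congrArg (fun t => (ω x)⁻¹ • sliceRight ω t) (h a b x)
  simpa [hf, hω, smul_smul, mul_comm] using this.symm

theorem sliceLeft_surjective {φ : X →ₗ[ℂ] ℂ} (hφ : φ ≠ 0) :
    Function.Surjective (sliceLeft (Y := Y) φ) := fun y => by
  obtain ⟨p, hp⟩ := DFunLike.ne_iff.1 hφ
  rw [LinearMap.zero_apply] at hp
  exact ⟨p ⊗ₜ ((φ p)⁻¹ • y), by simp [hp]⟩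

theorem sliceLeft_assoc (φ : X →ₗ[ℂ] ℂ) (w : X ⊗[ℂ] Y) (z : Z) :
    sliceLeft φ (TensorProduct.assoc ℂ X Y Z (w ⊗ₜ z)) = sliceLeft φ w ⊗ₜ z :=
  LinearMap.congr_fun
    (f := sliceLeft φ ∘ₗ (TensorProduct.assoc ℂ X Y Z).toLinearMap ∘ₗ
      (TensorProduct.mk ℂ (X ⊗[ℂ] Y) Z).flip z)
    (g := (TensorProduct.mk ℂ Y Z).flip z ∘ₗ sliceLeft φ)
    (TensorProduct.ext' fun _ _ => by simp [TensorProduct.smul_tmul']) w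

theorem sliceRight_lTensor (φ : X →ₗ[ℂ] ℂ) (f : X →ₗ[ℂ] X) (w : X ⊗[ℂ] X) :
    sliceRight φ (f.lTensor X w) = sliceRight (φ ∘ₗ f) w :=
  LinearMap.congr_fun (f := sliceRight φ ∘ₗ f.lTensor X) (TensorProduct.ext' fun _ _ => by simp) w

theorem tensorFunctional_eq_sliceRight (φ ψ : X →ₗ[ℂ] ℂ) (w : X ⊗[ℂ] X) :
    tensorFunctional φ ψ w = φ (sliceRight ψ w) :=
  LinearMap.congr_fun (g := φ ∘ₗ sliceRight ψ) (TensorProduct.ext' fun _ _ => by simp [mul_comm]) w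

theorem tensorFunctional_eq_sliceLeft (φ ψ : X →ₗ[ℂ] ℂ) (w : X ⊗[ℂ] X) :
    tensorFunctional φ ψ w = ψ (sliceLeft φ w) :=
  LinearMap.congr_fun (g := ψ ∘ₗ sliceLeft φ) (TensorProduct.ext' fun _ _ => by simp) w

theorem lTensor_eq_zero_of_sliceRight {β : X →ₗ[ℂ] Y →ₗ[ℂ] ℂ} {w : X ⊗[ℂ] X}
    (h : ∀ y, sliceRight (β.flip y) w = 0) : β.lTensor X w = 0 := by
  refine lTensor_separating (fun y : Y => LinearMap.applyₗ (R := ℂ) (M₂ := ℂ) y)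
    (fun f hf => LinearMap.ext hf) _ fun y => (TensorProduct.rid ℂ X).injective ?_
  rw [map_zero, ← h y, ← LinearMap.lTensor_comp_apply]
  rfl

theorem sliceRight_eq_zero_of_lTensor {φ : X →ₗ[ℂ] ℂ} {w : X ⊗[ℂ] X} (h : φ.lTensor X w = 0) :
    sliceRight φ w = 0 :=
  (congrArg (TensorProduct.rid ℂ X) h).trans (map_zero _)

theorem lTensor_sliceRight_assoc (φ : X →ₗ[ℂ] ℂ) (w : X ⊗[ℂ] X) (x : X) :
    (sliceRight φ).lTensor X (TensorProduct.assoc ℂ X X X (w ⊗ₜ x)) = φ x • w :=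
  LinearMap.congr_fun
    (f := (sliceRight φ).lTensor X ∘ₗ (TensorProduct.assoc ℂ X X X).toLinearMap ∘ₗ
      (TensorProduct.mk ℂ (X ⊗[ℂ] X) X).flip x)
    (g := LinearMap.lsmul ℂ (X ⊗[ℂ] X) (φ x)) (TensorProduct.ext' fun _ _ => by simp) w

/-- For canonical bijections the hypothesis is coassociativity, and the conclusion says that
slicing one of them is colinear with respect to the other. -/
theorem apply_tmul_sliceRight_of_leftLegs_comm {T U : X ⊗[ℂ] X ≃ₗ[ℂ] X ⊗[ℂ] X}
    (h : ∀ t : X ⊗[ℂ] (X ⊗[ℂ] X), U.lTensor X (leftLegs T t) = leftLegs T (U.lTensor X t))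
    (φ : X →ₗ[ℂ] ℂ) (x y z : X) :
    T (x ⊗ₜ sliceRight φ (U (y ⊗ₜ z))) =
      (sliceRight φ ∘ₗ U.toLinearMap ∘ₗ (TensorProduct.mk ℂ X X).flip z).lTensor X
        (T (x ⊗ₜ y)) := by
  have slice_T (w : X ⊗[ℂ] X) :
      (sliceRight φ).lTensor X (leftLegs T (x ⊗ₜ w)) = T (x ⊗ₜ sliceRight φ w) :=
    LinearMap.congr_fun
      (f := (sliceRight φ).lTensor X ∘ₗ (leftLegs T).toLinearMap ∘ₗ
        TensorProduct.mk ℂ X (X ⊗[ℂ] X) x)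
      (g := T.toLinearMap ∘ₗ TensorProduct.mk ℂ X X x ∘ₗ sliceRight φ)
      (TensorProduct.ext' fun p q => by simp [lTensor_sliceRight_assoc]) w
  have slice_U (w : X ⊗[ℂ] X) :
      (sliceRight φ).lTensor X (U.lTensor X (TensorProduct.assoc ℂ X X X (w ⊗ₜ z))) =
        (sliceRight φ ∘ₗ U.toLinearMap ∘ₗ (TensorProduct.mk ℂ X X).flip z).lTensor X w := by
    refine LinearMap.congr_fun
      (f := (sliceRight φ).lTensor X ∘ₗ (U.lTensor X).toLinearMap ∘ₗ
        (TensorProduct.assoc ℂ X X X).toLinearMap ∘ₗ (TensorProduct.mk ℂ (X ⊗[ℂ] X) X).flip z)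
      (g := LinearMap.lTensor X _) (TensorProduct.ext' fun _ _ => ?_) w
    rfl
  rw [← slice_T, ← slice_U, ← leftLegs_tmul, h]
  rfl

/-- The operator `T₁₃` on `X ⊗ (X ⊗ X)`. -/
def outerLegs (T : X ⊗[ℂ] X ≃ₗ[ℂ] X ⊗[ℂ] X) : X ⊗[ℂ] (X ⊗[ℂ] X) ≃ₗ[ℂ] X ⊗[ℂ] (X ⊗[ℂ] X) :=
  (TensorProduct.comm ℂ X X).lTensor X ≪≫ₗ leftLegs T ≪≫ₗ (TensorProduct.comm ℂ X X).lTensor X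

theorem outerLegs_tmul (T : X ⊗[ℂ] X ≃ₗ[ℂ] X ⊗[ℂ] X) (a b c : X) :
    outerLegs T (a ⊗ₜ (b ⊗ₜ c)) = (TensorProduct.comm ℂ X X).lTensor X
      (TensorProduct.assoc ℂ X X X (T (a ⊗ₜ c) ⊗ₜ b)) := by
  simp [outerLegs]

end TensorLemmas

section MultiplierLemmas

variable {X Y Z X' Y' : Type*}
  [NonUnitalRing X] [Module ℂ X] [IsScalarTower ℂ X X] [SMulCommClass ℂ X X]
  [NonUnitalRing Y] [Module ℂ Y] [IsScalarTower ℂ Y Y] [SMulCommClass ℂ Y Y]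
  [NonUnitalRing Z] [Module ℂ Z] [IsScalarTower ℂ Z Z] [SMulCommClass ℂ Z Z]
  [NonUnitalRing X'] [Module ℂ X'] [IsScalarTower ℂ X' X'] [SMulCommClass ℂ X' X']
  [NonUnitalRing Y'] [Module ℂ Y'] [IsScalarTower ℂ Y' Y'] [SMulCommClass ℂ Y' Y']

theorem incl_lmul (m : Mult X) (x : X) : incl X (m.lmul x) = m * incl X x :=
  Mult.ext (fun y => by simp [m.lmul_mul_apply]) (fun y => by simp [m.rmul_mul])

theorem incl_rmul (m : Mult X) (x : X) : incl X (m.rmul x) = incl X x * m :=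
  Mult.ext (fun y => by simp [m.rmul_mul]) (fun y => by simp [m.rmul_mul_apply])

theorem incl_injective [NondegenerateMul X] : Function.Injective (incl X) := fun _ _ h =>
  AlgebraicQuantumGroup.eq_of_mul fun z => congrArg (fun m => m.lmul z) h

theorem eq_of_mul_left {R : Type*} [NonUnitalRing R] [NondegenerateMul R] {s t : R}
    (h : ∀ x, x * s = x * t) : s = t := by
  rw [← sub_eq_zero]
  exact NondegenerateMul.eq_zero_of_mul_left _ fun x => by rw [mul_sub, h, sub_self]

theorem Mult.ext_lmul [NondegenerateMul X] {m n : Mult X} (h : ∀ x, m.lmul x = n.lmul x) :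
    m = n :=
  Mult.ext h fun x => AlgebraicQuantumGroup.eq_of_mul fun y => by
    rw [Mult.rmul_mul, Mult.rmul_mul, h]

theorem Mult.ext_rmul [NondegenerateMul X] {m n : Mult X} (h : ∀ x, m.rmul x = n.rmul x) :
    m = n :=
  Mult.ext (fun x => eq_of_mul_left fun y => by rw [← Mult.rmul_mul, ← Mult.rmul_mul, h]) h

theorem Mult.lmul_rmul_comm [NondegenerateMul X] (m n : Mult X) (x : X) :
    m.lmul (n.rmul x) = n.rmul (m.lmul x) :=
  AlgebraicQuantumGroup.eq_of_mul fun y => by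
    rw [← Mult.lmul_mul_apply, Mult.rmul_mul, Mult.rmul_mul, Mult.lmul_mul_apply]

theorem tmul_mul_tmul (m m' : Mult X) (n n' : Mult Y) :
    tmul m n * tmul m' n' = tmul (m * m') (n * n') :=
  Mult.ext_tmul (fun _ _ => by simp) (fun _ _ => by simp)

theorem tmul_one_one : tmul (1 : Mult X) (1 : Mult Y) = 1 :=
  Mult.ext_tmul (fun _ _ => by simp) (fun _ _ => by simp)

theorem incl_tmul (x : X) (y : Y) :
    incl (X ⊗[ℂ] Y) (x ⊗ₜ y) = tmul (incl X x) (incl Y y) :=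
  Mult.ext_tmul (fun _ _ => by simp) (fun _ _ => by simp)

/-- The map `w ↦ (x ⊗ 1) w`. -/
def mulL₁ (x : X) : X ⊗[ℂ] Y →ₗ[ℂ] X ⊗[ℂ] Y :=
  (tmul (incl X x) 1).lmul

/-- The map `w ↦ (1 ⊗ y) w`. -/
def mulL₂ (y : Y) : X ⊗[ℂ] Y →ₗ[ℂ] X ⊗[ℂ] Y :=
  (tmul 1 (incl Y y)).lmul

/-- The map `w ↦ w (x ⊗ 1)`. -/
def mulR₁ (x : X) : X ⊗[ℂ] Y →ₗ[ℂ] X ⊗[ℂ] Y :=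
  (tmul (incl X x) 1).rmul

/-- The map `w ↦ w (1 ⊗ y)`. -/
def mulR₂ (y : Y) : X ⊗[ℂ] Y →ₗ[ℂ] X ⊗[ℂ] Y :=
  (tmul 1 (incl Y y)).rmul

@[simp] theorem mulL₁_tmul (x x' : X) (y : Y) : mulL₁ x (x' ⊗ₜ[ℂ] y) = (x * x') ⊗ₜ y := rfl

@[simp] theorem mulL₂_tmul (x : X) (y y' : Y) : mulL₂ y (x ⊗ₜ[ℂ] y') = x ⊗ₜ (y * y') := rfl

@[simp] theorem mulR₁_tmul (x x' : X) (y : Y) : mulR₁ x (x' ⊗ₜ[ℂ] y) = (x' * x) ⊗ₜ y := rfl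

@[simp] theorem mulR₂_tmul (x : X) (y y' : Y) : mulR₂ y (x ⊗ₜ[ℂ] y') = x ⊗ₜ (y' * y) := rfl

theorem incl_mulL₁ (x : X) (w : X ⊗[ℂ] Y) :
    incl (X ⊗[ℂ] Y) (mulL₁ x w) = tmul (incl X x) 1 * incl (X ⊗[ℂ] Y) w :=
  incl_lmul (tmul (incl X x) 1) w

theorem incl_mulL₂ (y : Y) (w : X ⊗[ℂ] Y) :
    incl (X ⊗[ℂ] Y) (mulL₂ y w) = tmul 1 (incl Y y) * incl (X ⊗[ℂ] Y) w :=
  incl_lmul (tmul 1 (incl Y y)) w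

theorem incl_mulR₁ (x : X) (w : X ⊗[ℂ] Y) :
    incl (X ⊗[ℂ] Y) (mulR₁ x w) = incl (X ⊗[ℂ] Y) w * tmul (incl X x) 1 :=
  incl_rmul (tmul (incl X x) 1) w

theorem incl_mulR₂ (y : Y) (w : X ⊗[ℂ] Y) :
    incl (X ⊗[ℂ] Y) (mulR₂ y w) = incl (X ⊗[ℂ] Y) w * tmul 1 (incl Y y) :=
  incl_rmul (tmul 1 (incl Y y)) w

theorem eq_of_mulL₁_eq [NondegenerateMul X] {s t : X ⊗[ℂ] Y}
    (h : ∀ x, mulL₁ x s = mulL₁ x t) : s = t :=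
  sub_eq_zero.1 <| rTensor_separating (fun x : X => LinearMap.mulLeft ℂ x)
    (fun x => NondegenerateMul.eq_zero_of_mul_left x) _ fun x => by
      rw [map_sub, sub_eq_zero]; exact h x

theorem eq_of_mulR₂_eq [NondegenerateMul Y] {s t : X ⊗[ℂ] Y}
    (h : ∀ y, mulR₂ y s = mulR₂ y t) : s = t :=
  sub_eq_zero.1 <| lTensor_separating (fun y : Y => LinearMap.mulRight ℂ y)
    (fun y => NondegenerateMul.eq_zero_of_mul_right y) _ fun y => by
      rw [map_sub, sub_eq_zero]; exact h y

theorem lmul_multAssoc (m : Mult ((X ⊗[ℂ] Y) ⊗[ℂ] Z)) (w : (X ⊗[ℂ] Y) ⊗[ℂ] Z) :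
    (multAssoc m).lmul (TensorProduct.assoc ℂ X Y Z w) = TensorProduct.assoc ℂ X Y Z (m.lmul w) :=
  congrArg (fun v => TensorProduct.assoc ℂ X Y Z (m.lmul v)) (LinearEquiv.symm_apply_apply _ w)

theorem rmul_multAssoc (m : Mult ((X ⊗[ℂ] Y) ⊗[ℂ] Z)) (w : (X ⊗[ℂ] Y) ⊗[ℂ] Z) :
    (multAssoc m).rmul (TensorProduct.assoc ℂ X Y Z w) = TensorProduct.assoc ℂ X Y Z (m.rmul w) :=
  congrArg (fun v => TensorProduct.assoc ℂ X Y Z (m.rmul v)) (LinearEquiv.symm_apply_apply _ w)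

theorem multAssoc_incl (w : (X ⊗[ℂ] Y) ⊗[ℂ] Z) :
    multAssoc (incl _ w) = incl _ (TensorProduct.assoc ℂ X Y Z w) :=
  Mult.ext
    (fun v => by
      obtain ⟨v, rfl⟩ := (TensorProduct.assoc ℂ X Y Z).surjective v
      rw [lmul_multAssoc, lmul_incl, lmul_incl, assoc_mul])
    (fun v => by
      obtain ⟨v, rfl⟩ := (TensorProduct.assoc ℂ X Y Z).surjective v
      rw [rmul_multAssoc, rmul_incl, rmul_incl, assoc_mul])

theorem multAssoc_tmul_tmul (l : Mult X) (m : Mult Y) (n : Mult Z) :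
    multAssoc (tmul (tmul l m) n) = tmul l (tmul m n) := by
  have hlmul : (multAssoc (tmul (tmul l m) n)).lmul = (tmul l (tmul m n)).lmul :=
    TensorProduct.ext_threefold' fun x y z => lmul_multAssoc _ ((x ⊗ₜ y) ⊗ₜ z)
  have hrmul : (multAssoc (tmul (tmul l m) n)).rmul = (tmul l (tmul m n)).rmul :=
    TensorProduct.ext_threefold' fun x y z => rmul_multAssoc _ ((x ⊗ₜ y) ⊗ₜ z)
  exact Mult.ext (LinearMap.congr_fun hlmul) (LinearMap.congr_fun hrmul)

theorem tmul_one_commute (m : Mult X) (n : Mult Y) :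
    Commute (tmul m (1 : Mult Y)) (tmul (1 : Mult X) n) := by
  simp [Commute, SemiconjBy, tmul_mul_tmul]

theorem tensorHom_mulL₁ (f : X →ₙₐ[ℂ] Mult X') (g : Y →ₙₐ[ℂ] Mult Y') (x : X) (w : X ⊗[ℂ] Y) :
    tensorHom f g (mulL₁ x w) = tmul (f x) 1 * tensorHom f g w := by
  induction w with
  | zero => simp
  | add s t hs ht => simp only [map_add, mul_add, hs, ht]
  | tmul => simp [tmul_mul_tmul]

theorem tensorHom_mulL₂ (f : X →ₙₐ[ℂ] Mult X') (g : Y →ₙₐ[ℂ] Mult Y') (y : Y) (w : X ⊗[ℂ] Y) :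
    tensorHom f g (mulL₂ y w) = tmul 1 (g y) * tensorHom f g w := by
  induction w with
  | zero => simp
  | add s t hs ht => simp only [map_add, mul_add, hs, ht]
  | tmul => simp [tmul_mul_tmul]

theorem tensorHom_mulR₁ (f : X →ₙₐ[ℂ] Mult X') (g : Y →ₙₐ[ℂ] Mult Y') (x : X) (w : X ⊗[ℂ] Y) :
    tensorHom f g (mulR₁ x w) = tensorHom f g w * tmul (f x) 1 := by
  induction w with
  | zero => simp
  | add s t hs ht => simp only [map_add, add_mul, hs, ht]
  | tmul => simp [tmul_mul_tmul]

theorem tensorHom_mulR₂ (f : X →ₙₐ[ℂ] Mult X') (g : Y →ₙₐ[ℂ] Mult Y') (y : Y) (w : X ⊗[ℂ] Y) :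
    tensorHom f g (mulR₂ y w) = tensorHom f g w * tmul 1 (g y) := by
  induction w with
  | zero => simp
  | add s t hs ht => simp only [map_add, add_mul, hs, ht]
  | tmul => simp [tmul_mul_tmul]

theorem Mult.eq_of_tmul_one_mul [NondegenerateMul X] [NondegenerateMul Y]
    {m n : Mult (X ⊗[ℂ] Y)}
    (h : ∀ x, tmul (incl X x) 1 * m = tmul (incl X x) 1 * n) : m = n :=
  Mult.ext_lmul fun w => eq_of_mulL₁_eq fun x => congrArg (fun k => k.lmul w) (h x)

theorem Mult.eq_of_mul_one_tmul_one_tmul [NondegenerateMul X] [NondegenerateMul Y]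
    [NondegenerateMul Z] {m n : Mult (X ⊗[ℂ] (Y ⊗[ℂ] Z))}
    (h : ∀ z, m * tmul 1 (tmul 1 (incl Z z)) = n * tmul 1 (tmul 1 (incl Z z))) : m = n :=
  Mult.ext_rmul fun w => sub_eq_zero.1 <| lTensor_separating (fun z : Z => mulR₂ (X := Y) z)
    (fun s hs => eq_of_mulR₂_eq fun z => (hs z).trans (map_zero _).symm) _ fun z => by
      rw [map_sub, sub_eq_zero]
      exact congrArg (fun k => k.rmul w) (h z)

theorem rTensor_mul'_comm_assoc_symm (x : X) (w : X ⊗[ℂ] Y) :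
    (LinearMap.mul' ℂ X ∘ₗ (TensorProduct.comm ℂ X X).toLinearMap).rTensor Y
      ((TensorProduct.assoc ℂ X X Y).symm (x ⊗ₜ w)) = mulR₁ x w :=
  LinearMap.congr_fun
    (f := (LinearMap.mul' ℂ X ∘ₗ (TensorProduct.comm ℂ X X).toLinearMap).rTensor Y ∘ₗ
      (TensorProduct.assoc ℂ X X Y).symm.toLinearMap ∘ₗ TensorProduct.mk ℂ X (X ⊗[ℂ] Y) x)
    (TensorProduct.ext' fun _ _ => by simp) w

theorem lmul_leg12 (E : Mult (X ⊗[ℂ] Y)) (w : X ⊗[ℂ] Y) (z : Z) :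
    (leg12 Z E).lmul (TensorProduct.assoc ℂ X Y Z (w ⊗ₜ z)) =
      TensorProduct.assoc ℂ X Y Z (E.lmul w ⊗ₜ z) :=
  lmul_multAssoc (tmul E 1) (w ⊗ₜ z)

theorem lmul_leg13 (E : Mult (X ⊗[ℂ] Y)) (w : X ⊗[ℂ] Y) (z : Z) :
    (leg13 Z E).lmul ((TensorProduct.comm ℂ Y Z).lTensor X
        (TensorProduct.assoc ℂ X Y Z (w ⊗ₜ z))) =
      (TensorProduct.comm ℂ Y Z).lTensor X (TensorProduct.assoc ℂ X Y Z (E.lmul w ⊗ₜ z)) := by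
  rw [← lmul_leg12]
  exact congrArg (fun v => (TensorProduct.comm ℂ Y Z).lTensor X ((leg12 Z E).lmul v))
    (LinearEquiv.symm_apply_apply _ _)

end MultiplierLemmas

section ProductLemmas

variable {X : Type*} [NonUnitalRing X] [Module ℂ X] [IsScalarTower ℂ X X] [SMulCommClass ℂ X X]

theorem mul'_mulL₁ (x : X) (w : X ⊗[ℂ] X) :
    LinearMap.mul' ℂ X (mulL₁ x w) = x * LinearMap.mul' ℂ X w :=
  LinearMap.congr_fun (f := LinearMap.mul' ℂ X ∘ₗ mulL₁ x)
    (g := LinearMap.mulLeft ℂ x ∘ₗ LinearMap.mul' ℂ X)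
    (TensorProduct.ext' fun _ _ => by simp [mul_assoc]) w

theorem mul'_mulR₂ (x : X) (w : X ⊗[ℂ] X) :
    LinearMap.mul' ℂ X (mulR₂ x w) = LinearMap.mul' ℂ X w * x :=
  LinearMap.congr_fun (f := LinearMap.mul' ℂ X ∘ₗ mulR₂ x)
    (g := LinearMap.mulRight ℂ x ∘ₗ LinearMap.mul' ℂ X)
    (TensorProduct.ext' fun _ _ => by simp [mul_assoc]) w

theorem lTensor_mul'_assoc (w : X ⊗[ℂ] X) (x : X) :
    (LinearMap.mul' ℂ X).lTensor X (TensorProduct.assoc ℂ X X X (w ⊗ₜ x)) = mulR₂ x w :=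
  LinearMap.congr_fun
    (f := (LinearMap.mul' ℂ X).lTensor X ∘ₗ (TensorProduct.assoc ℂ X X X).toLinearMap ∘ₗ
      (TensorProduct.mk ℂ (X ⊗[ℂ] X) X).flip x)
    (g := mulR₂ x) (TensorProduct.ext' fun _ _ => by simp) w

theorem rTensor_mul'_assoc_symm (x : X) (w : X ⊗[ℂ] X) :
    (LinearMap.mul' ℂ X).rTensor X ((TensorProduct.assoc ℂ X X X).symm (x ⊗ₜ w)) = mulL₁ x w :=
  LinearMap.congr_fun
    (f := (LinearMap.mul' ℂ X).rTensor X ∘ₗ (TensorProduct.assoc ℂ X X X).symm.toLinearMap ∘ₗ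
      TensorProduct.mk ℂ X (X ⊗[ℂ] X) x)
    (g := mulL₁ x) (TensorProduct.ext' fun _ _ => by simp) w

theorem sliceRight_mulL₁ (φ : X →ₗ[ℂ] ℂ) (x : X) (w : X ⊗[ℂ] X) :
    sliceRight φ (mulL₁ x w) = x * sliceRight φ w :=
  sliceRight_rTensor φ (LinearMap.mulLeft ℂ x) w

theorem sliceRight_mulR₁ (φ : X →ₗ[ℂ] ℂ) (x : X) (w : X ⊗[ℂ] X) :
    sliceRight φ (mulR₁ x w) = sliceRight φ w * x :=
  sliceRight_rTensor φ (LinearMap.mulRight ℂ x) w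

theorem sliceLeft_mulL₂ (φ : X →ₗ[ℂ] ℂ) (x : X) (w : X ⊗[ℂ] X) :
    sliceLeft φ (mulL₂ x w) = x * sliceLeft φ w :=
  sliceLeft_lTensor φ (LinearMap.mulLeft ℂ x) w

theorem sliceLeft_mulR₂ (φ : X →ₗ[ℂ] ℂ) (x : X) (w : X ⊗[ℂ] X) :
    sliceLeft φ (mulR₂ x w) = sliceLeft φ w * x :=
  sliceLeft_lTensor φ (LinearMap.mulRight ℂ x) w

theorem lTensor_mulL₂_leftLegs (T : X ⊗[ℂ] X ≃ₗ[ℂ] X ⊗[ℂ] X) (z : X) (x : X ⊗[ℂ] (X ⊗[ℂ] X)) :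
    (mulL₂ z).lTensor X (leftLegs T x) = leftLegs T ((mulL₂ z).lTensor X x) := by
  have lTensor_mulL₂_assoc (v : X ⊗[ℂ] X) (c : X) :
      (mulL₂ z).lTensor X (TensorProduct.assoc ℂ X X X (v ⊗ₜ c)) =
        TensorProduct.assoc ℂ X X X (v ⊗ₜ (z * c)) :=
    LinearMap.congr_fun
      (f := (mulL₂ z).lTensor X ∘ₗ (TensorProduct.assoc ℂ X X X).toLinearMap ∘ₗ
        (TensorProduct.mk ℂ (X ⊗[ℂ] X) X).flip c)
      (g := (TensorProduct.assoc ℂ X X X).toLinearMap ∘ₗ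
        (TensorProduct.mk ℂ (X ⊗[ℂ] X) X).flip (z * c))
      (TensorProduct.ext' fun _ _ => by simp) v
  refine LinearMap.congr_fun
    (f := (mulL₂ z).lTensor X ∘ₗ (leftLegs T).toLinearMap)
    (g := (leftLegs T).toLinearMap ∘ₗ (mulL₂ z).lTensor X)
    (TensorProduct.ext_threefold' fun a b c => ?_) x
  change (mulL₂ z).lTensor X (leftLegs T (a ⊗ₜ (b ⊗ₜ c))) = leftLegs T (a ⊗ₜ (b ⊗ₜ (z * c)))
  rw [leftLegs_tmul, leftLegs_tmul, lTensor_mulL₂_assoc]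

end ProductLemmas

namespace IsNondegenerateHom

variable {X Y Z W : Type*}
  [NonUnitalRing X] [Module ℂ X] [IsScalarTower ℂ X X] [SMulCommClass ℂ X X]
  [NonUnitalRing Y] [Module ℂ Y] [IsScalarTower ℂ Y Y] [SMulCommClass ℂ Y Y]
  [NonUnitalRing Z] [Module ℂ Z] [IsScalarTower ℂ Z Z] [SMulCommClass ℂ Z Z]
  [NonUnitalRing W] [Module ℂ W] [IsScalarTower ℂ W W] [SMulCommClass ℂ W W]

omit [IsScalarTower ℂ X X] [SMulCommClass ℂ X X] in
theorem of_surjective {α : X →ₙₐ[ℂ] Mult Y} (hl : Function.Surjective (lact α))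
    (hr : Function.Surjective (ract α)) : IsNondegenerateHom α where
  span_lmul := by
    rw [← LinearMap.range_eq_top.2 hl, LinearMap.range_eq_map,
      ← TensorProduct.span_tmul_eq_top, Submodule.map_span]
    congr 1
    ext z
    exact ⟨fun ⟨x, y, hz⟩ => ⟨x ⊗ₜ y, ⟨x, y, rfl⟩, hz.symm⟩,
      fun ⟨_, ⟨x, y, hxy⟩, hz⟩ => ⟨x, y, by rw [← hz, ← hxy]; rfl⟩⟩
  span_rmul := by
    rw [← LinearMap.range_eq_top.2 hr, LinearMap.range_eq_map,
      ← TensorProduct.span_tmul_eq_top, Submodule.map_span]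
    congr 1
    ext z
    exact ⟨fun ⟨x, y, hz⟩ => ⟨x ⊗ₜ y, ⟨x, y, rfl⟩, hz.symm⟩,
      fun ⟨_, ⟨x, y, hxy⟩, hz⟩ => ⟨x, y, by rw [← hz, ← hxy]; rfl⟩⟩

theorem extend_eq [NondegenerateMul Y] {α : X →ₙₐ[ℂ] Mult Y} (h : IsNondegenerateHom α)
    {m : Mult X} {n : Mult Y} (hn : ∀ x y, n.lmul ((α x).lmul y) = (α (m.lmul x)).lmul y) :
    h.extend m = n :=
  Mult.ext_lmul fun y => by
    obtain ⟨t, rfl⟩ := h.lact_surjective y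
    exact LinearMap.congr_fun (f := (h.extend m).lmul ∘ₗ lact α) (g := n.lmul ∘ₗ lact α)
      (TensorProduct.ext' fun x y => (h.extend_lmul m x y).trans (hn x y).symm) t

theorem of_incl (h : Function.Surjective (LinearMap.mul' ℂ X)) :
    IsNondegenerateHom (incl X) := by
  have lact_incl : lact (incl X) = LinearMap.mul' ℂ X := TensorProduct.ext' fun x y => by simp
  have ract_incl : ract (incl X) =
      LinearMap.mul' ℂ X ∘ₗ (TensorProduct.comm ℂ X X).toLinearMap :=
    TensorProduct.ext' fun x y => by simp
  refine of_surjective (lact_incl ▸ h) ?_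
  rw [ract_incl]
  exact h.comp (TensorProduct.comm ℂ X X).surjective

theorem lact_tensorHom (f : X →ₙₐ[ℂ] Mult Z) (g : Y →ₙₐ[ℂ] Mult W) :
    lact (tensorHom f g) = TensorProduct.map (lact f) (lact g) ∘ₗ
      (TensorProduct.tensorTensorTensorComm ℂ X Y Z W).toLinearMap := by
  ext; simp

theorem ract_tensorHom (f : X →ₙₐ[ℂ] Mult Z) (g : Y →ₙₐ[ℂ] Mult W) :
    ract (tensorHom f g) = TensorProduct.map (ract f) (ract g) ∘ₗ
      (TensorProduct.tensorTensorTensorComm ℂ X Y Z W).toLinearMap := by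
  ext; simp

theorem tensorHom {f : X →ₙₐ[ℂ] Mult Z} {g : Y →ₙₐ[ℂ] Mult W} (hf : IsNondegenerateHom f)
    (hg : IsNondegenerateHom g) : IsNondegenerateHom (tensorHom f g) := by
  refine of_surjective ?_ ?_
  · rw [lact_tensorHom]
    exact (TensorProduct.map_surjective hf.lact_surjective hg.lact_surjective).comp
      (TensorProduct.tensorTensorTensorComm ℂ X Y Z W).surjective
  · rw [ract_tensorHom]
    exact (TensorProduct.map_surjective hf.ract_surjective hg.ract_surjective).comp
      (TensorProduct.tensorTensorTensorComm ℂ X Y Z W).surjective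

theorem multAssoc_comp {α : W →ₙₐ[ℂ] Mult ((X ⊗[ℂ] Y) ⊗[ℂ] Z)} (h : IsNondegenerateHom α) :
    IsNondegenerateHom
      (NonUnitalAlgHom.comp (multAssoc (X := X) (Y := Y) (Z := Z)).toNonUnitalAlgHom α) := by
  have lact_comp : lact (NonUnitalAlgHom.comp multAssoc.toNonUnitalAlgHom α) ∘ₗ
      (TensorProduct.assoc ℂ X Y Z).toLinearMap.lTensor W =
        (TensorProduct.assoc ℂ X Y Z).toLinearMap ∘ₗ lact α :=
    TensorProduct.ext' fun w v => lmul_multAssoc (α w) v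
  have ract_comp : ract (NonUnitalAlgHom.comp multAssoc.toNonUnitalAlgHom α) ∘ₗ
      (TensorProduct.assoc ℂ X Y Z).toLinearMap.lTensor W =
        (TensorProduct.assoc ℂ X Y Z).toLinearMap ∘ₗ ract α :=
    TensorProduct.ext' fun w v => rmul_multAssoc (α w) v
  refine of_surjective (.of_comp (g := (TensorProduct.assoc ℂ X Y Z).toLinearMap.lTensor W) ?_)
    (.of_comp (g := (TensorProduct.assoc ℂ X Y Z).toLinearMap.lTensor W) ?_)
  · rw [← LinearMap.coe_comp, lact_comp]
    exact (TensorProduct.assoc ℂ X Y Z).surjective.comp h.lact_surjective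
  · rw [← LinearMap.coe_comp, ract_comp]
    exact (TensorProduct.assoc ℂ X Y Z).surjective.comp h.ract_surjective

end IsNondegenerateHom

section ActingPairing

open AlgebraicQuantumGroup

theorem exists_comp_eq_of_range_le {U V W : Type*} [AddCommGroup U] [Module ℂ U]
    [AddCommGroup V] [Module ℂ V] [AddCommGroup W] [Module ℂ W] {f : U →ₗ[ℂ] W} {g : V →ₗ[ℂ] W}
    (h : LinearMap.range f ≤ LinearMap.range g) : ∃ F : U →ₗ[ℂ] V, g ∘ₗ F = f := by
  obtain ⟨F, hF⟩ := Module.projective_lifting_property g.rangeRestrict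
    (f.codRestrict _ fun u => h ⟨u, rfl⟩) g.surjective_rangeRestrict
  exact ⟨F, LinearMap.ext fun u => congrArg Subtype.val (LinearMap.congr_fun hF u)⟩

theorem range_le_range_of_tmul {U U' V W : Type*} [AddCommGroup U] [Module ℂ U]
    [AddCommGroup U'] [Module ℂ U'] [AddCommGroup V] [Module ℂ V] [AddCommGroup W] [Module ℂ W]
    {f : U ⊗[ℂ] U' →ₗ[ℂ] W} {g : V →ₗ[ℂ] W} (h : ∀ u u', ∃ v, g v = f (u ⊗ₜ u')) :
    LinearMap.range f ≤ LinearMap.range g := by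
  rw [LinearMap.range_eq_map, ← TensorProduct.span_tmul_eq_top, Submodule.map_span,
    Submodule.span_le]
  rintro _ ⟨_, ⟨u, u', rfl⟩, rfl⟩
  exact h u u'

section TensorPairing

variable {X X' Y Y' : Type*} [AddCommGroup X] [Module ℂ X] [AddCommGroup X'] [Module ℂ X']
  [AddCommGroup Y] [Module ℂ Y] [AddCommGroup Y'] [Module ℂ Y']
  {P : X →ₗ[ℂ] Y →ₗ[ℂ] ℂ} {P' : X' →ₗ[ℂ] Y' →ₗ[ℂ] ℂ}

theorem separatingLeft_tensorPairing (h : P.SeparatingLeft) (h' : P'.SeparatingLeft) :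
    (tensorPairing P P').SeparatingLeft := fun t ht =>
  rTensor_separating P.flip h t fun y => lTensor_separating P'.flip h' _ fun y' =>
    (TensorProduct.lid ℂ ℂ).injective <| by
      rw [map_zero, ← ht (y ⊗ₜ y')]
      exact LinearMap.congr_fun
        (f := (TensorProduct.lid ℂ ℂ).toLinearMap ∘ₗ (P'.flip y').lTensor ℂ ∘ₗ
          (P.flip y).rTensor X')
        (g := (tensorPairing P P').flip (y ⊗ₜ y')) (TensorProduct.ext' fun x x' => by simp) t

theorem flip_tensorPairing : (tensorPairing P P').flip = tensorPairing P.flip P'.flip :=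
  TensorProduct.ext' fun _ _ => TensorProduct.ext' fun _ _ => rfl

theorem nondegenerate_tensorPairing (h : P.Nondegenerate) (h' : P'.Nondegenerate) :
    (tensorPairing P P').Nondegenerate := by
  refine ⟨separatingLeft_tensorPairing h.1 h'.1, ?_⟩
  rw [← LinearMap.flip_separatingLeft, flip_tensorPairing]
  exact separatingLeft_tensorPairing (LinearMap.flip_separatingLeft.2 h.2)
    (LinearMap.flip_separatingLeft.2 h'.2)

theorem tensorPairing_map₂ {μ : X →ₗ[ℂ] X →ₗ[ℂ] X} {μ' : X' →ₗ[ℂ] X' →ₗ[ℂ] X'}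
    {L : X →ₗ[ℂ] Y →ₗ[ℂ] Y} {L' : X' →ₗ[ℂ] Y' →ₗ[ℂ] Y'}
    (h : ∀ x' x y, P x' (L x y) = P (μ x' x) y)
    (h' : ∀ x' x y, P' x' (L' x y) = P' (μ' x' x) y) (t' t : X ⊗[ℂ] X') (s : Y ⊗[ℂ] Y') :
    tensorPairing P P' t' (TensorProduct.map₂ L L' t s) =
      tensorPairing P P' (TensorProduct.map₂ μ μ' t' t) s := by
  induction t' with
  | zero => simp
  | add u v hu hv => simp only [map_add, LinearMap.add_apply, hu, hv]
  | tmul x₁ x₁' =>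
    induction t with
    | zero => simp
    | add u v hu hv => simp only [map_add, LinearMap.add_apply, hu, hv]
    | tmul x x' =>
      induction s with
      | zero => simp
      | add u v hu hv => simp only [map_add, hu, hv]
      | tmul y y' => simp [h, h']

end TensorPairing

section MulTensor

variable {X X' : Type*}
  [NonUnitalRing X] [Module ℂ X] [IsScalarTower ℂ X X] [SMulCommClass ℂ X X]
  [NonUnitalRing X'] [Module ℂ X'] [IsScalarTower ℂ X' X'] [SMulCommClass ℂ X' X']

theorem map₂_mul (t s : X ⊗[ℂ] X') :
    TensorProduct.map₂ (LinearMap.mul ℂ X) (LinearMap.mul ℂ X') t s = t * s :=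
  LinearMap.congr_fun₂
    (f := TensorProduct.map₂ (LinearMap.mul ℂ X) (LinearMap.mul ℂ X'))
    (g := LinearMap.mul ℂ (X ⊗[ℂ] X'))
    (TensorProduct.ext' fun _ _ => TensorProduct.ext' fun _ _ => by simp) t s

theorem map₂_mul_flip (t s : X ⊗[ℂ] X') :
    TensorProduct.map₂ (LinearMap.mul ℂ X).flip (LinearMap.mul ℂ X').flip t s = s * t :=
  LinearMap.congr_fun₂
    (f := TensorProduct.map₂ (LinearMap.mul ℂ X).flip (LinearMap.mul ℂ X').flip)
    (g := (LinearMap.mul ℂ (X ⊗[ℂ] X')).flip)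
    (TensorProduct.ext' fun _ _ => TensorProduct.ext' fun _ _ => by simp) t s

end MulTensor

variable {X Y X' Y' : Type*}
  [NonUnitalRing X] [Module ℂ X] [AddCommGroup Y] [Module ℂ Y]
  [NonUnitalRing X'] [Module ℂ X'] [AddCommGroup Y'] [Module ℂ Y']
  {P : X →ₗ[ℂ] Y →ₗ[ℂ] ℂ} {P' : X' →ₗ[ℂ] Y' →ₗ[ℂ] ℂ}

/-- A non-degenerate pairing of an algebra `X` with a vector space `Y`, together with the actions
`actL x y = x ▹ y` and `actR x y = y ◃ x` of `X` on `Y` dual to the multiplications of `X`. -/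
structure ActingPairing (P : X →ₗ[ℂ] Y →ₗ[ℂ] ℂ) where
  nondegenerate : P.Nondegenerate
  actL : X →ₗ[ℂ] Y →ₗ[ℂ] Y
  actR : X →ₗ[ℂ] Y →ₗ[ℂ] Y
  pairing_actL : ∀ x' x y, P x' (actL x y) = P (x' * x) y
  pairing_actR : ∀ x' x y, P x' (actR x y) = P (x * x') y

namespace ActingPairing

variable (T : ActingPairing P) (T' : ActingPairing P')

include T in
theorem eq_left {x z : X} (h : ∀ y, P x y = P z y) : x = z :=
  sub_eq_zero.1 (T.nondegenerate.1 _ fun y => by rw [map_sub, LinearMap.sub_apply, h, sub_self])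

include T in
theorem eq_right {y z : Y} (h : ∀ x, P x y = P x z) : y = z :=
  sub_eq_zero.1 (T.nondegenerate.2 _ fun x => by rw [map_sub, h, sub_self])

theorem actL_mul (x x' : X) (y : Y) : T.actL (x * x') y = T.actL x (T.actL x' y) :=
  T.eq_right fun u => by simp only [pairing_actL, mul_assoc]

theorem actR_mul (x x' : X) (y : Y) : T.actR (x * x') y = T.actR x' (T.actR x y) :=
  T.eq_right fun u => by simp only [pairing_actR, mul_assoc]

theorem actL_actR (x x' : X) (y : Y) : T.actL x (T.actR x' y) = T.actR x' (T.actL x y) :=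
  T.eq_right fun u => by simp only [pairing_actR, pairing_actL, mul_assoc]

variable [IsScalarTower ℂ X X] [SMulCommClass ℂ X X]
  [IsScalarTower ℂ X' X'] [SMulCommClass ℂ X' X']

theorem isExtendedPairing_iff {m : Mult X} {e : Y →ₗ[ℂ] ℂ} :
    IsExtendedPairing P m e ↔ (∀ x y, P (m.lmul x) y = e (T.actL x y)) ∧
      ∀ x y, P (m.rmul x) y = e (T.actR x y) := by
  constructor
  · rintro ⟨hl, hr⟩
    exact ⟨fun x y => (hl x y _ fun x' => T.pairing_actL x' x y).symm,
      fun x y => (hr x y _ fun x' => T.pairing_actR x' x y).symm⟩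
  · rintro ⟨hl, hr⟩
    refine ⟨fun x y z hz => ?_, fun x y z hz => ?_⟩
    · rw [hl, T.eq_right fun x' => (hz x').trans (T.pairing_actL x' x y).symm]
    · rw [hr, T.eq_right fun x' => (hz x').trans (T.pairing_actR x' x y).symm]

theorem existsUnique_isExtendedPairing {e : Y →ₗ[ℂ] ℂ}
    (hL : LinearMap.range (T.actL.compr₂ e) ≤ LinearMap.range P)
    (hR : LinearMap.range (T.actR.compr₂ e) ≤ LinearMap.range P) :
    ∃! m, IsExtendedPairing P m e := by
  obtain ⟨L, hL⟩ := exists_comp_eq_of_range_le hL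
  obtain ⟨R, hR⟩ := exists_comp_eq_of_range_le hR
  replace hL : ∀ x y, P (L x) y = e (T.actL x y) := LinearMap.congr_fun₂ hL
  replace hR : ∀ x y, P (R x) y = e (T.actR x y) := LinearMap.congr_fun₂ hR
  refine ⟨Mult.mk L R (fun x x' => T.eq_left fun y => ?_) (fun x x' => T.eq_left fun y => ?_)
    (fun x x' => T.eq_left fun y => ?_), T.isExtendedPairing_iff.2 ⟨hL, hR⟩, fun m hm => ?_⟩
  · rw [hL, actL_mul, ← hL, pairing_actL]
  · rw [hR, actR_mul, ← hR, pairing_actR]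
  · rw [← T.pairing_actL, hR, ← T.pairing_actR, hL, actL_actR]
  · obtain ⟨hmL, hmR⟩ := T.isExtendedPairing_iff.1 hm
    exact Mult.ext (fun x => T.eq_left fun y => by rw [hmL, Mult.lmul_mk, hL])
      (fun x => T.eq_left fun y => by rw [hmR, Mult.rmul_mk, hR])

include T in
theorem eq_of_isExtendedPairing [NondegenerateMul X] {m n : Mult X} {e : Y →ₗ[ℂ] ℂ}
    (hm : IsExtendedPairing P m e) (hn : ∀ x y, P (n.lmul x) y = e (T.actL x y)) : m = n :=
  Mult.ext_lmul fun x => T.eq_left fun y => by rw [(T.isExtendedPairing_iff.1 hm).1, hn]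

/-- The tensor product of two acting pairings, with the actions on both legs. -/
def tensor : ActingPairing (tensorPairing P P') where
  nondegenerate := nondegenerate_tensorPairing T.nondegenerate T'.nondegenerate
  actL := TensorProduct.map₂ T.actL T'.actL
  actR := TensorProduct.map₂ T.actR T'.actR
  pairing_actL t' t s := by
    rw [tensorPairing_map₂ T.pairing_actL T'.pairing_actL (μ := LinearMap.mul ℂ X)
      (μ' := LinearMap.mul ℂ X'), map₂_mul]
  pairing_actR t' t s := by
    rw [tensorPairing_map₂ T.pairing_actR T'.pairing_actR (μ := (LinearMap.mul ℂ X).flip)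
      (μ' := (LinearMap.mul ℂ X').flip), map₂_mul_flip]

@[simp] theorem tensor_actL_tmul (x : X) (x' : X') (y : Y) (y' : Y') :
    (T.tensor T').actL (x ⊗ₜ x') (y ⊗ₜ y') = T.actL x y ⊗ₜ T'.actL x' y' := rfl

@[simp] theorem tensor_actR_tmul (x : X) (x' : X') (y : Y) (y' : Y') :
    (T.tensor T').actR (x ⊗ₜ x') (y ⊗ₜ y') = T.actR x y ⊗ₜ T'.actR x' y' := rfl

end ActingPairing

end ActingPairing

namespace RegularMultiplierHopfAlgebra

variable {A : Type*} [NonUnitalRing A] [Module ℂ A] [IsScalarTower ℂ A A] [SMulCommClass ℂ A A]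
  [NondegenerateMul A] (H : RegularMultiplierHopfAlgebra A)

/-- The bijection `a ⊗ b ↦ Δ(a)(1 ⊗ b)`. -/
def can₁ : A ⊗[ℂ] A ≃ₗ[ℂ] A ⊗[ℂ] A := H.exists_equiv_comul_mul_right.choose

/-- The bijection `a ⊗ b ↦ (a ⊗ 1)Δ(b)`. -/
def can₂ : A ⊗[ℂ] A ≃ₗ[ℂ] A ⊗[ℂ] A := H.exists_equiv_left_mul_comul.choose

/-- The bijection `a ⊗ b ↦ Δ(b)(a ⊗ 1)`; the flip keeps the multiplying factor in its leg. -/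
def can₃ : A ⊗[ℂ] A ≃ₗ[ℂ] A ⊗[ℂ] A :=
  TensorProduct.comm ℂ A A ≪≫ₗ H.exists_equiv_comul_mul_left.choose

/-- The bijection `a ⊗ b ↦ (1 ⊗ b)Δ(a)`; the flip keeps the multiplying factor in its leg. -/
def can₄ : A ⊗[ℂ] A ≃ₗ[ℂ] A ⊗[ℂ] A :=
  TensorProduct.comm ℂ A A ≪≫ₗ H.exists_equiv_right_mul_comul.choose

theorem incl_can₁ (a b : A) :
    incl (A ⊗[ℂ] A) (H.can₁ (a ⊗ₜ b)) = H.comul a * tmul 1 (incl A b) :=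
  H.exists_equiv_comul_mul_right.choose_spec a b

theorem incl_can₂ (a b : A) :
    incl (A ⊗[ℂ] A) (H.can₂ (a ⊗ₜ b)) = tmul (incl A a) 1 * H.comul b :=
  H.exists_equiv_left_mul_comul.choose_spec a b

theorem incl_can₃ (a b : A) :
    incl (A ⊗[ℂ] A) (H.can₃ (a ⊗ₜ b)) = H.comul b * tmul (incl A a) 1 :=
  H.exists_equiv_comul_mul_left.choose_spec b a

theorem incl_can₄ (a b : A) :
    incl (A ⊗[ℂ] A) (H.can₄ (a ⊗ₜ b)) = tmul 1 (incl A b) * H.comul a :=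
  H.exists_equiv_right_mul_comul.choose_spec b a

theorem mulR₁_can₁ (a b x : A) : mulR₁ x (H.can₁ (a ⊗ₜ b)) = (H.comul a).lmul (x ⊗ₜ b) :=
  incl_injective (by
    rw [incl_mulR₁, incl_can₁, incl_lmul, mul_assoc, tmul_mul_tmul, one_mul, mul_one, incl_tmul])

theorem mulR₂_can₃ (a b x : A) : mulR₂ x (H.can₃ (a ⊗ₜ b)) = (H.comul b).lmul (a ⊗ₜ x) :=
  incl_injective (by
    rw [incl_mulR₂, incl_can₃, incl_lmul, mul_assoc, tmul_mul_tmul, one_mul, mul_one, incl_tmul])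

theorem mulL₂_can₂ (a b x : A) : mulL₂ x (H.can₂ (a ⊗ₜ b)) = (H.comul b).rmul (a ⊗ₜ x) :=
  incl_injective (by
    rw [incl_mulL₂, incl_can₂, incl_rmul, ← mul_assoc, tmul_mul_tmul, one_mul, mul_one,
      incl_tmul])

theorem mulL₁_can₄ (a b x : A) : mulL₁ x (H.can₄ (a ⊗ₜ b)) = (H.comul a).rmul (x ⊗ₜ b) :=
  incl_injective (by
    rw [incl_mulL₁, incl_can₄, incl_rmul, ← mul_assoc, tmul_mul_tmul, one_mul, mul_one,
      incl_tmul])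

theorem mulL₁_can₁ (a b x : A) :
    mulL₁ x (H.can₁ (a ⊗ₜ b)) = mulR₂ b (H.can₂ (x ⊗ₜ a)) :=
  incl_injective (by rw [incl_mulL₁, incl_can₁, incl_mulR₂, incl_can₂, mul_assoc])

theorem mulL₂_can₃ (a b x : A) :
    mulL₂ x (H.can₃ (a ⊗ₜ b)) = mulR₁ a (H.can₄ (b ⊗ₜ x)) :=
  incl_injective (by rw [incl_mulL₂, incl_can₃, incl_mulR₁, incl_can₄, mul_assoc])

theorem mulL₁_can₃ (a b x : A) :
    mulL₁ x (H.can₃ (a ⊗ₜ b)) = mulR₁ a (H.can₂ (x ⊗ₜ b)) :=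
  incl_injective (by rw [incl_mulL₁, incl_can₃, incl_mulR₁, incl_can₂, mul_assoc])

theorem mulL₂_can₁ (a b x : A) :
    mulL₂ x (H.can₁ (a ⊗ₜ b)) = mulR₂ b (H.can₄ (a ⊗ₜ x)) :=
  incl_injective (by rw [incl_mulL₂, incl_can₁, incl_mulR₂, incl_can₄, mul_assoc])

theorem lmul_comul_can₁ (a : A) (w : A ⊗[ℂ] A) :
    (H.comul a).lmul (H.can₁ w) = H.can₁ (mulL₁ a w) :=
  LinearMap.congr_fun (f := (H.comul a).lmul ∘ₗ H.can₁) (g := H.can₁ ∘ₗ mulL₁ a)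
    (TensorProduct.ext' fun p q => incl_injective (by
      simp [incl_lmul, incl_can₁, mul_assoc])) w

theorem lmul_comul_can₃ (a : A) (w : A ⊗[ℂ] A) :
    (H.comul a).lmul (H.can₃ w) = H.can₃ (mulL₂ a w) :=
  LinearMap.congr_fun (f := (H.comul a).lmul ∘ₗ H.can₃) (g := H.can₃ ∘ₗ mulL₂ a)
    (TensorProduct.ext' fun p q => incl_injective (by
      simp [incl_lmul, incl_can₃, mul_assoc])) w

theorem rmul_comul_can₂ (a : A) (w : A ⊗[ℂ] A) :
    (H.comul a).rmul (H.can₂ w) = H.can₂ (mulR₂ a w) :=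
  LinearMap.congr_fun (f := (H.comul a).rmul ∘ₗ H.can₂) (g := H.can₂ ∘ₗ mulR₂ a)
    (TensorProduct.ext' fun p q => incl_injective (by
      simp [incl_rmul, incl_can₂, mul_assoc])) w

theorem rmul_comul_can₄ (a : A) (w : A ⊗[ℂ] A) :
    (H.comul a).rmul (H.can₄ w) = H.can₄ (mulR₁ a w) :=
  LinearMap.congr_fun (f := (H.comul a).rmul ∘ₗ H.can₄) (g := H.can₄ ∘ₗ mulR₁ a)
    (TensorProduct.ext' fun p q => incl_injective (by
      simp [incl_rmul, incl_can₄, mul_assoc])) w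

theorem incl_lTensor_can₁ (t : A ⊗[ℂ] A) (c : A) :
    incl _ (H.can₁.lTensor A (TensorProduct.assoc ℂ A A A (t ⊗ₜ c))) =
      tensorHom (incl A) H.comul t * tmul 1 (tmul 1 (incl A c)) := by
  induction t with
  | zero => simp
  | add s t hs ht => simp only [TensorProduct.add_tmul, map_add, add_mul, hs, ht]
  | tmul => simp [incl_tmul, incl_can₁, tmul_mul_tmul]

theorem incl_lTensor_can₄ (t : A ⊗[ℂ] A) (c : A) :
    incl _ (H.can₄.lTensor A (TensorProduct.assoc ℂ A A A (t ⊗ₜ c))) =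
      tmul 1 (tmul 1 (incl A c)) * tensorHom (incl A) H.comul t := by
  induction t with
  | zero => simp
  | add s t hs ht => simp only [TensorProduct.add_tmul, map_add, mul_add, hs, ht]
  | tmul => simp [incl_tmul, incl_can₄, tmul_mul_tmul]

theorem incl_leftLegs_can₂ (a : A) (s : A ⊗[ℂ] A) :
    incl _ (leftLegs H.can₂ (a ⊗ₜ s)) =
      tmul (incl A a) 1 * multAssoc (tensorHom H.comul (incl A) s) := by
  induction s with
  | zero => simp
  | add s t hs ht => simp only [TensorProduct.tmul_add, map_add, mul_add, hs, ht]
  | tmul b c =>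
    rw [leftLegs_tmul, ← multAssoc_incl, incl_tmul, incl_can₂, tensorHom_tmul, ← tmul_one_one,
      ← multAssoc_tmul_tmul, ← map_mul multAssoc, tmul_mul_tmul, one_mul]

theorem incl_leftLegs_can₃ (a : A) (s : A ⊗[ℂ] A) :
    incl _ (leftLegs H.can₃ (a ⊗ₜ s)) =
      multAssoc (tensorHom H.comul (incl A) s) * tmul (incl A a) 1 := by
  induction s with
  | zero => simp
  | add s t hs ht => simp only [TensorProduct.tmul_add, map_add, add_mul, hs, ht]
  | tmul b c =>
    rw [leftLegs_tmul, ← multAssoc_incl, incl_tmul, incl_can₃, tensorHom_tmul, ← tmul_one_one,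
      ← multAssoc_tmul_tmul, ← map_mul multAssoc, tmul_mul_tmul, mul_one]

theorem lTensor_can₁_leftLegs_can₂ (x : A ⊗[ℂ] (A ⊗[ℂ] A)) :
    H.can₁.lTensor A (leftLegs H.can₂ x) = leftLegs H.can₂ (H.can₁.lTensor A x) := by
  refine LinearMap.congr_fun
    (f := (H.can₁.lTensor A).toLinearMap ∘ₗ (leftLegs H.can₂).toLinearMap)
    (g := (leftLegs H.can₂).toLinearMap ∘ₗ (H.can₁.lTensor A).toLinearMap)
    (TensorProduct.ext_threefold' fun a b c => incl_injective ?_) x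
  change incl _ (H.can₁.lTensor A (leftLegs H.can₂ (a ⊗ₜ (b ⊗ₜ c)))) =
    incl _ (leftLegs H.can₂ (a ⊗ₜ H.can₁ (b ⊗ₜ c)))
  rw [leftLegs_tmul, incl_lTensor_can₁, incl_leftLegs_can₂]
  exact (H.coassoc a b c _ _ (H.incl_can₁ b c) (H.incl_can₂ a b)).symm

theorem one_tmul_one_tmul_mul_tensorHom_can₃ (a b c : A) :
    tmul 1 (tmul 1 (incl A c)) * tensorHom (incl A) H.comul (H.can₃ (a ⊗ₜ b)) =
      multAssoc (tensorHom H.comul (incl A) (H.can₄ (b ⊗ₜ c))) * tmul (incl A a) 1 := by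
  refine Mult.eq_of_tmul_one_mul fun x => Mult.eq_of_mul_one_tmul_one_tmul fun d => ?_
  have coassoc := H.coassoc x b d _ _ (H.incl_can₁ b d) (H.incl_can₂ x b)
  set C : Mult (A ⊗[ℂ] (A ⊗[ℂ] A)) := tmul 1 (tmul 1 (incl A c))
  set D : Mult (A ⊗[ℂ] (A ⊗[ℂ] A)) := tmul 1 (tmul 1 (incl A d))
  set a₁ : Mult (A ⊗[ℂ] (A ⊗[ℂ] A)) := tmul (incl A a) 1
  set x₁ : Mult (A ⊗[ℂ] (A ⊗[ℂ] A)) := tmul (incl A x) 1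
  have hxC : Commute x₁ C := tmul_one_commute _ _
  have haD : Commute a₁ D := tmul_one_commute _ _
  have inner_left : x₁ * tensorHom (incl A) H.comul (H.can₃ (a ⊗ₜ b)) =
      tensorHom (incl A) H.comul (H.can₂ (x ⊗ₜ b)) * a₁ := by
    rw [← tensorHom_mulL₁, mulL₁_can₃, tensorHom_mulR₁]
  have inner_right : multAssoc (tensorHom H.comul (incl A) (H.can₄ (b ⊗ₜ c))) * D =
      C * multAssoc (tensorHom H.comul (incl A) (H.can₁ (b ⊗ₜ d))) := by
    simp only [D, C, ← multAssoc_tmul_tmul, ← map_mul, tmul_one_one, ← tensorHom_mulR₂,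
      ← tensorHom_mulL₂, mulL₂_can₁]
  calc x₁ * (C * tensorHom (incl A) H.comul (H.can₃ (a ⊗ₜ b))) * D
      = C * (x₁ * tensorHom (incl A) H.comul (H.can₃ (a ⊗ₜ b))) * D := by
        rw [← mul_assoc, hxC.eq, mul_assoc C]
    _ = C * (tensorHom (incl A) H.comul (H.can₂ (x ⊗ₜ b)) * D) * a₁ := by
        rw [inner_left]; simp only [mul_assoc, haD.eq]
    _ = x₁ * (C * multAssoc (tensorHom H.comul (incl A) (H.can₁ (b ⊗ₜ d)))) * a₁ := by
        rw [← coassoc, ← mul_assoc C, ← hxC.eq, mul_assoc x₁]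
    _ = x₁ * (multAssoc (tensorHom H.comul (incl A) (H.can₄ (b ⊗ₜ c))) * a₁) * D := by
        rw [← inner_right]; simp only [mul_assoc, haD.eq]

theorem lTensor_can₄_leftLegs_can₃ (x : A ⊗[ℂ] (A ⊗[ℂ] A)) :
    H.can₄.lTensor A (leftLegs H.can₃ x) = leftLegs H.can₃ (H.can₄.lTensor A x) := by
  refine LinearMap.congr_fun
    (f := (H.can₄.lTensor A).toLinearMap ∘ₗ (leftLegs H.can₃).toLinearMap)
    (g := (leftLegs H.can₃).toLinearMap ∘ₗ (H.can₄.lTensor A).toLinearMap)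
    (TensorProduct.ext_threefold' fun a b c => incl_injective ?_) x
  change incl _ (H.can₄.lTensor A (leftLegs H.can₃ (a ⊗ₜ (b ⊗ₜ c)))) =
    incl _ (leftLegs H.can₃ (a ⊗ₜ H.can₄ (b ⊗ₜ c)))
  rw [leftLegs_tmul, incl_lTensor_can₄, incl_leftLegs_can₃,
    one_tmul_one_tmul_mul_tensorHom_can₃]

theorem lTensor_mul'_leftLegs_can₂ (x : A ⊗[ℂ] (A ⊗[ℂ] A)) :
    (LinearMap.mul' ℂ A).lTensor A (leftLegs H.can₂ x) =
      (LinearMap.mul' ℂ A).rTensor A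
        ((TensorProduct.assoc ℂ A A A).symm (H.can₁.lTensor A x)) := by
  refine LinearMap.congr_fun
    (f := (LinearMap.mul' ℂ A).lTensor A ∘ₗ (leftLegs H.can₂).toLinearMap)
    (g := (LinearMap.mul' ℂ A).rTensor A ∘ₗ (TensorProduct.assoc ℂ A A A).symm.toLinearMap ∘ₗ
      (H.can₁.lTensor A).toLinearMap)
    (TensorProduct.ext_threefold' fun a b c => ?_) x
  change (LinearMap.mul' ℂ A).lTensor A (leftLegs H.can₂ (a ⊗ₜ (b ⊗ₜ c))) =
    (LinearMap.mul' ℂ A).rTensor A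
      ((TensorProduct.assoc ℂ A A A).symm (a ⊗ₜ H.can₁ (b ⊗ₜ c)))
  rw [leftLegs_tmul, lTensor_mul'_assoc, rTensor_mul'_assoc_symm, mulL₁_can₁]

theorem lTensor_can₁_symm_leftLegs_can₂ (t : A ⊗[ℂ] (A ⊗[ℂ] A)) :
    (H.can₁.lTensor A).symm (leftLegs H.can₂ t) =
      leftLegs H.can₂ ((H.can₁.lTensor A).symm t) := by
  rw [LinearEquiv.symm_apply_eq, lTensor_can₁_leftLegs_can₂, LinearEquiv.apply_symm_apply]

theorem tmul_mul'_can₁_symm (a b c : A) :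
    a ⊗ₜ[ℂ] LinearMap.mul' ℂ A (H.can₁.symm (b ⊗ₜ c)) =
      LinearMap.mul' ℂ A (H.can₂.symm (a ⊗ₜ b)) ⊗ₜ[ℂ] c := by
  obtain ⟨w, hw⟩ := H.can₂.surjective (a ⊗ₜ b)
  let y := TensorProduct.assoc ℂ A A A (w ⊗ₜ c)
  have hy : a ⊗ₜ[ℂ] (b ⊗ₜ[ℂ] c) = leftLegs H.can₂ y := by rw [leftLegs_assoc, hw]; rfl
  calc a ⊗ₜ[ℂ] LinearMap.mul' ℂ A (H.can₁.symm (b ⊗ₜ c))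
      = (LinearMap.mul' ℂ A).lTensor A ((H.can₁.lTensor A).symm (a ⊗ₜ (b ⊗ₜ c))) := rfl
    _ = (LinearMap.mul' ℂ A).rTensor A ((TensorProduct.assoc ℂ A A A).symm y) := by
        rw [hy, lTensor_can₁_symm_leftLegs_can₂, lTensor_mul'_leftLegs_can₂,
          LinearEquiv.apply_symm_apply]
    _ = LinearMap.mul' ℂ A w ⊗ₜ[ℂ] c := by rw [LinearEquiv.symm_apply_apply]; rfl
    _ = LinearMap.mul' ℂ A (H.can₂.symm (a ⊗ₜ b)) ⊗ₜ[ℂ] c := by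
        rw [← hw, LinearEquiv.symm_apply_apply]

theorem exists_counit : ∃ ε : A →ₗ[ℂ] ℂ,
    LinearMap.mul' ℂ A ∘ₗ H.can₁.symm.toLinearMap = sliceLeft ε ∧
      LinearMap.mul' ℂ A ∘ₗ H.can₂.symm.toLinearMap = sliceRight ε :=
  exists_eq_slice_of_tmul_eq H.tmul_mul'_can₁_symm

/-- The counit `ε`, characterised by `(ε ⊗ ι)(Δ(a)(1 ⊗ b)) = ab = (ι ⊗ ε)((a ⊗ 1)Δ(b))`. -/
def counit : A →ₗ[ℂ] ℂ := H.exists_counit.choose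

theorem sliceLeft_counit_can₁ (w : A ⊗[ℂ] A) :
    sliceLeft H.counit (H.can₁ w) = LinearMap.mul' ℂ A w := by
  rw [counit, ← H.exists_counit.choose_spec.1]
  simp

theorem sliceRight_counit_can₂ (w : A ⊗[ℂ] A) :
    sliceRight H.counit (H.can₂ w) = LinearMap.mul' ℂ A w := by
  rw [counit, ← H.exists_counit.choose_spec.2]
  simp

theorem counit_ne_zero [Nontrivial A] : H.counit ≠ 0 := fun hε => by
  obtain ⟨a, ha⟩ := exists_ne (0 : A)
  refine ha (NondegenerateMul.eq_zero_of_mul_right a fun b => ?_)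
  simpa [hε, sliceLeft] using (H.sliceLeft_counit_can₁ (a ⊗ₜ b)).symm

include H in
theorem mul'_surjective : Function.Surjective (LinearMap.mul' ℂ A) := by
  obtain hA | hA := subsingleton_or_nontrivial A
  · exact fun a => ⟨0, Subsingleton.elim _ _⟩
  refine fun a => (((sliceRight_surjective H.counit_ne_zero).comp H.can₂.surjective) a).imp
    fun w hw => ?_
  rw [← H.sliceRight_counit_can₂]
  exact hw

theorem sliceLeft_counit_lmul_comul (a : A) (w : A ⊗[ℂ] A) :
    sliceLeft H.counit ((H.comul a).lmul w) = a * sliceLeft H.counit w := by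
  obtain ⟨w, rfl⟩ := H.can₁.surjective w
  rw [lmul_comul_can₁, sliceLeft_counit_can₁, sliceLeft_counit_can₁, mul'_mulL₁]

theorem sliceLeft_counit_mulR₁ (x : A) (w : A ⊗[ℂ] A) :
    sliceLeft H.counit (mulR₁ x w) = H.counit x • sliceLeft H.counit w := by
  obtain ⟨w, rfl⟩ := H.can₁.surjective w
  refine LinearMap.congr_fun (f := sliceLeft H.counit ∘ₗ mulR₁ x ∘ₗ H.can₁.toLinearMap)
    (g := H.counit x • sliceLeft H.counit ∘ₗ H.can₁.toLinearMap)
    (TensorProduct.ext' fun a b => ?_) w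
  simp [mulR₁_can₁, sliceLeft_counit_lmul_comul, sliceLeft_counit_can₁, mul_smul_comm]

theorem counit_mul (a b : A) : H.counit (a * b) = H.counit a * H.counit b := by
  obtain hA | hA := subsingleton_or_nontrivial A
  · simp [Subsingleton.elim a 0]
  obtain ⟨c, hc⟩ := exists_ne (0 : A)
  refine smul_left_injective ℂ hc ?_
  simpa [smul_smul, mul_comm] using H.sliceLeft_counit_mulR₁ b (a ⊗ₜ c)

theorem sliceLeft_counit_mulL₁ (x : A) (w : A ⊗[ℂ] A) :
    sliceLeft H.counit (mulL₁ x w) = H.counit x • sliceLeft H.counit w :=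
  LinearMap.congr_fun (f := sliceLeft H.counit ∘ₗ mulL₁ x)
    (g := H.counit x • sliceLeft H.counit)
    (TensorProduct.ext' (by simp [counit_mul, mul_smul])) w

theorem tensorFunctional_counit_can₁ (w : A ⊗[ℂ] A) :
    tensorFunctional H.counit H.counit (H.can₁ w) = tensorFunctional H.counit H.counit w := by
  have slice (v : A ⊗[ℂ] A) :
      tensorFunctional H.counit H.counit v = H.counit (sliceLeft H.counit v) :=
    LinearMap.congr_fun (g := H.counit ∘ₗ sliceLeft H.counit) (TensorProduct.ext' (by simp)) v
  have mul (v : A ⊗[ℂ] A) :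
      tensorFunctional H.counit H.counit v = H.counit (LinearMap.mul' ℂ A v) :=
    LinearMap.congr_fun (g := H.counit ∘ₗ LinearMap.mul' ℂ A)
      (TensorProduct.ext' (by simp [counit_mul])) v
  rw [slice, sliceLeft_counit_can₁, mul]

theorem mulR₂_can₂_symm (z a b : A) :
    mulR₂ b (H.can₂.symm (z ⊗ₜ a)) =
      (sliceRight H.counit ∘ₗ H.can₂.symm.toLinearMap ∘ₗ TensorProduct.mk ℂ A A z).rTensor A
        (H.can₁ (a ⊗ₜ b)) := by
  have comm : (leftLegs H.can₂).symm (z ⊗ₜ H.can₁ (a ⊗ₜ b)) =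
      H.can₁.lTensor A ((leftLegs H.can₂).symm (z ⊗ₜ (a ⊗ₜ b))) := by
    rw [LinearEquiv.symm_apply_eq, ← lTensor_can₁_leftLegs_can₂, LinearEquiv.apply_symm_apply]
    rfl
  have slice (w : A ⊗[ℂ] A) :
      (sliceLeft H.counit).lTensor A ((leftLegs H.can₂).symm (z ⊗ₜ w)) =
        (sliceRight H.counit ∘ₗ H.can₂.symm.toLinearMap ∘ₗ TensorProduct.mk ℂ A A z).rTensor A
          w :=
    LinearMap.congr_fun
      (f := (sliceLeft H.counit).lTensor A ∘ₗ (leftLegs H.can₂).symm.toLinearMap ∘ₗ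
        TensorProduct.mk ℂ A (A ⊗[ℂ] A) z)
      (TensorProduct.ext' fun p q => lTensor_sliceLeft_assoc _ (H.can₂.symm (z ⊗ₜ p)) q) w
  calc mulR₂ b (H.can₂.symm (z ⊗ₜ a))
      = (LinearMap.mul' ℂ A).lTensor A ((leftLegs H.can₂).symm (z ⊗ₜ (a ⊗ₜ b))) :=
        (lTensor_mul'_assoc _ b).symm
    _ = (sliceLeft H.counit).lTensor A
          (H.can₁.lTensor A ((leftLegs H.can₂).symm (z ⊗ₜ (a ⊗ₜ b)))) := by
        rw [← LinearMap.ext (f := sliceLeft H.counit ∘ₗ H.can₁.toLinearMap)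
          H.sliceLeft_counit_can₁, LinearMap.lTensor_comp_apply]
        rfl
    _ = _ := by rw [← comm, slice]

theorem lact_comul_leftComm (x : A ⊗[ℂ] (A ⊗[ℂ] A)) :
    IsNondegenerateHom.lact H.comul (TensorProduct.leftComm ℂ A A A x) =
      (LinearMap.mul' ℂ A).lTensor A (leftLegs H.can₃ x) := by
  refine LinearMap.congr_fun
    (f := IsNondegenerateHom.lact H.comul ∘ₗ (TensorProduct.leftComm ℂ A A A).toLinearMap)
    (g := (LinearMap.mul' ℂ A).lTensor A ∘ₗ (leftLegs H.can₃).toLinearMap)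
    (TensorProduct.ext_threefold' fun a c a' => ?_) x
  change (H.comul c).lmul (a ⊗ₜ a') = (LinearMap.mul' ℂ A).lTensor A (leftLegs H.can₃ _)
  rw [leftLegs_tmul, lTensor_mul'_assoc, mulR₂_can₃]

theorem ract_comul_leftComm (x : A ⊗[ℂ] (A ⊗[ℂ] A)) :
    IsNondegenerateHom.ract H.comul (TensorProduct.leftComm ℂ A A A x) =
      (LinearMap.mul' ℂ A).rTensor A ((TensorProduct.assoc ℂ A A A).symm
        (H.can₄.toLinearMap.lTensor A x)) := by
  refine LinearMap.congr_fun
    (f := IsNondegenerateHom.ract H.comul ∘ₗ (TensorProduct.leftComm ℂ A A A).toLinearMap)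
    (g := (LinearMap.mul' ℂ A).rTensor A ∘ₗ (TensorProduct.assoc ℂ A A A).symm.toLinearMap ∘ₗ
      H.can₄.toLinearMap.lTensor A)
    (TensorProduct.ext_threefold' fun a c a' => ?_) x
  change (H.comul c).rmul (a ⊗ₜ a') = (LinearMap.mul' ℂ A).rTensor A
    ((TensorProduct.assoc ℂ A A A).symm (a ⊗ₜ H.can₄ (c ⊗ₜ a')))
  rw [rTensor_mul'_assoc_symm, mulL₁_can₄]

theorem isNondegenerateHom_comul : IsNondegenerateHom H.comul := by
  refine .of_surjective (fun y => ?_) (fun y => ?_)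
  · obtain ⟨x, rfl⟩ := ((LinearMap.lTensor_surjective A H.mul'_surjective).comp
      (leftLegs H.can₃).surjective) y
    exact ⟨_, H.lact_comul_leftComm x⟩
  · obtain ⟨x, rfl⟩ := ((LinearMap.rTensor_surjective A H.mul'_surjective).comp
      ((TensorProduct.assoc ℂ A A A).symm.surjective.comp
        (LinearMap.lTensor_surjective A H.can₄.surjective))) y
    exact ⟨_, H.ract_comul_leftComm x⟩

/-- The map `w ⊗ (g ⊗ h) ↦ Δ(g)w ⊗ h`. -/
def comulAct : (A ⊗[ℂ] A) ⊗[ℂ] (A ⊗[ℂ] A) →ₗ[ℂ] A ⊗[ℂ] (A ⊗[ℂ] A) :=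
  (TensorProduct.assoc ℂ A A A).toLinearMap ∘ₗ
    (IsNondegenerateHom.lact H.comul ∘ₗ
      (TensorProduct.comm ℂ (A ⊗[ℂ] A) A).toLinearMap).rTensor A ∘ₗ
    (TensorProduct.assoc ℂ (A ⊗[ℂ] A) A A).symm.toLinearMap

theorem comulAct_tmul (w : A ⊗[ℂ] A) (g h : A) : H.comulAct (w ⊗ₜ (g ⊗ₜ h)) =
    TensorProduct.assoc ℂ A A A ((H.comul g).lmul w ⊗ₜ h) := rfl

theorem leftLegs_can₃_tmul_mulR₁ (q s : A) (u : A ⊗[ℂ] A) :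
    leftLegs H.can₃ (q ⊗ₜ mulR₁ s u) = H.comulAct (H.can₃ (q ⊗ₜ s) ⊗ₜ u) :=
  LinearMap.congr_fun
    (f := (leftLegs H.can₃).toLinearMap ∘ₗ TensorProduct.mk ℂ A (A ⊗[ℂ] A) q ∘ₗ mulR₁ s)
    (g := H.comulAct ∘ₗ TensorProduct.mk ℂ (A ⊗[ℂ] A) (A ⊗[ℂ] A) (H.can₃ (q ⊗ₜ s)))
    (TensorProduct.ext' fun g h => by
      simp [comulAct_tmul, lmul_comul_can₃]) u

theorem lTensor_mulR₁_leftLegs_can₃ (x y : A) (u : A ⊗[ℂ] A) :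
    (mulR₁ y).lTensor A (leftLegs H.can₃ (x ⊗ₜ u)) = H.comulAct ((x ⊗ₜ y) ⊗ₜ u) := by
  have lTensor_mulR₁_assoc (v : A ⊗[ℂ] A) (h : A) :
      (mulR₁ y).lTensor A (TensorProduct.assoc ℂ A A A (v ⊗ₜ h)) =
        TensorProduct.assoc ℂ A A A (mulR₂ y v ⊗ₜ h) :=
    LinearMap.congr_fun
      (f := (mulR₁ y).lTensor A ∘ₗ (TensorProduct.assoc ℂ A A A).toLinearMap ∘ₗ
        (TensorProduct.mk ℂ (A ⊗[ℂ] A) A).flip h)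
      (g := (TensorProduct.assoc ℂ A A A).toLinearMap ∘ₗ
        (TensorProduct.mk ℂ (A ⊗[ℂ] A) A).flip h ∘ₗ mulR₂ y)
      (TensorProduct.ext' fun _ _ => by simp) v
  refine LinearMap.congr_fun
    (f := (mulR₁ y).lTensor A ∘ₗ (leftLegs H.can₃).toLinearMap ∘ₗ TensorProduct.mk ℂ A (A ⊗[ℂ] A) x)
    (g := H.comulAct ∘ₗ TensorProduct.mk ℂ (A ⊗[ℂ] A) (A ⊗[ℂ] A) (x ⊗ₜ y))
    (TensorProduct.ext' fun g h => ?_) u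
  change (mulR₁ y).lTensor A (leftLegs H.can₃ (x ⊗ₜ (g ⊗ₜ h))) =
    H.comulAct ((x ⊗ₜ y) ⊗ₜ (g ⊗ₜ h))
  rw [leftLegs_tmul, lTensor_mulR₁_assoc, mulR₂_can₃, comulAct_tmul]

theorem lTensor_mulL₂_lTensor_can₃ (w : A ⊗[ℂ] A) (y z : A) :
    (mulL₂ z).lTensor A (H.can₃.lTensor A ((TensorProduct.comm ℂ A A).lTensor A
        (TensorProduct.assoc ℂ A A A (w ⊗ₜ y)))) =
      (mulR₁ y).lTensor A (H.can₄.lTensor A (TensorProduct.assoc ℂ A A A (w ⊗ₜ z))) :=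
  LinearMap.congr_fun
    (f := (mulL₂ z).lTensor A ∘ₗ (H.can₃.lTensor A).toLinearMap ∘ₗ
      ((TensorProduct.comm ℂ A A).lTensor A).toLinearMap ∘ₗ
        (TensorProduct.assoc ℂ A A A).toLinearMap ∘ₗ (TensorProduct.mk ℂ (A ⊗[ℂ] A) A).flip y)
    (g := (mulR₁ y).lTensor A ∘ₗ (H.can₄.lTensor A).toLinearMap ∘ₗ
      (TensorProduct.assoc ℂ A A A).toLinearMap ∘ₗ (TensorProduct.mk ℂ (A ⊗[ℂ] A) A).flip z)
    (TensorProduct.ext' fun _ _ => by simp [mulL₂_can₃]) w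

theorem lTensor_mulL₂_lTensor_can₃_outerLegs (w : A ⊗[ℂ] A) (r z : A) :
    (mulL₂ z).lTensor A (H.can₃.lTensor A (outerLegs H.can₃
        (TensorProduct.assoc ℂ A A A (w ⊗ₜ r)))) = H.comulAct (w ⊗ₜ H.can₄ (r ⊗ₜ z)) := by
  refine LinearMap.congr_fun
    (f := (mulL₂ z).lTensor A ∘ₗ (H.can₃.lTensor A).toLinearMap ∘ₗ
      (outerLegs H.can₃).toLinearMap ∘ₗ (TensorProduct.assoc ℂ A A A).toLinearMap ∘ₗ
        (TensorProduct.mk ℂ (A ⊗[ℂ] A) A).flip r)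
    (g := H.comulAct ∘ₗ (TensorProduct.mk ℂ (A ⊗[ℂ] A) (A ⊗[ℂ] A)).flip (H.can₄ (r ⊗ₜ z)))
    (TensorProduct.ext' fun x y => ?_) w
  calc (mulL₂ z).lTensor A (H.can₃.lTensor A (outerLegs H.can₃ (x ⊗ₜ (y ⊗ₜ r))))
      = (mulR₁ y).lTensor A (H.can₄.lTensor A (leftLegs H.can₃ (x ⊗ₜ (r ⊗ₜ z)))) := by
        rw [outerLegs_tmul, lTensor_mulL₂_lTensor_can₃, leftLegs_tmul]
    _ = (mulR₁ y).lTensor A (leftLegs H.can₃ (x ⊗ₜ H.can₄ (r ⊗ₜ z))) := by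
        rw [lTensor_can₄_leftLegs_can₃, LinearEquiv.lTensor_tmul]
    _ = H.comulAct ((x ⊗ₜ y) ⊗ₜ H.can₄ (r ⊗ₜ z)) := H.lTensor_mulR₁_leftLegs_can₃ x y _

theorem pentagon_can₃ (x : A ⊗[ℂ] (A ⊗[ℂ] A)) :
    H.can₃.lTensor A (outerLegs H.can₃ (leftLegs H.can₃ x)) =
      leftLegs H.can₃ (H.can₃.lTensor A x) := by
  refine sub_eq_zero.1 (lTensor_separating (fun z : A => mulL₂ z)
    (lTensor_separating (fun z : A => LinearMap.mulLeft ℂ z)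
      NondegenerateMul.eq_zero_of_mul_left) _ fun z => ?_)
  rw [map_sub, sub_eq_zero, lTensor_mulL₂_leftLegs]
  refine LinearMap.congr_fun
    (f := (mulL₂ z).lTensor A ∘ₗ (H.can₃.lTensor A).toLinearMap ∘ₗ
      (outerLegs H.can₃).toLinearMap ∘ₗ (leftLegs H.can₃).toLinearMap)
    (g := (leftLegs H.can₃).toLinearMap ∘ₗ (mulL₂ z).lTensor A ∘ₗ (H.can₃.lTensor A).toLinearMap)
    (TensorProduct.ext_threefold' fun q s r => ?_) x
  calc (mulL₂ z).lTensor A (H.can₃.lTensor A (outerLegs H.can₃ (leftLegs H.can₃ (q ⊗ₜ (s ⊗ₜ r)))))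
      = H.comulAct (H.can₃ (q ⊗ₜ s) ⊗ₜ H.can₄ (r ⊗ₜ z)) := by
        rw [leftLegs_tmul, lTensor_mulL₂_lTensor_can₃_outerLegs]
    _ = leftLegs H.can₃ (q ⊗ₜ mulL₂ z (H.can₃ (s ⊗ₜ r))) := by
        rw [mulL₂_can₃, leftLegs_can₃_tmul_mulR₁]

end RegularMultiplierHopfAlgebra

namespace AlgebraicQuantumGroup

variable {A : Type*} [NonUnitalRing A] [Module ℂ A] [IsScalarTower ℂ A A] [SMulCommClass ℂ A A]
  [NondegenerateMul A] (Q : AlgebraicQuantumGroup A)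

include Q in
theorem nontrivial : Nontrivial A := by
  obtain ⟨a, ha⟩ := DFunLike.ne_iff.1 Q.integral_ne_zero
  exact ⟨a, 0, fun h => ha (by simp [h])⟩

theorem sliceRight_integral_can₃ (w : A ⊗[ℂ] A) :
    sliceRight Q.integral (Q.can₃ w) = sliceRight Q.integral w :=
  LinearMap.congr_fun (f := sliceRight Q.integral ∘ₗ Q.can₃.toLinearMap)
    (TensorProduct.ext' fun a b => by
      simpa using Q.left_invariant b a _ (Q.incl_can₃ a b)) w

theorem sliceRight_integral_can₂ (w : A ⊗[ℂ] A) :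
    sliceRight Q.integral (Q.can₂ w) = sliceRight Q.integral w :=
  LinearMap.congr_fun (f := sliceRight Q.integral ∘ₗ Q.can₂.toLinearMap)
    (TensorProduct.ext' fun a b => by
      simpa using Q.left_invariant' b a _ (Q.incl_can₂ a b)) w

theorem mul_sliceRight_integral_can₄ (z : A) (w : A ⊗[ℂ] A) :
    z * sliceRight Q.integral (Q.can₄ (TensorProduct.comm ℂ A A w)) =
      sliceRight Q.counit (Q.can₂.symm (z ⊗ₜ sliceRight Q.integral (Q.can₁ w))) := by
  refine LinearMap.congr_fun
    (f := LinearMap.mulLeft ℂ z ∘ₗ sliceRight Q.integral ∘ₗ Q.can₄.toLinearMap ∘ₗ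
      (TensorProduct.comm ℂ A A).toLinearMap)
    (g := sliceRight Q.counit ∘ₗ Q.can₂.symm.toLinearMap ∘ₗ TensorProduct.mk ℂ A A z ∘ₗ
      sliceRight Q.integral ∘ₗ Q.can₁.toLinearMap)
    (TensorProduct.ext' fun a b => ?_) w
  calc z * sliceRight Q.integral (Q.can₄ (b ⊗ₜ a))
      = sliceRight Q.integral ((Q.comul b).rmul (z ⊗ₜ a)) := by
        rw [← sliceRight_mulL₁, Q.mulL₁_can₄]
    _ = sliceRight Q.integral (Q.can₂ (mulR₂ b (Q.can₂.symm (z ⊗ₜ a)))) := by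
        rw [← Q.rmul_comul_can₂, LinearEquiv.apply_symm_apply]
    _ = _ := by rw [sliceRight_integral_can₂, Q.mulR₂_can₂_symm, sliceRight_rTensor]; rfl

theorem exists_antipode : ∃ S : A →ₗ[ℂ] A, ∀ z a,
    z * S a = sliceRight Q.counit (Q.can₂.symm (z ⊗ₜ a)) := by
  obtain ⟨g, hg⟩ := (sliceRight Q.integral ∘ₗ Q.can₁.toLinearMap).exists_rightInverse_of_surjective
    (LinearMap.range_eq_top.2
      ((sliceRight_surjective Q.integral_ne_zero).comp Q.can₁.surjective))
  refine ⟨sliceRight Q.integral ∘ₗ Q.can₄.toLinearMap ∘ₗ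
    (TensorProduct.comm ℂ A A).toLinearMap ∘ₗ g, fun z a => ?_⟩
  refine (Q.mul_sliceRight_integral_can₄ z (g a)).trans ?_
  exact congrArg (fun b => sliceRight Q.counit (Q.can₂.symm (z ⊗ₜ b))) (LinearMap.congr_fun hg a)

/-- The antipode `S`, characterised by `z S(a) = (ι ⊗ ε)(T⁻¹(z ⊗ a))` for the bijection
`T : z ⊗ a ↦ (z ⊗ 1)Δ(a)`. -/
def antipode : A →ₗ[ℂ] A := Q.exists_antipode.choose

theorem mul_antipode (z a : A) :
    z * Q.antipode a = sliceRight Q.counit (Q.can₂.symm (z ⊗ₜ a)) :=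
  Q.exists_antipode.choose_spec z a

theorem antipode_sliceRight (w : A ⊗[ℂ] A) :
    Q.antipode (sliceRight Q.integral (Q.can₁ w)) =
      sliceRight Q.integral (Q.can₄ (TensorProduct.comm ℂ A A w)) :=
  eq_of_mul_left fun z => by rw [mul_antipode, mul_sliceRight_integral_can₄]

theorem antipode_surjective : Function.Surjective Q.antipode := fun a => by
  obtain ⟨w, rfl⟩ := ((sliceRight_surjective Q.integral_ne_zero).comp
    ((TensorProduct.comm ℂ A A ≪≫ₗ Q.can₄).surjective)) a
  exact ⟨_, Q.antipode_sliceRight w⟩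

theorem mulR₂_can₂_symm_antipode (z a b : A) :
    mulR₂ b (Q.can₂.symm (z ⊗ₜ a)) =
      (LinearMap.mulLeft ℂ z ∘ₗ Q.antipode).rTensor A (Q.can₁ (a ⊗ₜ b)) := by
  rw [Q.mulR₂_can₂_symm]
  congr 2
  exact LinearMap.ext fun c => (Q.mul_antipode z c).symm

theorem mul'_rTensor_antipode_can₁ (w : A ⊗[ℂ] A) :
    LinearMap.mul' ℂ A (Q.antipode.rTensor A (Q.can₁ w)) = sliceLeft Q.counit w := by
  refine LinearMap.congr_fun
    (f := LinearMap.mul' ℂ A ∘ₗ Q.antipode.rTensor A ∘ₗ Q.can₁.toLinearMap)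
    (TensorProduct.ext' fun a b => eq_of_mul_left fun z => ?_) w
  calc z * LinearMap.mul' ℂ A (Q.antipode.rTensor A (Q.can₁ (a ⊗ₜ b)))
      = LinearMap.mul' ℂ A (mulR₂ b (Q.can₂.symm (z ⊗ₜ a))) := by
        rw [mulR₂_can₂_symm_antipode, LinearMap.rTensor_comp_apply]
        exact (mul'_mulL₁ z _).symm
    _ = z * sliceLeft Q.counit (a ⊗ₜ b) := by
        rw [mul'_mulR₂, ← Q.sliceRight_counit_can₂, LinearEquiv.apply_symm_apply]
        simp [mul_smul_comm, smul_mul_assoc]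

theorem antipode_mul (a b : A) :
    Q.antipode a * b = sliceLeft Q.counit (Q.can₁.symm (a ⊗ₜ b)) := by
  rw [← mul'_rTensor_antipode_can₁, LinearEquiv.apply_symm_apply]
  simp

theorem counit_antipode (a : A) : Q.counit (Q.antipode a) = Q.counit a := by
  have := Q.nontrivial
  obtain ⟨b, hb⟩ := DFunLike.ne_iff.1 Q.counit_ne_zero
  refine mul_right_cancel₀ hb ?_
  have slice (v : A ⊗[ℂ] A) :
      Q.counit (sliceLeft Q.counit v) = tensorFunctional Q.counit Q.counit v :=
    LinearMap.congr_fun (f := Q.counit ∘ₗ sliceLeft Q.counit) (TensorProduct.ext' (by simp)) v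
  rw [← Q.counit_mul, antipode_mul, slice, ← Q.tensorFunctional_counit_can₁,
    LinearEquiv.apply_symm_apply, tensorFunctional_tmul]

theorem sliceLeft_counit_can₁_symm_mulR₁ (y : A) (w : A ⊗[ℂ] A) :
    sliceLeft Q.counit (Q.can₁.symm (mulR₁ y w)) =
      Q.antipode y * sliceLeft Q.counit (Q.can₁.symm w) := by
  obtain ⟨v, rfl⟩ := Q.can₁.surjective w
  rw [LinearEquiv.symm_apply_apply]
  refine LinearMap.congr_fun
    (f := sliceLeft Q.counit ∘ₗ Q.can₁.symm.toLinearMap ∘ₗ mulR₁ y ∘ₗ Q.can₁.toLinearMap)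
    (g := LinearMap.mulLeft ℂ (Q.antipode y) ∘ₗ sliceLeft Q.counit)
    (TensorProduct.ext' fun p q => ?_) v
  obtain ⟨u, hu⟩ := Q.can₁.surjective (y ⊗ₜ q)
  calc sliceLeft Q.counit (Q.can₁.symm (mulR₁ y (Q.can₁ (p ⊗ₜ q))))
      = sliceLeft Q.counit (mulL₁ p u) := by
        rw [Q.mulR₁_can₁, ← hu, Q.lmul_comul_can₁, LinearEquiv.symm_apply_apply]
    _ = Q.counit p • (Q.antipode y * q) := by
        rw [Q.sliceLeft_counit_mulL₁, antipode_mul, ← hu, LinearEquiv.symm_apply_apply]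
    _ = Q.antipode y * sliceLeft Q.counit (p ⊗ₜ q) := by simp [mul_smul_comm]

theorem antipode_mul_rev (x y : A) :
    Q.antipode (x * y) = Q.antipode y * Q.antipode x :=
  eq_of_mul fun b => by
    rw [mul_assoc, antipode_mul, antipode_mul Q x, ← sliceLeft_counit_can₁_symm_mulR₁, mulR₁_tmul]

/-- The bilinear map `(c, a) ↦ (ι ⊗ φ)(Δ(a)(1 ⊗ c))`, the convolution of `a` with `φ(· c)`. -/
def convolve : A →ₗ[ℂ] A →ₗ[ℂ] A :=
  (TensorProduct.mk ℂ A A).flip.compr₂ (sliceRight Q.integral ∘ₗ Q.can₁.toLinearMap)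

theorem convolve_apply (c a : A) :
    Q.convolve c a = sliceRight Q.integral (Q.can₁ (a ⊗ₜ c)) := rfl

theorem antipode_convolve (c a : A) :
    Q.antipode (Q.convolve c a) = sliceRight Q.integral (Q.can₄ (c ⊗ₜ a)) :=
  Q.antipode_sliceRight (a ⊗ₜ c)

theorem can₂_convolve (z c a : A) :
    Q.can₂ (z ⊗ₜ Q.convolve c a) = (Q.convolve c).lTensor A (Q.can₂ (z ⊗ₜ a)) :=
  apply_tmul_sliceRight_of_leftLegs_comm Q.lTensor_can₁_leftLegs_can₂ Q.integral z a c

theorem can₃_antipode_convolve (z c a : A) :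
    Q.can₃ (z ⊗ₜ Q.antipode (Q.convolve c a)) =
      (Q.antipode ∘ₗ Q.convolve.flip a).lTensor A (Q.can₃ (z ⊗ₜ c)) := by
  have hS : Q.antipode ∘ₗ Q.convolve.flip a =
      sliceRight Q.integral ∘ₗ Q.can₄.toLinearMap ∘ₗ (TensorProduct.mk ℂ A A).flip a :=
    LinearMap.ext fun c => Q.antipode_convolve c a
  rw [antipode_convolve, hS]
  exact apply_tmul_sliceRight_of_leftLegs_comm Q.lTensor_can₄_leftLegs_can₃ Q.integral z c a

/-- The bilinear map `(w, a) ↦ (ι ⊗ φ)(Δ(a) w)`. -/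
def sliceComulMul : A ⊗[ℂ] A →ₗ[ℂ] A →ₗ[ℂ] A :=
  LinearMap.mk₂ ℂ (fun w a => sliceRight Q.integral ((Q.comul a).lmul w)) (by simp) (by simp)
    (by simp) (by simp)

theorem sliceComulMul_tmul (y c a : A) : Q.sliceComulMul (y ⊗ₜ c) a = Q.convolve c a * y := by
  rw [convolve_apply, ← sliceRight_mulR₁, Q.mulR₁_can₁]
  rfl

theorem sliceComulMul_can₃ (w : A ⊗[ℂ] A) (a : A) :
    Q.sliceComulMul (Q.can₃ w) a = sliceRight Q.integral (mulL₂ a w) := by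
  rw [← sliceRight_integral_can₃, ← Q.lmul_comul_can₃]
  rfl

theorem mulL₁_can₁_comm_convolve (z a : A) (w : A ⊗[ℂ] A) :
    mulL₁ z (Q.can₁ (TensorProduct.comm ℂ A A ((Q.convolve.flip a).lTensor A w))) =
      (Q.sliceComulMul w).lTensor A (Q.can₂ (z ⊗ₜ a)) := by
  refine LinearMap.congr_fun
    (f := mulL₁ z ∘ₗ Q.can₁.toLinearMap ∘ₗ (TensorProduct.comm ℂ A A).toLinearMap ∘ₗ
      (Q.convolve.flip a).lTensor A)
    (g := LinearMap.applyₗ (Q.can₂ (z ⊗ₜ a)) ∘ₗ LinearMap.lTensorHom A ∘ₗ Q.sliceComulMul)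
    (TensorProduct.ext' fun y c => ?_) w
  calc mulL₁ z (Q.can₁ (Q.convolve c a ⊗ₜ y))
      = mulR₂ y ((Q.convolve c).lTensor A (Q.can₂ (z ⊗ₜ a))) := by
        rw [Q.mulL₁_can₁, can₂_convolve]
    _ = (LinearMap.mulRight ℂ y ∘ₗ Q.convolve c).lTensor A (Q.can₂ (z ⊗ₜ a)) :=
        (LinearMap.lTensor_comp_apply ..).symm
    _ = (Q.sliceComulMul (y ⊗ₜ c)).lTensor A (Q.can₂ (z ⊗ₜ a)) := by
        congr 2
        exact LinearMap.ext fun p => (Q.sliceComulMul_tmul y c p).symm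

theorem lTensor_sliceComulMul_can₃ (a b : A) (w : A ⊗[ℂ] A) :
    (Q.sliceComulMul (Q.can₃ (a ⊗ₜ b))).lTensor A w =
      sliceRight Q.integral (mulR₂ b w) ⊗ₜ a :=
  LinearMap.congr_fun
    (g := (TensorProduct.mk ℂ A A).flip a ∘ₗ sliceRight Q.integral ∘ₗ mulR₂ b)
    (TensorProduct.ext' fun p q => by simp [sliceComulMul_can₃]) w

theorem can₁_comm_convolve_can₃ (a : A) (v : A ⊗[ℂ] A) :
    Q.can₁ (TensorProduct.comm ℂ A A ((Q.convolve.flip a).lTensor A (Q.can₃ v))) =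
      TensorProduct.comm ℂ A A ((Q.convolve.flip a).lTensor A v) := by
  refine LinearMap.congr_fun
    (f := Q.can₁.toLinearMap ∘ₗ (TensorProduct.comm ℂ A A).toLinearMap ∘ₗ
      (Q.convolve.flip a).lTensor A ∘ₗ Q.can₃.toLinearMap)
    (g := (TensorProduct.comm ℂ A A).toLinearMap ∘ₗ (Q.convolve.flip a).lTensor A)
    (TensorProduct.ext' fun s r => eq_of_mulL₁_eq fun z => ?_) v
  calc mulL₁ z (Q.can₁ (TensorProduct.comm ℂ A A
        ((Q.convolve.flip a).lTensor A (Q.can₃ (s ⊗ₜ r)))))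
      = sliceRight Q.integral (mulL₁ z (Q.can₁ (a ⊗ₜ r))) ⊗ₜ s := by
        rw [mulL₁_can₁_comm_convolve, lTensor_sliceComulMul_can₃, Q.mulL₁_can₁]
    _ = mulL₁ z (Q.convolve r a ⊗ₜ s) := by rw [sliceRight_mulL₁, mulL₁_tmul, convolve_apply]

theorem convolve_lift_surjective (a : A) : ∃ w, TensorProduct.lift Q.convolve w = a := by
  obtain ⟨w, rfl⟩ := ((sliceRight_surjective Q.integral_ne_zero).comp Q.can₁.surjective) a
  refine ⟨TensorProduct.comm ℂ A A w, LinearMap.congr_fun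
    (f := TensorProduct.lift Q.convolve ∘ₗ (TensorProduct.comm ℂ A A).toLinearMap)
    (g := sliceRight Q.integral ∘ₗ Q.can₁.toLinearMap) (TensorProduct.ext' fun _ _ => rfl) w⟩

/-- The right integral `ψ = φ ∘ S`. -/
def rightIntegral : A →ₗ[ℂ] ℂ := Q.integral ∘ₗ Q.antipode

theorem rightIntegral_ne_zero : Q.rightIntegral ≠ 0 := fun h => Q.integral_ne_zero <|
  LinearMap.ext fun a => by
    obtain ⟨b, rfl⟩ := Q.antipode_surjective a
    exact LinearMap.congr_fun h b

theorem sliceRight_rightIntegral_convolve_can₃ (a : A) (v : A ⊗[ℂ] A) :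
    sliceRight (Q.rightIntegral ∘ₗ Q.convolve.flip a) (Q.can₃ v) =
      sliceRight (Q.rightIntegral ∘ₗ Q.convolve.flip a) v := by
  refine LinearMap.congr_fun
    (f := sliceRight (Q.rightIntegral ∘ₗ Q.convolve.flip a) ∘ₗ Q.can₃.toLinearMap)
    (TensorProduct.ext' fun s r => ?_) v
  calc sliceRight (Q.rightIntegral ∘ₗ Q.convolve.flip a) (Q.can₃ (s ⊗ₜ r))
      = sliceRight Q.integral ((Q.antipode ∘ₗ Q.convolve.flip a).lTensor A (Q.can₃ (s ⊗ₜ r))) := by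
        rw [sliceRight_lTensor]
        rfl
    _ = sliceRight Q.integral (Q.can₃ (s ⊗ₜ Q.antipode (Q.convolve r a))) := by
        rw [can₃_antipode_convolve]
    _ = sliceRight (Q.rightIntegral ∘ₗ Q.convolve.flip a) (s ⊗ₜ r) := by
        rw [sliceRight_integral_can₃]
        simp [rightIntegral]

/-- Every element is a sum of convolutions `φ(a₂ r) a₁`, on which `ψ` is controlled by
`antipode_convolve`. -/
theorem sliceLeft_rightIntegral_can₁ (w : A ⊗[ℂ] A) :
    sliceLeft Q.rightIntegral (Q.can₁ w) = sliceLeft Q.rightIntegral w := by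
  have slice (a : A) (v : A ⊗[ℂ] A) :
      sliceLeft Q.rightIntegral (TensorProduct.comm ℂ A A ((Q.convolve.flip a).lTensor A v)) =
        sliceRight (Q.rightIntegral ∘ₗ Q.convolve.flip a) v :=
    LinearMap.congr_fun
      (f := sliceLeft Q.rightIntegral ∘ₗ (TensorProduct.comm ℂ A A).toLinearMap ∘ₗ
        (Q.convolve.flip a).lTensor A)
      (TensorProduct.ext' fun _ _ => by simp) v
  have invariant (a : A) (v : A ⊗[ℂ] A) :
      sliceLeft Q.rightIntegral
          (Q.can₁ (TensorProduct.comm ℂ A A ((Q.convolve.flip a).lTensor A v))) =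
        sliceLeft Q.rightIntegral
          (TensorProduct.comm ℂ A A ((Q.convolve.flip a).lTensor A v)) := by
    obtain ⟨v, rfl⟩ := Q.can₃.surjective v
    rw [can₁_comm_convolve_can₃, slice, slice, sliceRight_rightIntegral_convolve_can₃]
  refine LinearMap.congr_fun (f := sliceLeft Q.rightIntegral ∘ₗ Q.can₁.toLinearMap)
    (TensorProduct.ext' fun d y => ?_) w
  obtain ⟨u, rfl⟩ := Q.convolve_lift_surjective d
  induction u with
  | zero => simp
  | add s t hs ht => simp only [map_add, TensorProduct.add_tmul, hs, ht]
  | tmul r a => exact invariant a (y ⊗ₜ r)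

theorem sliceLeft_rightIntegral_can₄ (w : A ⊗[ℂ] A) :
    sliceLeft Q.rightIntegral (Q.can₄ w) = sliceLeft Q.rightIntegral w := by
  refine LinearMap.congr_fun (f := sliceLeft Q.rightIntegral ∘ₗ Q.can₄.toLinearMap)
    (TensorProduct.ext' fun a b => eq_of_mul fun x => ?_) w
  calc sliceLeft Q.rightIntegral (Q.can₄ (a ⊗ₜ b)) * x
      = sliceLeft Q.rightIntegral (mulL₂ b (Q.can₁ (a ⊗ₜ x))) := by
        rw [Q.mulL₂_can₁]
        exact (sliceLeft_mulR₂ ..).symm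
    _ = sliceLeft Q.rightIntegral (a ⊗ₜ b) * x := by
        rw [sliceLeft_mulL₂, sliceLeft_rightIntegral_can₁]
        simp [mul_smul_comm, smul_mul_assoc]

theorem rightIntegral_mul_sliceRight (x : A) (w : A ⊗[ℂ] A) :
    Q.rightIntegral (x * sliceRight Q.integral w) =
      tensorFunctional Q.rightIntegral Q.integral ((Q.comul x).lmul (Q.can₁ w)) := by
  rw [tensorFunctional_eq_sliceLeft, Q.lmul_comul_can₁, sliceLeft_rightIntegral_can₁,
    ← tensorFunctional_eq_sliceLeft, tensorFunctional_eq_sliceRight, sliceRight_mulL₁]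

theorem integral_mul_sliceLeft (x : A) (w : A ⊗[ℂ] A) :
    Q.integral (x * sliceLeft Q.rightIntegral w) =
      tensorFunctional Q.rightIntegral Q.integral ((Q.comul x).lmul (Q.can₃ w)) := by
  rw [tensorFunctional_eq_sliceRight, Q.lmul_comul_can₃, sliceRight_integral_can₃,
    ← tensorFunctional_eq_sliceRight, tensorFunctional_eq_sliceLeft, sliceLeft_mulL₂]

theorem rightIntegral_sliceRight_mul (x : A) (w : A ⊗[ℂ] A) :
    Q.rightIntegral (sliceRight Q.integral w * x) =
      tensorFunctional Q.rightIntegral Q.integral ((Q.comul x).rmul (Q.can₄ w)) := by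
  rw [tensorFunctional_eq_sliceLeft, Q.rmul_comul_can₄, sliceLeft_rightIntegral_can₄,
    ← tensorFunctional_eq_sliceLeft, tensorFunctional_eq_sliceRight, sliceRight_mulR₁]

theorem integral_sliceLeft_mul (x : A) (w : A ⊗[ℂ] A) :
    Q.integral (sliceLeft Q.rightIntegral w * x) =
      tensorFunctional Q.rightIntegral Q.integral ((Q.comul x).rmul (Q.can₂ w)) := by
  rw [tensorFunctional_eq_sliceRight, Q.rmul_comul_can₂, sliceRight_integral_can₂,
    ← tensorFunctional_eq_sliceRight, tensorFunctional_eq_sliceLeft, sliceLeft_mulR₂]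

theorem exists_rightIntegral_mul_right_eq (c : A) :
    ∃ d, ∀ x, Q.rightIntegral (x * d) = Q.integral (x * c) := by
  obtain ⟨w, rfl⟩ := sliceLeft_surjective Q.rightIntegral_ne_zero c
  refine ⟨sliceRight Q.integral (Q.can₁.symm (Q.can₃ w)), fun x => ?_⟩
  rw [rightIntegral_mul_sliceRight, integral_mul_sliceLeft, LinearEquiv.apply_symm_apply]

theorem exists_integral_mul_right_eq (c : A) :
    ∃ d, ∀ x, Q.integral (x * d) = Q.rightIntegral (x * c) := by
  obtain ⟨w, rfl⟩ := sliceRight_surjective Q.integral_ne_zero c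
  refine ⟨sliceLeft Q.rightIntegral (Q.can₃.symm (Q.can₁ w)), fun x => ?_⟩
  rw [rightIntegral_mul_sliceRight, integral_mul_sliceLeft, LinearEquiv.apply_symm_apply]

theorem exists_rightIntegral_mul_left_eq (c : A) :
    ∃ d, ∀ x, Q.rightIntegral (d * x) = Q.integral (c * x) := by
  obtain ⟨w, rfl⟩ := sliceLeft_surjective Q.rightIntegral_ne_zero c
  refine ⟨sliceRight Q.integral (Q.can₄.symm (Q.can₂ w)), fun x => ?_⟩
  rw [rightIntegral_sliceRight_mul, integral_sliceLeft_mul, LinearEquiv.apply_symm_apply]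

theorem exists_integral_mul_left_eq (c : A) :
    ∃ d, ∀ x, Q.integral (d * x) = Q.rightIntegral (c * x) := by
  obtain ⟨w, rfl⟩ := sliceRight_surjective Q.integral_ne_zero c
  refine ⟨sliceLeft Q.rightIntegral (Q.can₂.symm (Q.can₄ w)), fun x => ?_⟩
  rw [rightIntegral_sliceRight_mul, integral_sliceLeft_mul, LinearEquiv.apply_symm_apply]

theorem lTensor_toDual_eq_zero {w : A ⊗[ℂ] A}
    (h : ∀ q, sliceRight Q.integral (mulL₂ q w) = 0) : Q.toDual.lTensor A w = 0 :=
  lTensor_eq_zero_of_sliceRight fun q =>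
    (sliceRight_lTensor Q.integral (LinearMap.mulLeft ℂ q) w).symm.trans (h q)

theorem lTensor_toDual_flip_eq_zero {w : A ⊗[ℂ] A}
    (h : ∀ q, sliceRight Q.integral (mulR₂ q w) = 0) : Q.toDual.flip.lTensor A w = 0 :=
  lTensor_eq_zero_of_sliceRight fun q =>
    (sliceRight_lTensor Q.integral (LinearMap.mulRight ℂ q) w).symm.trans (h q)

theorem eq_zero_of_lTensor_can₂ {B : Type*} [AddCommGroup B] [Module ℂ B] {β : A →ₗ[ℂ] B}
    (hβ : LinearMap.ker β ≤ LinearMap.ker Q.counit) {n : A}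
    (hn : ∀ x, β.lTensor A (Q.can₂ (x ⊗ₜ n)) = 0) : n = 0 :=
  NondegenerateMul.eq_zero_of_mul_left n fun x => by
    rw [← LinearMap.mul'_apply (R := ℂ), ← Q.sliceRight_counit_can₂]
    exact sliceRight_eq_zero_of_lTensor (lTensor_eq_zero_of_ker_le hβ (hn x))

theorem mulL₂_can₂_symm_antipode (z a b : A) :
    mulL₂ b (Q.can₂.symm (z ⊗ₜ a)) =
      (LinearMap.mulLeft ℂ z ∘ₗ Q.antipode).rTensor A (Q.can₄ (a ⊗ₜ b)) := by
  refine eq_of_mulR₂_eq fun y => ?_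
  have mulR₂_mulL₂ (w : A ⊗[ℂ] A) : mulR₂ y (mulL₂ b w) = mulL₂ b (mulR₂ y w) :=
    LinearMap.congr_fun (f := mulR₂ y ∘ₗ mulL₂ b) (g := mulL₂ b ∘ₗ mulR₂ y)
      (TensorProduct.ext' fun _ _ => by simp [mul_assoc]) w
  have mulL₂_rTensor (f : A →ₗ[ℂ] A) (w : A ⊗[ℂ] A) :
      mulL₂ b (f.rTensor A w) = f.rTensor A (mulL₂ b w) :=
    LinearMap.congr_fun (f := mulL₂ b ∘ₗ f.rTensor A) (g := f.rTensor A ∘ₗ mulL₂ b)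
      (TensorProduct.ext' fun _ _ => by simp) w
  have mulR₂_rTensor (f : A →ₗ[ℂ] A) (w : A ⊗[ℂ] A) :
      mulR₂ y (f.rTensor A w) = f.rTensor A (mulR₂ y w) :=
    LinearMap.congr_fun (f := mulR₂ y ∘ₗ f.rTensor A) (g := f.rTensor A ∘ₗ mulR₂ y)
      (TensorProduct.ext' fun _ _ => by simp) w
  rw [mulR₂_mulL₂, mulR₂_can₂_symm_antipode, mulL₂_rTensor, Q.mulL₂_can₁, mulR₂_rTensor]

theorem sliceRight_integral_mulL₂_can₂_eq_zero {n : A} (hn : ∀ q, Q.integral (q * n) = 0)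
    (x q : A) : sliceRight Q.integral (mulL₂ q (Q.can₂ (x ⊗ₜ n))) = 0 := by
  obtain ⟨w, hw⟩ := Q.can₂.surjective (x ⊗ₜ q)
  rw [Q.mulL₂_can₂, ← hw, Q.rmul_comul_can₂, sliceRight_integral_can₂]
  exact LinearMap.congr_fun (f := sliceRight Q.integral ∘ₗ mulR₂ n) (g := 0)
    (TensorProduct.ext' fun _ _ => by simp [hn]) w

theorem sliceRight_integral_can₄_eq_zero {n : A} (hn : ∀ q, Q.integral (q * n) = 0) (q : A) :
    sliceRight Q.integral (Q.can₄ (n ⊗ₜ q)) = 0 :=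
  NondegenerateMul.eq_zero_of_mul_left _ fun x => by
    rw [← sliceRight_mulL₁, Q.mulL₁_can₄, ← Q.mulL₂_can₂,
      sliceRight_integral_mulL₂_can₂_eq_zero Q hn]

theorem counit_eq_zero_of_integral_mul_right {n : A} (hn : ∀ q, Q.integral (q * n) = 0) :
    Q.counit n = 0 := by
  obtain ⟨z, hz⟩ := DFunLike.ne_iff.1 Q.integral_ne_zero
  have mem : Q.toDual.lTensor A (Q.can₂.symm (z ⊗ₜ n)) = 0 := Q.lTensor_toDual_eq_zero fun q => by
    rw [mulL₂_can₂_symm_antipode, sliceRight_rTensor, sliceRight_integral_can₄_eq_zero Q hn,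
      map_zero]
  have factor (w : A ⊗[ℂ] A) : Q.integral (LinearMap.mul' ℂ A w) =
      TensorProduct.lift LinearMap.applyₗ (Q.toDual.lTensor A w) :=
    LinearMap.congr_fun (f := Q.integral ∘ₗ LinearMap.mul' ℂ A)
      (g := TensorProduct.lift LinearMap.applyₗ ∘ₗ Q.toDual.lTensor A)
      (TensorProduct.ext' fun _ _ => by simp) w
  have := factor (Q.can₂.symm (z ⊗ₜ n))
  rw [mem, map_zero, ← Q.sliceRight_counit_can₂, LinearEquiv.apply_symm_apply, sliceRight_tmul,
    map_smul, smul_eq_mul] at this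
  exact (mul_eq_zero.1 this).resolve_right hz

theorem eq_zero_of_integral_mul_right {n : A} (hn : ∀ q, Q.integral (q * n) = 0) : n = 0 :=
  Q.eq_zero_of_lTensor_can₂
    (fun _ hm => Q.counit_eq_zero_of_integral_mul_right (LinearMap.congr_fun hm))
    fun x => Q.lTensor_toDual_eq_zero (Q.sliceRight_integral_mulL₂_can₂_eq_zero hn x)

theorem counit_eq_zero_of_integral_mul_left {n : A} (hn : ∀ q, Q.integral (n * q) = 0) :
    Q.counit n = 0 := by
  rw [← counit_antipode, Q.eq_zero_of_integral_mul_right (n := Q.antipode n) fun q => ?_, map_zero]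
  obtain ⟨p, rfl⟩ := Q.antipode_surjective q
  obtain ⟨d, hd⟩ := Q.exists_integral_mul_right_eq p
  calc Q.integral (Q.antipode p * Q.antipode n)
      = Q.rightIntegral (n * p) := by rw [← antipode_mul_rev]; rfl
    _ = 0 := by rw [← hd, hn]

theorem sliceRight_integral_mulR₂_can₂_eq_zero {n : A} (hn : ∀ q, Q.integral (n * q) = 0)
    (x q : A) : sliceRight Q.integral (mulR₂ q (Q.can₂ (x ⊗ₜ n))) = 0 := by
  have convolve_eq_zero : Q.convolve q n = 0 :=
    NondegenerateMul.eq_zero_of_mul_right _ fun y => by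
      obtain ⟨w, hw⟩ := Q.can₃.surjective (y ⊗ₜ q)
      rw [← sliceComulMul_tmul, ← hw, sliceComulMul_can₃]
      exact LinearMap.congr_fun (f := sliceRight Q.integral ∘ₗ mulL₂ n) (g := 0)
        (TensorProduct.ext' fun _ _ => by simp [hn]) w
  rw [← Q.mulL₁_can₁, sliceRight_mulL₁, ← convolve_apply, convolve_eq_zero, mul_zero]

theorem eq_zero_of_integral_mul_left {n : A} (hn : ∀ q, Q.integral (n * q) = 0) : n = 0 :=
  Q.eq_zero_of_lTensor_can₂
    (fun _ hm => Q.counit_eq_zero_of_integral_mul_left (LinearMap.congr_fun hm))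
    fun x => Q.lTensor_toDual_flip_eq_zero (Q.sliceRight_integral_mulR₂_can₂_eq_zero hn x)

theorem antipode_sliceLeft (x r : A) :
    Q.antipode (sliceLeft Q.rightIntegral (Q.can₂ (x ⊗ₜ r))) =
      sliceLeft Q.rightIntegral (Q.can₃ (r ⊗ₜ x)) := by
  refine eq_of_mul fun y => ?_
  have slice_leftLegs (u : A ⊗[ℂ] A) :
      (sliceLeft Q.counit).lTensor A (leftLegs Q.can₂ (x ⊗ₜ u)) = mulL₁ x u :=
    LinearMap.congr_fun
      (f := (sliceLeft Q.counit).lTensor A ∘ₗ (leftLegs Q.can₂).toLinearMap ∘ₗ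
        TensorProduct.mk ℂ A (A ⊗[ℂ] A) x)
      (TensorProduct.ext' fun p q => by
        simp [lTensor_sliceLeft_assoc, Q.sliceRight_counit_can₂]) u
  calc Q.antipode (sliceLeft Q.rightIntegral (Q.can₂ (x ⊗ₜ r))) * y
      = sliceLeft Q.counit (Q.can₁.symm
          (sliceLeft Q.rightIntegral (leftLegs Q.can₂ (x ⊗ₜ (r ⊗ₜ y))))) := by
        rw [antipode_mul, ← sliceLeft_assoc, leftLegs_tmul]
    _ = sliceLeft Q.rightIntegral ((sliceLeft Q.counit).lTensor A
          ((Q.can₁.lTensor A).symm (leftLegs Q.can₂ (x ⊗ₜ (r ⊗ₜ y))))) := by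
        rw [sliceLeft_lTensor]
        exact congrArg _ (sliceLeft_lTensor Q.rightIntegral Q.can₁.symm.toLinearMap _).symm
    _ = sliceLeft Q.rightIntegral (mulL₁ x (Q.can₁.symm (r ⊗ₜ y))) := by
        rw [Q.lTensor_can₁_symm_leftLegs_can₂, ← slice_leftLegs]
        rfl
    _ = sliceLeft Q.rightIntegral (mulR₂ y (Q.can₃ (r ⊗ₜ x))) := by
        rw [← sliceLeft_rightIntegral_can₁, ← Q.lmul_comul_can₁, LinearEquiv.apply_symm_apply,
          Q.mulR₂_can₃]
    _ = sliceLeft Q.rightIntegral (Q.can₃ (r ⊗ₜ x)) * y := sliceLeft_mulR₂ ..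

theorem tensorFunctional_mulL₂_can₃_antipode_left (r a x : A) :
    tensorFunctional Q.rightIntegral Q.integral
        (mulL₂ (Q.antipode a) (Q.can₃ (Q.antipode r ⊗ₜ x))) =
      Q.integral (sliceLeft (Q.rightIntegral ∘ₗ Q.antipode)
        (Q.can₂ (r ⊗ₜ Q.antipode a)) * x) := by
  rw [Q.mulL₂_can₃, tensorFunctional_eq_sliceRight, sliceRight_mulR₁, ← antipode_convolve]
  calc Q.rightIntegral (Q.antipode (Q.convolve x (Q.antipode a)) * Q.antipode r)
      = (Q.rightIntegral ∘ₗ Q.antipode)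
          (sliceRight Q.integral (mulL₁ r (Q.can₁ (Q.antipode a ⊗ₜ x)))) := by
        rw [← antipode_mul_rev, sliceRight_mulL₁]
        rfl
    _ = Q.integral (sliceLeft (Q.rightIntegral ∘ₗ Q.antipode)
          (Q.can₂ (r ⊗ₜ Q.antipode a)) * x) := by
        rw [← tensorFunctional_eq_sliceRight, Q.mulL₁_can₁, tensorFunctional_eq_sliceLeft,
          sliceLeft_mulR₂]

theorem tensorFunctional_mulL₂_can₃_antipode_right (r a x : A) :
    tensorFunctional Q.rightIntegral Q.integral
        (mulL₂ (Q.antipode a) (Q.can₃ (r ⊗ₜ x))) =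
      Q.rightIntegral (x * sliceRight Q.rightIntegral (Q.can₁ (r ⊗ₜ a))) := by
  rw [tensorFunctional_eq_sliceLeft, sliceLeft_mulL₂, ← antipode_sliceLeft, ← antipode_mul_rev]
  calc Q.rightIntegral (sliceLeft Q.rightIntegral (Q.can₂ (x ⊗ₜ r)) * a)
      = tensorFunctional Q.rightIntegral Q.rightIntegral (mulL₁ x (Q.can₁ (r ⊗ₜ a))) := by
        rw [Q.mulL₁_can₁, tensorFunctional_eq_sliceLeft, sliceLeft_mulR₂]
    _ = Q.rightIntegral (x * sliceRight Q.rightIntegral (Q.can₁ (r ⊗ₜ a))) := by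
        rw [tensorFunctional_eq_sliceRight, sliceRight_mulL₁]

theorem integral_mul_eq_rightIntegral_mul (w : A ⊗[ℂ] A) (x : A) :
    Q.integral (sliceLeft (Q.rightIntegral ∘ₗ Q.antipode)
        (Q.can₂ (Q.antipode.lTensor A w)) * x) =
      Q.rightIntegral (x * sliceRight Q.rightIntegral (Q.can₁ (Q.antipode.rTensor A w))) :=
  LinearMap.congr_fun
    (f := Q.integral ∘ₗ LinearMap.mulRight ℂ x ∘ₗ sliceLeft (Q.rightIntegral ∘ₗ Q.antipode) ∘ₗ
      Q.can₂.toLinearMap ∘ₗ Q.antipode.lTensor A)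
    (g := Q.rightIntegral ∘ₗ LinearMap.mulLeft ℂ x ∘ₗ sliceRight Q.rightIntegral ∘ₗ
      Q.can₁.toLinearMap ∘ₗ Q.antipode.rTensor A)
    (TensorProduct.ext' fun r a =>
      (Q.tensorFunctional_mulL₂_can₃_antipode_left r a x).symm.trans
        (Q.tensorFunctional_mulL₂_can₃_antipode_right (Q.antipode r) a x)) w

theorem rightIntegral_comp_antipode_ne_zero : Q.rightIntegral ∘ₗ Q.antipode ≠ 0 := fun h =>
  Q.rightIntegral_ne_zero <| LinearMap.ext fun a => by
    obtain ⟨b, rfl⟩ := Q.antipode_surjective a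
    exact LinearMap.congr_fun h b

theorem exists_integral_mul_right_eq_mul_left (c : A) :
    ∃ d, ∀ x, Q.integral (x * d) = Q.integral (c * x) := by
  obtain ⟨w, rfl⟩ := ((sliceLeft_surjective Q.rightIntegral_comp_antipode_ne_zero).comp
    (Q.can₂.surjective.comp (LinearMap.lTensor_surjective A Q.antipode_surjective))) c
  obtain ⟨d, hd⟩ := Q.exists_integral_mul_right_eq
    (sliceRight Q.rightIntegral (Q.can₁ (Q.antipode.rTensor A w)))
  exact ⟨d, fun x => (hd x).trans (Q.integral_mul_eq_rightIntegral_mul w x).symm⟩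

theorem exists_integral_mul_left_eq_mul_right (c : A) :
    ∃ d, ∀ x, Q.integral (d * x) = Q.integral (x * c) := by
  obtain ⟨e, he⟩ := Q.exists_rightIntegral_mul_right_eq c
  obtain ⟨w, rfl⟩ := ((sliceRight_surjective Q.rightIntegral_ne_zero).comp
    (Q.can₁.surjective.comp (LinearMap.rTensor_surjective A Q.antipode_surjective))) e
  exact ⟨_, fun x => (Q.integral_mul_eq_rightIntegral_mul w x).trans (he x)⟩

theorem pairing_nondegenerate : Q.pairing.Nondegenerate :=
  ⟨fun _ ha => Q.eq_zero_of_integral_mul_left fun c => ha (Q.fourier c),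
    fun _ hb => Dual.ext Q fun a => (hb a).trans (map_zero _).symm⟩

/-- The Fourier transform `c ↦ φ(· c)`, which is bijective because `φ` is faithful. -/
def fourierEquiv : A ≃ₗ[ℂ] Q.Dual :=
  LinearEquiv.ofBijective Q.fourier
    ⟨(injective_iff_map_eq_zero Q.fourier).2 fun c hc =>
      Q.eq_zero_of_integral_mul_right fun a => by rw [← pairing_fourier, hc, map_zero],
      Q.fourier_surjective⟩

@[simp] theorem fourierEquiv_symm_fourier (c : A) : Q.fourierEquiv.symm (Q.fourier c) = c :=
  Q.fourierEquiv.symm_apply_apply c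

theorem exists_modularMap :
    ∃ σ : A →ₗ[ℂ] A, Q.toDual ∘ₗ σ = (LinearMap.mul ℂ A).compr₂ Q.integral :=
  exists_comp_eq_of_range_le <| by
    rintro _ ⟨c, rfl⟩
    exact (Q.exists_integral_mul_right_eq_mul_left c).imp fun d hd => LinearMap.ext hd

/-- The modular automorphism `σ` of `φ`, as a linear map: `φ(x σ(a)) = φ(a x)`. -/
def modularMap : A →ₗ[ℂ] A := Q.exists_modularMap.choose

theorem integral_mul_modularMap (a x : A) :
    Q.integral (x * Q.modularMap a) = Q.integral (a * x) :=
  LinearMap.congr_fun₂ Q.exists_modularMap.choose_spec a x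

theorem pairing_convolve (c a : A) (b : Q.Dual) :
    Q.pairing (Q.convolve c a) b = Q.pairing a (b * Q.fourier c) := by
  obtain ⟨c', rfl⟩ := Q.fourier_surjective b
  rw [pairing_fourier_mul_fourier, ← Q.mulR₁_can₁, tensorFunctional_eq_sliceRight,
    sliceRight_mulR₁, pairing_fourier, convolve_apply]

theorem pairing_sliceLeft_can₃ (c a : A) (b : Q.Dual) :
    Q.pairing (sliceLeft Q.integral (Q.can₃ (c ⊗ₜ a))) b = Q.pairing a (Q.fourier c * b) := by
  obtain ⟨c', rfl⟩ := Q.fourier_surjective b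
  rw [pairing_fourier_mul_fourier, ← Q.mulR₂_can₃, tensorFunctional_eq_sliceLeft,
    sliceLeft_mulR₂, pairing_fourier]

/-- The actions of `Â` on `A`. -/
def dualActing : ActingPairing Q.pairing.flip where
  nondegenerate := ⟨LinearMap.flip_separatingLeft.2 Q.pairing_nondegenerate.2,
    LinearMap.flip_separatingRight.2 Q.pairing_nondegenerate.1⟩
  actL := Q.convolve ∘ₗ Q.fourierEquiv.symm.toLinearMap
  actR := TensorProduct.curry (sliceLeft Q.integral ∘ₗ Q.can₃.toLinearMap) ∘ₗ
    Q.fourierEquiv.symm.toLinearMap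
  pairing_actL b' b a := by
    obtain ⟨c, rfl⟩ := Q.fourier_surjective b
    simpa using Q.pairing_convolve c a b'
  pairing_actR b' b a := by
    obtain ⟨c, rfl⟩ := Q.fourier_surjective b
    simpa using Q.pairing_sliceLeft_can₃ c a b'

/-- The actions of `A` on `Â`. -/
def acting : ActingPairing Q.pairing where
  nondegenerate := Q.pairing_nondegenerate
  actL := (LinearMap.mul ℂ A).compr₂ Q.fourier |>.compl₂ Q.fourierEquiv.symm.toLinearMap
  actR := ((LinearMap.mul ℂ A).flip.compr₂ Q.fourier).compl₁₂ Q.modularMap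
    Q.fourierEquiv.symm.toLinearMap
  pairing_actL a' a b := by
    obtain ⟨c, rfl⟩ := Q.fourier_surjective b
    simp [mul_assoc]
  pairing_actR a' a b := by
    obtain ⟨c, rfl⟩ := Q.fourier_surjective b
    simp [← mul_assoc, integral_mul_modularMap]

@[simp] theorem dualActing_actL_fourier (c a : A) :
    Q.dualActing.actL (Q.fourier c) a = Q.convolve c a := by
  simp [dualActing]

@[simp] theorem dualActing_actR_fourier (c a : A) :
    Q.dualActing.actR (Q.fourier c) a = sliceLeft Q.integral (Q.can₃ (c ⊗ₜ a)) := by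
  simp [dualActing]

theorem dualActing_actR_mul (b : Q.Dual) (a x : A) : Q.dualActing.actR b a * x =
    sliceLeft (Q.pairing.flip b) (Q.can₁ (a ⊗ₜ x)) := by
  obtain ⟨c, rfl⟩ := Q.fourier_surjective b
  rw [dualActing_actR_fourier, ← sliceLeft_mulR₂, Q.mulR₂_can₃, ← Q.mulR₁_can₁]
  exact sliceLeft_rTensor Q.integral (LinearMap.mulRight ℂ c) _

theorem mul_dualActing_actR (b : Q.Dual) (a x : A) : x * Q.dualActing.actR b a =
    sliceLeft (Q.pairing.flip b) (Q.can₄ (a ⊗ₜ x)) := by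
  obtain ⟨c, rfl⟩ := Q.fourier_surjective b
  rw [dualActing_actR_fourier, ← sliceLeft_mulL₂, Q.mulL₂_can₃]
  exact sliceLeft_rTensor Q.integral (LinearMap.mulRight ℂ c) _

/-- The element `ψ(· c)` of `Â`. -/
def rightFourier : A →ₗ[ℂ] Q.Dual :=
  ((LinearMap.mul ℂ A).flip.compr₂ Q.rightIntegral).codRestrict (LinearMap.range Q.toDual)
    fun c => (Q.exists_integral_mul_right_eq c).imp fun _ hd => LinearMap.ext hd

/-- The element `ψ(c ·)` of `Â`. -/
def rightFourierOp : A →ₗ[ℂ] Q.Dual :=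
  ((LinearMap.mul ℂ A).compr₂ Q.rightIntegral).codRestrict (LinearMap.range Q.toDual) fun c => by
    obtain ⟨d, hd⟩ := Q.exists_integral_mul_left_eq c
    exact (Q.exists_integral_mul_right_eq_mul_left d).imp
      fun d' hd' => LinearMap.ext fun x => (hd' x).trans (hd x)

@[simp] theorem pairing_rightFourier (a c : A) :
    Q.pairing a (Q.rightFourier c) = Q.rightIntegral (a * c) := rfl

@[simp] theorem pairing_rightFourierOp (a c : A) :
    Q.pairing a (Q.rightFourierOp c) = Q.rightIntegral (c * a) := rfl

theorem rightFourier_surjective : Function.Surjective Q.rightFourier := by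
  intro b
  obtain ⟨c, rfl⟩ := Q.fourier_surjective b
  obtain ⟨d, hd⟩ := Q.exists_rightIntegral_mul_right_eq c
  exact ⟨d, Dual.ext Q fun a => by rw [pairing_rightFourier, hd, pairing_fourier]⟩

theorem rightFourierOp_surjective : Function.Surjective Q.rightFourierOp := by
  intro b
  obtain ⟨c, rfl⟩ := Q.fourier_surjective b
  obtain ⟨d, hd⟩ := Q.exists_integral_mul_left_eq_mul_right c
  obtain ⟨d', hd'⟩ := Q.exists_rightIntegral_mul_left_eq d
  exact ⟨d', Dual.ext Q fun a => by rw [pairing_rightFourierOp, hd', hd, pairing_fourier]⟩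

/-- The map `p ⊗ q ↦ φ(· q) ⊗ p`. -/
def fourierFlip : A ⊗[ℂ] A →ₗ[ℂ] Q.Dual ⊗[ℂ] A :=
  Q.fourier.rTensor A ∘ₗ (TensorProduct.comm ℂ A A).toLinearMap

@[simp] theorem fourierFlip_tmul (p q : A) : Q.fourierFlip (p ⊗ₜ q) = Q.fourier q ⊗ₜ p := rfl

theorem fourierFlip_surjective : Function.Surjective Q.fourierFlip :=
  (LinearMap.rTensor_surjective A Q.fourier_surjective).comp
    (TensorProduct.comm ℂ A A).surjective

theorem tensorPairing_fourierFlip (a : A) (b : Q.Dual) (v : A ⊗[ℂ] A) :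
    tensorPairing Q.pairing.flip Q.pairing (Q.fourierFlip v) (a ⊗ₜ b) =
      Q.pairing (sliceRight Q.integral (mulL₂ a v)) b :=
  LinearMap.congr_fun
    (f := (tensorPairing Q.pairing.flip Q.pairing).flip (a ⊗ₜ b) ∘ₗ Q.fourierFlip)
    (g := Q.pairing.flip b ∘ₗ sliceRight Q.integral ∘ₗ mulL₂ a)
    (TensorProduct.ext' fun _ _ => by simp) v

theorem tensorPairing_rTensor_rightFourierOp (a : A) (b : Q.Dual) (v : A ⊗[ℂ] A) :
    tensorPairing Q.pairing.flip Q.pairing (Q.rightFourierOp.rTensor A v) (a ⊗ₜ b) =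
      Q.pairing (sliceLeft Q.rightIntegral (mulR₁ a v)) b :=
  LinearMap.congr_fun
    (f := (tensorPairing Q.pairing.flip Q.pairing).flip (a ⊗ₜ b) ∘ₗ Q.rightFourierOp.rTensor A)
    (g := Q.pairing.flip b ∘ₗ sliceLeft Q.rightIntegral ∘ₗ mulR₁ a)
    (TensorProduct.ext' fun _ _ => by simp) v

theorem lift_pairing_actL_fourierFlip (w : A ⊗[ℂ] A) (a : A) (b : Q.Dual) :
    TensorProduct.lift Q.pairing
        ((Q.dualActing.tensor Q.acting).actL (Q.fourierFlip w) (a ⊗ₜ b)) =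
      Q.pairing (Q.sliceComulMul w a) b :=
  LinearMap.congr_fun
    (f := TensorProduct.lift Q.pairing ∘ₗ
      (Q.dualActing.tensor Q.acting).actL.flip (a ⊗ₜ b) ∘ₗ Q.fourierFlip)
    (g := Q.pairing.flip b ∘ₗ Q.sliceComulMul.flip a) (TensorProduct.ext' fun p q => by
      simp [sliceComulMul_tmul, ActingPairing.pairing_actL]) w

theorem lift_pairing_actL_can₃ (v : A ⊗[ℂ] A) (y : A ⊗[ℂ] Q.Dual) :
    TensorProduct.lift Q.pairing
        ((Q.dualActing.tensor Q.acting).actL (Q.fourierFlip (Q.can₃ v)) y) =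
      tensorPairing Q.pairing.flip Q.pairing (Q.fourierFlip v) y :=
  LinearMap.congr_fun
    (f := TensorProduct.lift Q.pairing ∘ₗ
      (Q.dualActing.tensor Q.acting).actL (Q.fourierFlip (Q.can₃ v)))
    (TensorProduct.ext' fun a b => by
      rw [LinearMap.comp_apply, lift_pairing_actL_fourierFlip, sliceComulMul_can₃,
        tensorPairing_fourierFlip]) y

theorem lift_pairing_actR_rTensor_rightFourierOp (w : A ⊗[ℂ] A) (a : A) (b : Q.Dual) :
    TensorProduct.lift Q.pairing
        ((Q.dualActing.tensor Q.acting).actR (Q.rightFourierOp.rTensor A w) (a ⊗ₜ b)) =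
      Q.pairing (sliceLeft Q.rightIntegral ((Q.comul a).rmul w)) b :=
  LinearMap.congr_fun
    (f := TensorProduct.lift Q.pairing ∘ₗ
      (Q.dualActing.tensor Q.acting).actR.flip (a ⊗ₜ b) ∘ₗ Q.rightFourierOp.rTensor A)
    (g := Q.pairing.flip b ∘ₗ sliceLeft Q.rightIntegral ∘ₗ (Q.comul a).rmul)
    (TensorProduct.ext' fun p q => by
      simp only [LinearMap.comp_apply, LinearMap.flip_apply, LinearMap.rTensor_tmul,
        ActingPairing.tensor_actR_tmul, TensorProduct.lift.tmul, ActingPairing.pairing_actR,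
        mul_dualActing_actR, ← Q.mulL₁_can₄]
      exact congrArg (Q.pairing · b)
        (sliceLeft_rTensor Q.rightIntegral (LinearMap.mulLeft ℂ p) _).symm) w

theorem lift_pairing_actR_can₄ (v : A ⊗[ℂ] A) (y : A ⊗[ℂ] Q.Dual) :
    TensorProduct.lift Q.pairing
        ((Q.dualActing.tensor Q.acting).actR (Q.rightFourierOp.rTensor A (Q.can₄ v)) y) =
      tensorPairing Q.pairing.flip Q.pairing (Q.rightFourierOp.rTensor A v) y :=
  LinearMap.congr_fun
    (f := TensorProduct.lift Q.pairing ∘ₗ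
      (Q.dualActing.tensor Q.acting).actR (Q.rightFourierOp.rTensor A (Q.can₄ v)))
    (TensorProduct.ext' fun a b => by
      rw [LinearMap.comp_apply, lift_pairing_actR_rTensor_rightFourierOp, Q.rmul_comul_can₄,
        sliceLeft_rightIntegral_can₄, tensorPairing_rTensor_rightFourierOp]) y

theorem existsUnique_duality : ∃! V : Mult (Q.Dual ⊗[ℂ] A), Q.IsDuality V := by
  refine (Q.dualActing.tensor Q.acting).existsUnique_isExtendedPairing ?_ ?_
  · rintro _ ⟨t, rfl⟩
    obtain ⟨v, rfl⟩ := (Q.fourierFlip_surjective.comp Q.can₃.surjective) t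
    exact ⟨Q.fourierFlip v, LinearMap.ext fun y => (Q.lift_pairing_actL_can₃ v y).symm⟩
  · rintro _ ⟨t, rfl⟩
    obtain ⟨v, rfl⟩ := ((LinearMap.rTensor_surjective A Q.rightFourierOp_surjective).comp
      Q.can₄.surjective) t
    exact ⟨Q.rightFourierOp.rTensor A v,
      LinearMap.ext fun y => (Q.lift_pairing_actR_can₄ v y).symm⟩

variable {Q} in
theorem IsDuality.lmul_fourierFlip_can₃ {V : Mult (Q.Dual ⊗[ℂ] A)} (hV : Q.IsDuality V)
    (v : A ⊗[ℂ] A) : V.lmul (Q.fourierFlip (Q.can₃ v)) = Q.fourierFlip v :=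
  (Q.dualActing.tensor Q.acting).eq_left fun y => by
    rw [((Q.dualActing.tensor Q.acting).isExtendedPairing_iff.1 hV).1, lift_pairing_actL_can₃]

theorem tensorPairing_mulR₁_fourier (b₁ : Q.Dual) (a a' : A) (v : A ⊗[ℂ] A) :
    tensorPairing Q.pairing.flip Q.pairing.flip
        (mulR₁ b₁ (TensorProduct.map Q.fourier Q.fourier v)) (a ⊗ₜ a') =
      Q.integral (Q.dualActing.actL b₁ a * sliceRight Q.integral (mulL₂ a' v)) :=
  LinearMap.congr_fun
    (f := (tensorPairing Q.pairing.flip Q.pairing.flip).flip (a ⊗ₜ a') ∘ₗ mulR₁ b₁ ∘ₗ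
      TensorProduct.map Q.fourier Q.fourier)
    (g := Q.integral ∘ₗ LinearMap.mulLeft ℂ (Q.dualActing.actL b₁ a) ∘ₗ
      sliceRight Q.integral ∘ₗ mulL₂ a')
    (TensorProduct.ext' fun p q => by
      simp [← Q.dualActing.pairing_actL, mul_comm]) v

theorem tensorPairing_mulL₁_rightFourier (b₁ : Q.Dual) (a a' : A) (v : A ⊗[ℂ] A) :
    tensorPairing Q.pairing.flip Q.pairing.flip
        (mulL₁ b₁ (TensorProduct.map Q.rightFourier Q.rightFourier
          (TensorProduct.comm ℂ A A v))) (a ⊗ₜ a') =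
      Q.rightIntegral (Q.dualActing.actR b₁ a * sliceLeft Q.rightIntegral (mulL₁ a' v)) :=
  LinearMap.congr_fun
    (f := (tensorPairing Q.pairing.flip Q.pairing.flip).flip (a ⊗ₜ a') ∘ₗ mulL₁ b₁ ∘ₗ
      TensorProduct.map Q.rightFourier Q.rightFourier ∘ₗ (TensorProduct.comm ℂ A A).toLinearMap)
    (g := Q.rightIntegral ∘ₗ LinearMap.mulLeft ℂ (Q.dualActing.actR b₁ a) ∘ₗ
      sliceLeft Q.rightIntegral ∘ₗ mulL₁ a')
    (TensorProduct.ext' fun p q => by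
      simp [← Q.dualActing.pairing_actR, mul_comm]) v

theorem convolve_mul {c c₂ : A} {v : A ⊗[ℂ] A} (hv : Q.can₃ v = c ⊗ₜ c₂) (a : A) :
    Q.convolve c₂ a * c = sliceRight Q.integral (mulL₂ a v) := by
  rw [← sliceComulMul_tmul, ← hv, sliceComulMul_can₃]

theorem dualActing_actR_rightFourier_mul {c c₂ : A} {v : A ⊗[ℂ] A} (hv : Q.can₁ v = c₂ ⊗ₜ c)
    (a : A) : Q.dualActing.actR (Q.rightFourier c₂) a * c =
      sliceLeft Q.rightIntegral (mulL₁ a v) := by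
  rw [dualActing_actR_mul, ← sliceLeft_rightIntegral_can₁, ← Q.lmul_comul_can₁, hv,
    ← Q.mulR₁_can₁]
  exact (sliceLeft_rTensor Q.rightIntegral (LinearMap.mulRight ℂ c₂) _).symm

theorem tensorPairing_mulR₁_fourier_of_can₃ {c c₂ : A} {v : A ⊗[ℂ] A}
    (hv : Q.can₃ v = c ⊗ₜ c₂) (b₁ : Q.Dual) (y : A ⊗[ℂ] A) :
    tensorPairing Q.pairing.flip Q.pairing.flip
        (mulR₁ b₁ (TensorProduct.map Q.fourier Q.fourier v)) y =
      Q.pairing (LinearMap.mul' ℂ A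
        ((Q.dualActing.tensor Q.dualActing).actL (b₁ ⊗ₜ Q.fourier c₂) y)) (Q.fourier c) :=
  LinearMap.congr_fun
    (g := Q.pairing.flip (Q.fourier c) ∘ₗ LinearMap.mul' ℂ A ∘ₗ
      (Q.dualActing.tensor Q.dualActing).actL (b₁ ⊗ₜ Q.fourier c₂))
    (TensorProduct.ext' fun a a' => by
      rw [tensorPairing_mulR₁_fourier, ← Q.convolve_mul hv]
      simp [mul_assoc]) y

theorem tensorPairing_mulL₁_rightFourier_of_can₁ {c c₂ : A} {v : A ⊗[ℂ] A}
    (hv : Q.can₁ v = c₂ ⊗ₜ c) (b₁ : Q.Dual) (y : A ⊗[ℂ] A) :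
    tensorPairing Q.pairing.flip Q.pairing.flip
        (mulL₁ b₁ (TensorProduct.map Q.rightFourier Q.rightFourier
          (TensorProduct.comm ℂ A A v))) y =
      Q.pairing (LinearMap.mul' ℂ A ((Q.dualActing.tensor Q.dualActing).actR
        (b₁ ⊗ₜ Q.rightFourier c₂) y)) (Q.rightFourier c) :=
  LinearMap.congr_fun
    (g := Q.pairing.flip (Q.rightFourier c) ∘ₗ LinearMap.mul' ℂ A ∘ₗ
      (Q.dualActing.tensor Q.dualActing).actR (b₁ ⊗ₜ Q.rightFourier c₂))
    (TensorProduct.ext' fun a a' => by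
      rw [tensorPairing_mulL₁_rightFourier, ← Q.dualActing_actR_rightFourier_mul hv]
      simp [mul_assoc]) y

theorem existsUnique_isExtendedPairing_mul' (b : Q.Dual) : ∃! m : Mult (Q.Dual ⊗[ℂ] Q.Dual),
    IsExtendedPairing (tensorPairing Q.pairing.flip Q.pairing.flip) m
      (Q.pairing.flip b ∘ₗ LinearMap.mul' ℂ A) := by
  refine (Q.dualActing.tensor Q.dualActing).existsUnique_isExtendedPairing
    (range_le_range_of_tmul fun b₁ b₂ => ?_) (range_le_range_of_tmul fun b₁ b₂ => ?_)
  · obtain ⟨c, rfl⟩ := Q.fourier_surjective b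
    obtain ⟨c₂, rfl⟩ := Q.fourier_surjective b₂
    obtain ⟨v, hv⟩ := Q.can₃.surjective (c ⊗ₜ c₂)
    exact ⟨_, LinearMap.ext (Q.tensorPairing_mulR₁_fourier_of_can₃ hv b₁)⟩
  · obtain ⟨c, rfl⟩ := Q.rightFourier_surjective b
    obtain ⟨c₂, rfl⟩ := Q.rightFourier_surjective b₂
    obtain ⟨v, hv⟩ := Q.can₁.surjective (c₂ ⊗ₜ c)
    exact ⟨_, LinearMap.ext (Q.tensorPairing_mulL₁_rightFourier_of_can₁ hv b₁)⟩

theorem lmul_tmul_fourier {m : Mult (Q.Dual ⊗[ℂ] Q.Dual)} {c c₂ : A} {v : A ⊗[ℂ] A}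
    (hm : IsExtendedPairing (tensorPairing Q.pairing.flip Q.pairing.flip) m
      (Q.pairing.flip (Q.fourier c) ∘ₗ LinearMap.mul' ℂ A)) (hv : Q.can₃ v = c ⊗ₜ c₂)
    (b₁ : Q.Dual) :
    m.lmul (b₁ ⊗ₜ Q.fourier c₂) = mulR₁ b₁ (TensorProduct.map Q.fourier Q.fourier v) := by
  refine (Q.dualActing.tensor Q.dualActing).eq_left fun y => ?_
  rw [((Q.dualActing.tensor Q.dualActing).isExtendedPairing_iff.1 hm).1,
    Q.tensorPairing_mulR₁_fourier_of_can₃ hv]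
  rfl

theorem rmul_tmul_rightFourier {m : Mult (Q.Dual ⊗[ℂ] Q.Dual)} {c c₂ : A} {v : A ⊗[ℂ] A}
    (hm : IsExtendedPairing (tensorPairing Q.pairing.flip Q.pairing.flip) m
      (Q.pairing.flip (Q.rightFourier c) ∘ₗ LinearMap.mul' ℂ A)) (hv : Q.can₁ v = c₂ ⊗ₜ c)
    (b₁ : Q.Dual) : m.rmul (b₁ ⊗ₜ Q.rightFourier c₂) =
      mulL₁ b₁ (TensorProduct.map Q.rightFourier Q.rightFourier (TensorProduct.comm ℂ A A v)) := by
  refine (Q.dualActing.tensor Q.dualActing).eq_left fun y => ?_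
  rw [((Q.dualActing.tensor Q.dualActing).isExtendedPairing_iff.1 hm).2,
    Q.tensorPairing_mulL₁_rightFourier_of_can₁ hv]
  rfl

theorem convolve_mul_convolve {c c₂ : A} {v : A ⊗[ℂ] A} (hv : Q.can₃ v = c ⊗ₜ c₂) (a a' : A) :
    Q.convolve c (a * Q.convolve c₂ a') =
      LinearMap.mul' ℂ A (TensorProduct.map (Q.convolve.flip a) (Q.convolve.flip a') v) := by
  have can₁_eq : Q.can₁ (Q.convolve c₂ a' ⊗ₜ c) =
      TensorProduct.comm ℂ A A ((Q.convolve.flip a').lTensor A v) := by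
    rw [← can₁_comm_convolve_can₃, hv, LinearMap.lTensor_tmul, TensorProduct.comm_tmul]
    rfl
  rw [convolve_apply, ← mulL₁_tmul, ← Q.lmul_comul_can₁, can₁_eq]
  exact LinearMap.congr_fun
    (f := sliceRight Q.integral ∘ₗ (Q.comul a).lmul ∘ₗ (TensorProduct.comm ℂ A A).toLinearMap ∘ₗ
      (Q.convolve.flip a').lTensor A)
    (g := LinearMap.mul' ℂ A ∘ₗ TensorProduct.map (Q.convolve.flip a) (Q.convolve.flip a'))
    (TensorProduct.ext' fun p q => Q.sliceComulMul_tmul _ p a) v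

theorem mul'_map_convolve (b₁ : Q.Dual) (a a' : A) (v : A ⊗[ℂ] A) :
    LinearMap.mul' ℂ A ((Q.dualActing.tensor Q.dualActing).actL
        (mulR₁ b₁ (TensorProduct.map Q.fourier Q.fourier v)) (a ⊗ₜ a')) =
      LinearMap.mul' ℂ A (TensorProduct.map (Q.convolve.flip (Q.dualActing.actL b₁ a))
        (Q.convolve.flip a') v) :=
  LinearMap.congr_fun
    (f := LinearMap.mul' ℂ A ∘ₗ (Q.dualActing.tensor Q.dualActing).actL.flip (a ⊗ₜ a') ∘ₗ
      mulR₁ b₁ ∘ₗ TensorProduct.map Q.fourier Q.fourier)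
    (g := LinearMap.mul' ℂ A ∘ₗ
      TensorProduct.map (Q.convolve.flip (Q.dualActing.actL b₁ a)) (Q.convolve.flip a'))
    (TensorProduct.ext' fun p q => by simp [ActingPairing.actL_mul]) v

/-- `A` is a module algebra over `Â`. -/
theorem mul'_actL_lmul {m : Mult (Q.Dual ⊗[ℂ] Q.Dual)} {b : Q.Dual}
    (hm : IsExtendedPairing (tensorPairing Q.pairing.flip Q.pairing.flip) m
      (Q.pairing.flip b ∘ₗ LinearMap.mul' ℂ A)) (x : Q.Dual ⊗[ℂ] Q.Dual) (y : A ⊗[ℂ] A) :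
    LinearMap.mul' ℂ A ((Q.dualActing.tensor Q.dualActing).actL (m.lmul x) y) =
      Q.dualActing.actL b (LinearMap.mul' ℂ A
        ((Q.dualActing.tensor Q.dualActing).actL x y)) := by
  refine LinearMap.congr_fun₂
    (f := ((Q.dualActing.tensor Q.dualActing).actL ∘ₗ m.lmul).compr₂ (LinearMap.mul' ℂ A))
    (g := (Q.dualActing.tensor Q.dualActing).actL.compr₂
      (Q.dualActing.actL b ∘ₗ LinearMap.mul' ℂ A))
    (TensorProduct.ext' fun b₁ b₂ => TensorProduct.ext' fun a a' => ?_) x y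
  obtain ⟨c, rfl⟩ := Q.fourier_surjective b
  obtain ⟨c₂, rfl⟩ := Q.fourier_surjective b₂
  obtain ⟨v, hv⟩ := Q.can₃.surjective (c ⊗ₜ c₂)
  calc LinearMap.mul' ℂ A ((Q.dualActing.tensor Q.dualActing).actL
        (m.lmul (b₁ ⊗ₜ Q.fourier c₂)) (a ⊗ₜ a'))
      = Q.convolve c (Q.dualActing.actL b₁ a * Q.convolve c₂ a') := by
        rw [Q.lmul_tmul_fourier hm hv, mul'_map_convolve, Q.convolve_mul_convolve hv]
    _ = _ := by simp

theorem existsUnique_dualComul :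
    ∃! Δ : Q.Dual →ₙₐ[ℂ] Mult (Q.Dual ⊗[ℂ] Q.Dual), Q.IsDualComul Δ := by
  let T := Q.dualActing.tensor Q.dualActing
  choose D hD using fun b => (Q.existsUnique_isExtendedPairing_mul' b).exists
  have pairing_lmul := fun b => (T.isExtendedPairing_iff.1 (hD b)).1
  let Δ : Q.Dual →ₙₐ[ℂ] Mult (Q.Dual ⊗[ℂ] Q.Dual) :=
    { toFun := D
      map_smul' r b := T.eq_of_isExtendedPairing (hD _) fun x y => by
        simp [pairing_lmul]
      map_zero' := T.eq_of_isExtendedPairing (hD 0) fun x y => by simp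
      map_add' b b' := T.eq_of_isExtendedPairing (hD _) fun x y => by
        simp [pairing_lmul]
      map_mul' b b' := T.eq_of_isExtendedPairing (hD _) fun x y => by
        rw [Mult.lmul_mul, LinearMap.comp_apply, pairing_lmul, LinearMap.comp_apply,
          Q.mul'_actL_lmul (hD b'), ActingPairing.pairing_actL] }
  exact ⟨Δ, hD, fun Δ' h => NonUnitalAlgHom.ext fun b =>
    (Q.existsUnique_isExtendedPairing_mul' b).unique (h b) (hD b)⟩

theorem pairing_mul'_map_fourier (a : A) (w : A ⊗[ℂ] A) :
    Q.pairing a (LinearMap.mul' ℂ Q.Dual (TensorProduct.map Q.fourier Q.fourier w)) =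
      tensorFunctional Q.integral Q.integral ((Q.comul a).lmul w) :=
  LinearMap.congr_fun
    (f := Q.pairing a ∘ₗ LinearMap.mul' ℂ Q.Dual ∘ₗ TensorProduct.map Q.fourier Q.fourier)
    (g := tensorFunctional Q.integral Q.integral ∘ₗ (Q.comul a).lmul)
    (TensorProduct.ext' fun p q => Q.pairing_fourier_mul_fourier a p q) w

theorem mul'_map_fourier_can₃ (v : A ⊗[ℂ] A) :
    LinearMap.mul' ℂ Q.Dual (TensorProduct.map Q.fourier Q.fourier (Q.can₃ v)) =
      Q.fourier (sliceLeft Q.integral v) :=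
  Dual.ext Q fun a => by
    rw [pairing_mul'_map_fourier, Q.lmul_comul_can₃, tensorFunctional_eq_sliceRight,
      sliceRight_integral_can₃, ← tensorFunctional_eq_sliceRight, tensorFunctional_eq_sliceLeft,
      sliceLeft_mulL₂, pairing_fourier]

theorem mul'_dual_surjective : Function.Surjective (LinearMap.mul' ℂ Q.Dual) :=
  fun b => by
    obtain ⟨v, rfl⟩ := (Q.fourier_surjective.comp (sliceLeft_surjective Q.integral_ne_zero)) b
    exact ⟨_, Q.mul'_map_fourier_can₃ v⟩

theorem isNondegenerateHom_idTensorComul : IsNondegenerateHom Q.idTensorComul :=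
  (IsNondegenerateHom.of_incl Q.mul'_dual_surjective).tensorHom Q.isNondegenerateHom_comul

section IsDualCoproduct

variable {Q} {Δ : Q.Dual →ₙₐ[ℂ] Mult (Q.Dual ⊗[ℂ] Q.Dual)}

theorem IsDualComul.lact_leftComm (hΔ : Q.IsDualComul Δ) (x : Q.Dual ⊗[ℂ] (A ⊗[ℂ] A)) :
    IsNondegenerateHom.lact Δ (TensorProduct.leftComm ℂ _ _ _
        ((TensorProduct.map Q.fourier Q.fourier).lTensor Q.Dual x)) =
      (LinearMap.mul' ℂ Q.Dual ∘ₗ (TensorProduct.comm ℂ _ _).toLinearMap).rTensor Q.Dual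
        ((TensorProduct.assoc ℂ _ _ _).symm
          ((TensorProduct.map Q.fourier Q.fourier ∘ₗ
            Q.can₃.symm.toLinearMap).lTensor Q.Dual x)) := by
  refine LinearMap.congr_fun
    (f := IsNondegenerateHom.lact Δ ∘ₗ (TensorProduct.leftComm ℂ _ _ _).toLinearMap ∘ₗ
      (TensorProduct.map Q.fourier Q.fourier).lTensor Q.Dual)
    (g := (LinearMap.mul' ℂ Q.Dual ∘ₗ (TensorProduct.comm ℂ _ _).toLinearMap).rTensor Q.Dual ∘ₗ
      (TensorProduct.assoc ℂ _ _ _).symm.toLinearMap ∘ₗ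
      (TensorProduct.map Q.fourier Q.fourier ∘ₗ Q.can₃.symm.toLinearMap).lTensor Q.Dual)
    (TensorProduct.ext_threefold' fun b₁ c c₂ => ?_) x
  exact (Q.lmul_tmul_fourier (hΔ _) (LinearEquiv.apply_symm_apply _ _) b₁).trans
    (rTensor_mul'_comm_assoc_symm b₁ _).symm

theorem IsDualComul.ract_leftComm (hΔ : Q.IsDualComul Δ) (x : Q.Dual ⊗[ℂ] (A ⊗[ℂ] A)) :
    IsNondegenerateHom.ract Δ (TensorProduct.leftComm ℂ _ _ _
        ((TensorProduct.map Q.rightFourier Q.rightFourier ∘ₗ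
          (TensorProduct.comm ℂ A A).toLinearMap).lTensor Q.Dual x)) =
      (LinearMap.mul' ℂ Q.Dual).rTensor Q.Dual ((TensorProduct.assoc ℂ _ _ _).symm
        ((TensorProduct.map Q.rightFourier Q.rightFourier ∘ₗ
          (TensorProduct.comm ℂ A A).toLinearMap ∘ₗ
            Q.can₁.symm.toLinearMap).lTensor Q.Dual x)) := by
  refine LinearMap.congr_fun
    (f := IsNondegenerateHom.ract Δ ∘ₗ (TensorProduct.leftComm ℂ _ _ _).toLinearMap ∘ₗ
      (TensorProduct.map Q.rightFourier Q.rightFourier ∘ₗ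
        (TensorProduct.comm ℂ A A).toLinearMap).lTensor Q.Dual)
    (g := (LinearMap.mul' ℂ Q.Dual).rTensor Q.Dual ∘ₗ
      (TensorProduct.assoc ℂ _ _ _).symm.toLinearMap ∘ₗ
      (TensorProduct.map Q.rightFourier Q.rightFourier ∘ₗ
        (TensorProduct.comm ℂ A A).toLinearMap ∘ₗ Q.can₁.symm.toLinearMap).lTensor Q.Dual)
    (TensorProduct.ext_threefold' fun b₁ c₂ c => ?_) x
  exact (Q.rmul_tmul_rightFourier (hΔ _) (LinearEquiv.apply_symm_apply _ _) b₁).trans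
    (rTensor_mul'_assoc_symm b₁ _).symm

theorem IsDualComul.isNondegenerateHom (hΔ : Q.IsDualComul Δ) : IsNondegenerateHom Δ := by
  refine .of_surjective (fun y => ?_) (fun y => ?_)
  · have hmul : Function.Surjective
        (LinearMap.mul' ℂ Q.Dual ∘ₗ (TensorProduct.comm ℂ Q.Dual Q.Dual).toLinearMap) :=
      Q.mul'_dual_surjective.comp (TensorProduct.comm ℂ _ _).surjective
    have hmap : Function.Surjective
        (TensorProduct.map Q.fourier Q.fourier ∘ₗ Q.can₃.symm.toLinearMap) :=
      (TensorProduct.map_surjective Q.fourier_surjective Q.fourier_surjective).comp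
        Q.can₃.symm.surjective
    obtain ⟨x, rfl⟩ := ((LinearMap.rTensor_surjective Q.Dual hmul).comp
      ((TensorProduct.assoc ℂ _ _ _).symm.surjective.comp
        (LinearMap.lTensor_surjective Q.Dual hmap))) y
    exact ⟨_, hΔ.lact_leftComm x⟩
  · have hmap : Function.Surjective (TensorProduct.map Q.rightFourier Q.rightFourier ∘ₗ
        (TensorProduct.comm ℂ A A).toLinearMap ∘ₗ Q.can₁.symm.toLinearMap) :=
      (TensorProduct.map_surjective Q.rightFourier_surjective Q.rightFourier_surjective).comp
        ((TensorProduct.comm ℂ A A).surjective.comp Q.can₁.symm.surjective)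
    obtain ⟨x, rfl⟩ := ((LinearMap.rTensor_surjective Q.Dual Q.mul'_dual_surjective).comp
      ((TensorProduct.assoc ℂ _ _ _).symm.surjective.comp
        (LinearMap.lTensor_surjective Q.Dual hmap))) y
    exact ⟨_, hΔ.ract_leftComm x⟩

theorem IsDualComul.isNondegenerateHom_comulTensorId (hΔ : Q.IsDualComul Δ) :
    IsNondegenerateHom (Q.comulTensorId Δ) :=
  (hΔ.isNondegenerateHom.tensorHom (.of_incl Q.mul'_surjective)).multAssoc_comp

end IsDualCoproduct

theorem lmul_idTensorComul (b b₁ : Q.Dual) (a a₁ a₂ : A) :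
    (Q.idTensorComul (b ⊗ₜ a)).lmul (b₁ ⊗ₜ (a₁ ⊗ₜ a₂)) =
      (b * b₁) ⊗ₜ mulR₂ a₂ (Q.can₃ (a₁ ⊗ₜ a)) := by
  rw [Q.mulR₂_can₃]; rfl

theorem lmul_comulTensorId (Δ : Q.Dual →ₙₐ[ℂ] Mult (Q.Dual ⊗[ℂ] Q.Dual)) (b b₁ b₂ : Q.Dual)
    (a a' : A) : (Q.comulTensorId Δ (b ⊗ₜ a)).lmul (b₁ ⊗ₜ (b₂ ⊗ₜ a')) =
      TensorProduct.assoc ℂ _ _ _ ((Δ b).lmul (b₁ ⊗ₜ b₂) ⊗ₜ (a * a')) :=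
  lmul_multAssoc (tmul (Δ b) (incl A a)) ((b₁ ⊗ₜ b₂) ⊗ₜ a')

/-- The map `x ⊗ y ⊗ c ↦ φ(· c) ⊗ x ⊗ y`. -/
def fourierLast : A ⊗[ℂ] (A ⊗[ℂ] A) →ₗ[ℂ] Q.Dual ⊗[ℂ] (A ⊗[ℂ] A) :=
  Q.fourier.rTensor (A ⊗[ℂ] A) ∘ₗ (TensorProduct.comm ℂ (A ⊗[ℂ] A) A).toLinearMap ∘ₗ
    (TensorProduct.assoc ℂ A A A).symm.toLinearMap

@[simp] theorem fourierLast_tmul_tmul (x y c : A) :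
    Q.fourierLast (x ⊗ₜ (y ⊗ₜ c)) = Q.fourier c ⊗ₜ (x ⊗ₜ y) := rfl

theorem fourierLast_tmul (x : A) (w : A ⊗[ℂ] A) :
    Q.fourierLast (x ⊗ₜ w) = (TensorProduct.comm ℂ A A).lTensor Q.Dual
      (TensorProduct.assoc ℂ Q.Dual A A (Q.fourierFlip w ⊗ₜ x)) :=
  LinearMap.congr_fun
    (f := Q.fourierLast ∘ₗ TensorProduct.mk ℂ A (A ⊗[ℂ] A) x)
    (g := ((TensorProduct.comm ℂ A A).lTensor Q.Dual).toLinearMap ∘ₗ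
      (TensorProduct.assoc ℂ Q.Dual A A).toLinearMap ∘ₗ
        (TensorProduct.mk ℂ (Q.Dual ⊗[ℂ] A) A).flip x ∘ₗ Q.fourierFlip)
    (TensorProduct.ext' fun _ _ => by simp) w

theorem fourierLast_lTensor_comm_assoc (w : A ⊗[ℂ] A) (y : A) :
    Q.fourierLast ((TensorProduct.comm ℂ A A).lTensor A (TensorProduct.assoc ℂ A A A (w ⊗ₜ y))) =
      TensorProduct.assoc ℂ Q.Dual A A (Q.fourierFlip w ⊗ₜ y) :=
  LinearMap.congr_fun
    (f := Q.fourierLast ∘ₗ ((TensorProduct.comm ℂ A A).lTensor A).toLinearMap ∘ₗ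
      (TensorProduct.assoc ℂ A A A).toLinearMap ∘ₗ (TensorProduct.mk ℂ (A ⊗[ℂ] A) A).flip y)
    (g := (TensorProduct.assoc ℂ Q.Dual A A).toLinearMap ∘ₗ
      (TensorProduct.mk ℂ (Q.Dual ⊗[ℂ] A) A).flip y ∘ₗ Q.fourierFlip)
    (TensorProduct.ext' fun _ _ => by simp) w

/-- The map `x ⊗ y ⊗ z ↦ φ(· y) ⊗ φ(· z) ⊗ x`. -/
def fourierTwo : A ⊗[ℂ] (A ⊗[ℂ] A) →ₗ[ℂ] Q.Dual ⊗[ℂ] (Q.Dual ⊗[ℂ] A) :=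
  (TensorProduct.assoc ℂ Q.Dual Q.Dual A).toLinearMap ∘ₗ
    (TensorProduct.map Q.fourier Q.fourier).rTensor A ∘ₗ
    (TensorProduct.comm ℂ A (A ⊗[ℂ] A)).toLinearMap

@[simp] theorem fourierTwo_tmul_tmul (x y z : A) :
    Q.fourierTwo (x ⊗ₜ (y ⊗ₜ z)) = Q.fourier y ⊗ₜ (Q.fourier z ⊗ₜ x) := rfl

theorem fourierTwo_assoc (w : A ⊗[ℂ] A) (z : A) :
    Q.fourierTwo (TensorProduct.assoc ℂ A A A (w ⊗ₜ z)) =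
      (TensorProduct.comm ℂ A Q.Dual).lTensor Q.Dual
        (TensorProduct.assoc ℂ Q.Dual A Q.Dual (Q.fourierFlip w ⊗ₜ Q.fourier z)) :=
  LinearMap.congr_fun
    (f := Q.fourierTwo ∘ₗ (TensorProduct.assoc ℂ A A A).toLinearMap ∘ₗ
      (TensorProduct.mk ℂ (A ⊗[ℂ] A) A).flip z)
    (g := ((TensorProduct.comm ℂ A Q.Dual).lTensor Q.Dual).toLinearMap ∘ₗ
      (TensorProduct.assoc ℂ Q.Dual A Q.Dual).toLinearMap ∘ₗ
        (TensorProduct.mk ℂ (Q.Dual ⊗[ℂ] A) Q.Dual).flip (Q.fourier z) ∘ₗ Q.fourierFlip)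
    (TensorProduct.ext' fun _ _ => by simp) w

theorem fourierTwo_lTensor_comm_assoc (w : A ⊗[ℂ] A) (y : A) :
    Q.fourierTwo ((TensorProduct.comm ℂ A A).lTensor A (TensorProduct.assoc ℂ A A A (w ⊗ₜ y))) =
      Q.fourier y ⊗ₜ Q.fourierFlip w :=
  LinearMap.congr_fun
    (f := Q.fourierTwo ∘ₗ ((TensorProduct.comm ℂ A A).lTensor A).toLinearMap ∘ₗ
      (TensorProduct.assoc ℂ A A A).toLinearMap ∘ₗ (TensorProduct.mk ℂ (A ⊗[ℂ] A) A).flip y)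
    (g := TensorProduct.mk ℂ Q.Dual (Q.Dual ⊗[ℂ] A) (Q.fourier y) ∘ₗ Q.fourierFlip)
    (TensorProduct.ext' fun _ _ => by simp) w

theorem lmul_idTensorComul_fourierFlip (b₁ : Q.Dual) (a₁ a₂ : A) (w : A ⊗[ℂ] A) :
    (Q.idTensorComul (Q.fourierFlip w)).lmul (b₁ ⊗ₜ (a₁ ⊗ₜ a₂)) =
      (tmul (incl _ b₁) (tmul 1 (incl A a₂))).rmul
        (Q.fourierLast (leftLegs Q.can₃ (a₁ ⊗ₜ w))) := by
  have mul_tmul_mulR₂ (c : A) (v : A ⊗[ℂ] A) : (Q.fourier c * b₁) ⊗ₜ[ℂ] mulR₂ a₂ v =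
      (tmul (incl _ b₁) (tmul 1 (incl A a₂))).rmul
        (Q.fourierLast (TensorProduct.assoc ℂ A A A (v ⊗ₜ c))) :=
    LinearMap.congr_fun
      (f := TensorProduct.mk ℂ Q.Dual (A ⊗[ℂ] A) (Q.fourier c * b₁) ∘ₗ mulR₂ a₂)
      (g := (tmul (incl _ b₁) (tmul 1 (incl A a₂))).rmul ∘ₗ Q.fourierLast ∘ₗ
        (TensorProduct.assoc ℂ A A A).toLinearMap ∘ₗ (TensorProduct.mk ℂ (A ⊗[ℂ] A) A).flip c)
      (TensorProduct.ext' fun _ _ => by simp) v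
  induction w with
  | zero => simp
  | add s t hs ht => simp only [map_add, Mult.lmul_add, TensorProduct.tmul_add, hs, ht]
  | tmul a c => rw [fourierFlip_tmul, lmul_idTensorComul, leftLegs_tmul, mul_tmul_mulR₂]

variable {Q} {Δ : Q.Dual →ₙₐ[ℂ] Mult (Q.Dual ⊗[ℂ] Q.Dual)} {V : Mult (Q.Dual ⊗[ℂ] A)}

theorem IsDualComul.lmul_comulTensorId_fourierFlip (hΔ : Q.IsDualComul Δ) (b₁ : Q.Dual)
    (c₂ a' : A) (w : A ⊗[ℂ] A) :
    (Q.comulTensorId Δ (Q.fourierFlip w)).lmul (b₁ ⊗ₜ (Q.fourier c₂ ⊗ₜ a')) =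
      (tmul (incl _ b₁) (tmul 1 (incl A a'))).rmul
        (Q.fourierTwo (Q.can₃.symm.lTensor A (TensorProduct.assoc ℂ A A A (w ⊗ₜ c₂)))) := by
  have assoc_mulR₁_tmul (a : A) (v : A ⊗[ℂ] A) :
      TensorProduct.assoc ℂ _ _ _
          (mulR₁ b₁ (TensorProduct.map Q.fourier Q.fourier v) ⊗ₜ (a * a')) =
        (tmul (incl _ b₁) (tmul 1 (incl A a'))).rmul (Q.fourierTwo (a ⊗ₜ v)) :=
    LinearMap.congr_fun
      (f := (TensorProduct.assoc ℂ _ _ _).toLinearMap ∘ₗ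
        (TensorProduct.mk ℂ (Q.Dual ⊗[ℂ] Q.Dual) A).flip (a * a') ∘ₗ mulR₁ b₁ ∘ₗ
          TensorProduct.map Q.fourier Q.fourier)
      (g := (tmul (incl _ b₁) (tmul 1 (incl A a'))).rmul ∘ₗ Q.fourierTwo ∘ₗ
        TensorProduct.mk ℂ A (A ⊗[ℂ] A) a)
      (TensorProduct.ext' fun _ _ => by simp) v
  induction w with
  | zero => simp
  | add s t hs ht => simp only [map_add, Mult.lmul_add, TensorProduct.add_tmul, hs, ht]
  | tmul a c =>
    rw [fourierFlip_tmul, lmul_comulTensorId,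
      Q.lmul_tmul_fourier (hΔ _) (LinearEquiv.apply_symm_apply Q.can₃ (c ⊗ₜ c₂)),
      assoc_mulR₁_tmul, TensorProduct.assoc_tmul, LinearEquiv.lTensor_tmul]

namespace IsDuality

theorem lmul_leg12_fourierLast (hV : Q.IsDuality V) (t : A ⊗[ℂ] (A ⊗[ℂ] A)) :
    (leg12 A V).lmul (Q.fourierLast (outerLegs Q.can₃ t)) = Q.fourierLast t := by
  refine LinearMap.congr_fun
    (f := (leg12 A V).lmul ∘ₗ Q.fourierLast ∘ₗ (outerLegs Q.can₃).toLinearMap)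
    (TensorProduct.ext_threefold' fun x y c => ?_) t
  change (leg12 A V).lmul (Q.fourierLast (outerLegs Q.can₃ (x ⊗ₜ (y ⊗ₜ c)))) = _
  rw [outerLegs_tmul, fourierLast_lTensor_comm_assoc, lmul_leg12, hV.lmul_fourierFlip_can₃]
  rfl

theorem lmul_leg13_fourierLast (hV : Q.IsDuality V) (t : A ⊗[ℂ] (A ⊗[ℂ] A)) :
    (leg13 A V).lmul (Q.fourierLast (Q.can₃.lTensor A t)) = Q.fourierLast t :=
  LinearMap.congr_fun
    (f := (leg13 A V).lmul ∘ₗ Q.fourierLast ∘ₗ (Q.can₃.lTensor A).toLinearMap)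
    (TensorProduct.ext' fun x w => by
      simp [fourierLast_tmul, lmul_leg13, hV.lmul_fourierFlip_can₃]) t

theorem lmul_leg23_fourierTwo (hV : Q.IsDuality V) (t : A ⊗[ℂ] (A ⊗[ℂ] A)) :
    (leg23 Q.Dual V).lmul (Q.fourierTwo (outerLegs Q.can₃ t)) = Q.fourierTwo t := by
  refine LinearMap.congr_fun
    (f := (leg23 Q.Dual V).lmul ∘ₗ Q.fourierTwo ∘ₗ (outerLegs Q.can₃).toLinearMap)
    (TensorProduct.ext_threefold' fun x y z => ?_) t
  change (leg23 Q.Dual V).lmul (Q.fourierTwo (outerLegs Q.can₃ (x ⊗ₜ (y ⊗ₜ z)))) = _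
  rw [outerLegs_tmul, fourierTwo_lTensor_comm_assoc, leg23, lmul_tmul, hV.lmul_fourierFlip_can₃]
  rfl

theorem lmul_leg13_fourierTwo (hV : Q.IsDuality V) (t : A ⊗[ℂ] (A ⊗[ℂ] A)) :
    (leg13 Q.Dual V).lmul (Q.fourierTwo (leftLegs Q.can₃ t)) = Q.fourierTwo t := by
  refine LinearMap.congr_fun
    (f := (leg13 Q.Dual V).lmul ∘ₗ Q.fourierTwo ∘ₗ (leftLegs Q.can₃).toLinearMap)
    (TensorProduct.ext_threefold' fun x y z => ?_) t
  change (leg13 Q.Dual V).lmul (Q.fourierTwo (leftLegs Q.can₃ (x ⊗ₜ (y ⊗ₜ z)))) = _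
  rw [leftLegs_tmul, fourierTwo_assoc, lmul_leg13, hV.lmul_fourierFlip_can₃, ← fourierTwo_assoc]
  rfl

theorem lmul_leg12_mul_leg13 (hV : Q.IsDuality V) (t : A ⊗[ℂ] (A ⊗[ℂ] A)) :
    (leg12 A V * leg13 A V).lmul (Q.fourierLast (leftLegs Q.can₃ (Q.can₃.lTensor A t))) =
      Q.fourierLast (leftLegs Q.can₃ t) := by
  rw [← Q.pentagon_can₃, Mult.lmul_mul, hV.lmul_leg13_fourierLast,
    hV.lmul_leg12_fourierLast]

theorem lmul_leg13_mul_leg23 (hV : Q.IsDuality V) (t : A ⊗[ℂ] (A ⊗[ℂ] A)) :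
    (leg13 Q.Dual V * leg23 Q.Dual V).lmul
        (Q.fourierTwo (Q.can₃.symm.lTensor A (leftLegs Q.can₃ t))) =
      Q.fourierTwo (Q.can₃.symm.lTensor A t) := by
  obtain ⟨s, rfl⟩ := (Q.can₃.lTensor A).surjective t
  rw [← Q.pentagon_can₃, ← LinearEquiv.symm_lTensor, LinearEquiv.symm_apply_apply,
    LinearEquiv.symm_apply_apply, Mult.lmul_mul, hV.lmul_leg23_fourierTwo,
    hV.lmul_leg13_fourierTwo]

theorem extend_idTensorComul (hV : Q.IsDuality V) (h : IsNondegenerateHom Q.idTensorComul) :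
    h.extend V = leg12 A V * leg13 A V := by
  refine h.extend_eq fun s y => ?_
  obtain ⟨v, rfl⟩ := (Q.fourierFlip_surjective.comp Q.can₃.surjective) s
  refine LinearMap.congr_fun
    (f := (leg12 A V * leg13 A V).lmul ∘ₗ (Q.idTensorComul (Q.fourierFlip (Q.can₃ v))).lmul)
    (g := (Q.idTensorComul (V.lmul (Q.fourierFlip (Q.can₃ v)))).lmul)
    (TensorProduct.ext_threefold' fun b₁ a₁ a₂ => ?_) y
  rw [hV.lmul_fourierFlip_can₃, LinearMap.comp_apply, lmul_idTensorComul_fourierFlip,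
    lmul_idTensorComul_fourierFlip, Mult.lmul_rmul_comm, ← hV.lmul_leg12_mul_leg13 (a₁ ⊗ₜ v),
    LinearEquiv.lTensor_tmul]

theorem extend_comulTensorId (hV : Q.IsDuality V) (hΔ : Q.IsDualComul Δ)
    (h : IsNondegenerateHom (Q.comulTensorId Δ)) :
    h.extend V = leg13 Q.Dual V * leg23 Q.Dual V := by
  refine h.extend_eq fun s y => ?_
  obtain ⟨v, rfl⟩ := (Q.fourierFlip_surjective.comp Q.can₃.surjective) s
  refine LinearMap.congr_fun
    (f := (leg13 Q.Dual V * leg23 Q.Dual V).lmul ∘ₗ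
      (Q.comulTensorId Δ (Q.fourierFlip (Q.can₃ v))).lmul)
    (g := (Q.comulTensorId Δ (V.lmul (Q.fourierFlip (Q.can₃ v)))).lmul)
    (TensorProduct.ext_threefold' fun b₁ b₂ a' => ?_) y
  obtain ⟨c₂, rfl⟩ := Q.fourier_surjective b₂
  rw [hV.lmul_fourierFlip_can₃, LinearMap.comp_apply, hΔ.lmul_comulTensorId_fourierFlip,
    hΔ.lmul_comulTensorId_fourierFlip, Mult.lmul_rmul_comm, ← leftLegs_assoc,
    hV.lmul_leg13_mul_leg23]

end IsDuality

end AlgebraicQuantumGroup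

end MultiplierHopf

end

open MultiplierHopf in
theorem mainTheorem3 {A : Type*} [NonUnitalRing A] [Module ℂ A] [IsScalarTower ℂ A A]
    [SMulCommClass ℂ A A] [NondegenerateMul A] (Q : AlgebraicQuantumGroup A) :
    (∃! Δ : Q.Dual →ₙₐ[ℂ] Mult (Q.Dual ⊗[ℂ] Q.Dual), Q.IsDualComul Δ) ∧
    (∃! V : Mult (Q.Dual ⊗[ℂ] A), Q.IsDuality V) ∧
    ∀ (Δ : Q.Dual →ₙₐ[ℂ] Mult (Q.Dual ⊗[ℂ] Q.Dual)) (V : Mult (Q.Dual ⊗[ℂ] A)),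
      Q.IsDualComul Δ → Q.IsDuality V →
      (∃ h : IsNondegenerateHom Q.idTensorComul,
        h.extend V = leg12 A V * leg13 A V) ∧
      (∃ h : IsNondegenerateHom (Q.comulTensorId Δ),
        h.extend V = leg13 Q.Dual V * leg23 Q.Dual V) :=
  ⟨Q.existsUnique_dualComul, Q.existsUnique_duality, fun _ _ hΔ hV =>
    ⟨⟨Q.isNondegenerateHom_idTensorComul, hV.extend_idTensorComul _⟩,
      ⟨hΔ.isNondegenerateHom_comulTensorId, hV.extend_comulTensorId hΔ _⟩⟩⟩
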